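/- **Theorem (the elliptic case).** Let $M$ be a 6-dimensional oriented smooth manifold, let $H\subset TM$ be a smooth subbundle of rank $4$, and put $Q=TM/H$. Let $\mathcal L\in\Gamma(\Lambda^2H^*\otimes Q)$ be the Levi form, $\mathcal L(\xi,\eta)=[\xi,\eta]\bmod H$ for $\xi,\eta\in\Gamma(H)$. Suppose that $(M,H)$ is elliptic, that is, at every point $\mathcal L\wedge\mathcal L\in\Lambda^4H^*\otimes\bigodot^2Q$, regarded as a quadratic form on $Q^*$ defined up to a non-zero real factor, is (positive or negative) definite. 1. There is a unique smooth almost complex structure $J:TM\to TM$ such that - $J$ preserves $H$; - the orientation on $M$ induced by $J$, in which the bases $e_1,Je_1,e_2,Je_2,e_3,Je_3$ are positive, is the given one; - $\mathcal L:H\times H\to Q$ is complex bilinear for the complex structures induced by $J$ on $H$ and $Q$; - $[\xi,\eta]+J[J\xi,\eta]-J[\xi,J\eta]+[J\xi,J\eta]\in\Gamma(H)$ for all $\xi\in\Gamma(TM)$, $\eta\in\Gamma(H)$. For any almost complex structure $J$ preserving $H$, the third property is equivalent to $[\xi,\eta]+J[J\xi,\eta]\in\Gamma(H)$ for all $\xi,\eta\in\Gamma(H)$.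 2. For this $J$ there is a unique tensor $S:Q\otimes H\to Q$ with $$S(\xi \bmod H,\eta)=[\xi,\eta]+J[J\xi,\eta]\bmod H\qquad\text{for }\xi\in\Gamma(TM),\ \eta\in\Gamma(H),$$ and $S$ is the obstruction to the integrability of $J$: one has $S=0$ if and only if the Nijenhuis tensor $$N(\xi,\eta)=[\xi,\eta]+J[J\xi,\eta]+J[\xi,J\eta]-[J\xi,J\eta],\qquad \xi,\eta\in\Gamma(TM),$$ vanishes. -/

import Mathlib

open scoped Manifold ContDiff Topology TensorProduct Bundle

noncomputable section

namespace SixDim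

/-- The model space of a six-dimensional manifold. -/
abbrev E6 : Type := EuclideanSpace ℝ (Fin 6)

/-! ### The wedge square of a vector-valued two-form -/

section LinearAlgebra

variable {V W : Type*} [AddCommGroup V] [Module ℝ V] [AddCommGroup W] [Module ℝ W]

/-- For `L ∈ Λ²V* ⊗ W`, the wedge square `L ∧ L ∈ Λ⁴V* ⊗ (W ⊗ W)`; its values are symmetric
tensors. -/
def wedgeSq (L : V [⋀^Fin 2]→ₗ[ℝ] W) : V [⋀^Fin 2 ⊕ Fin 2]→ₗ[ℝ] (W ⊗[ℝ] W) :=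
  L.domCoprod L

/-- The quadratic form `ψ ↦ (ψ ⊗ ψ) (t)` on `W*` defined by a tensor `t ∈ W ⊗ W`. -/
def quadOfTensor (t : W ⊗[ℝ] W) : QuadraticForm ℝ (Module.Dual ℝ W) :=
  LinearMap.BilinMap.toQuadraticMap
    ((TensorProduct.mk ℝ (Module.Dual ℝ W) (Module.Dual ℝ W)).compr₂
      ((TensorProduct.dualDistrib ℝ W W).flip t))

/-- `L ∧ L` is definite. A basis of the four-dimensional space `V` identifies `Λ⁴V*` with `ℝ`, so
that `L ∧ L` becomes a quadratic form on `W*`; another basis changes it by a non-zero factor. -/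
def WedgeSqDefinite (L : V [⋀^Fin 2]→ₗ[ℝ] W) : Prop :=
  ∃ b : Module.Basis (Fin 2 ⊕ Fin 2) ℝ V,
    (quadOfTensor (wedgeSq L b)).PosDef ∨ (-quadOfTensor (wedgeSq L b)).PosDef

end LinearAlgebra

variable {M : Type*} [TopologicalSpace M] [ChartedSpace E6 M] [IsManifold (𝓡 6) ∞ M]

/-- The vector field `X` is smooth, that is `X ∈ Γ(TM)`. -/
def IsSmoothField (X : Π x : M, TangentSpace (𝓡 6) x) : Prop :=
  ContMDiff (𝓡 6) (𝓡 6).tangent ∞ (fun x => (X x : TangentBundle (𝓡 6) M))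

/-! ### Distributions -/

variable (M) in
/-- A smooth distribution of rank `r`: a field of subspaces of the tangent spaces which is locally
spanned by `r` pointwise linearly independent smooth vector fields. -/
structure Distribution (r : ℕ) where
  fiber : Π x : M, Submodule ℝ (TangentSpace (𝓡 6) x)
  exists_frame : ∀ x : M, ∃ U ∈ 𝓝 x, ∃ s : Fin r → Π y : M, TangentSpace (𝓡 6) y,
    (∀ i, ContMDiffOn (𝓡 6) (𝓡 6).tangent ∞
      (fun y => (s i y : TangentBundle (𝓡 6) M)) U) ∧
    ∀ y ∈ U, LinearIndependent ℝ (fun i => s i y) ∧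
      Submodule.span ℝ (Set.range (fun i => s i y)) = fiber y

namespace Distribution

variable {r : ℕ} (D : Distribution M r)

/-- The fibre `T_x M / D_x` of the quotient bundle. -/
abbrev Quot (x : M) : Type := TangentSpace (𝓡 6) x ⧸ D.fiber x

/-- The vector field `X` takes values in the distribution. -/
def Contains (X : Π x : M, TangentSpace (𝓡 6) x) : Prop := ∀ x, X x ∈ D.fiber x

/-- `X ∈ Γ(D)`: a smooth vector field with values in the distribution. -/
def IsSection (X : Π x : M, TangentSpace (𝓡 6) x) : Prop := IsSmoothField X ∧ D.Contains X

/-- Germ at `x` of a smooth section of the distribution. -/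
def IsSectionAt (X : Π x : M, TangentSpace (𝓡 6) x) (x : M) : Prop :=
  ContMDiffAt (𝓡 6) (𝓡 6).tangent ∞ (fun y => (X y : TangentBundle (𝓡 6) M)) x ∧
    ∀ᶠ y in 𝓝 x, X y ∈ D.fiber y

/-- Coefficients of a section with respect to a local frame are differentiable. -/
theorem exists_coeff {x : M} {U : Set M} (hU : U ∈ 𝓝 x)
    {s : Fin r → Π y : M, TangentSpace (𝓡 6) y}
    (hs : ∀ i, ContMDiffOn (𝓡 6) (𝓡 6).tangent ∞
      (fun y => (s i y : TangentBundle (𝓡 6) M)) U)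
    (hli : ∀ y ∈ U, LinearIndependent ℝ (fun i => s i y) ∧
      Submodule.span ℝ (Set.range (fun i => s i y)) = D.fiber y)
    {ζ : Π y : M, TangentSpace (𝓡 6) y} (hζ : D.IsSectionAt ζ x) :
    ∃ f : Fin r → M → ℝ, (∀ i, MDifferentiableAt (𝓡 6) 𝓘(ℝ, ℝ) (f i) x) ∧
      ∀ᶠ y in 𝓝 x, ζ y = ∑ i, f i y • s i y := by
  set e := trivializationAt E6 (TangentSpace (𝓡 6) : M → Type _) x with he
  have hxe : x ∈ e.baseSet := FiberBundle.mem_baseSet_trivializationAt' x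
  let φ : (Π y : M, TangentSpace (𝓡 6) y) → M → E6 := fun X y => e.continuousLinearMapAt ℝ y (X y)
  have hφ : ∀ X : Π y : M, TangentSpace (𝓡 6) y,
      ContMDiffAt (𝓡 6) (𝓡 6).tangent ∞ (fun y => (X y : TangentBundle (𝓡 6) M)) x →
      ContMDiffAt (𝓡 6) 𝓘(ℝ, E6) 1 (φ X) x := by
    intro X hX
    have h1 := (Bundle.contMDiffAt_section x).1 hX
    refine (h1.of_le (by exact_mod_cast le_top)).congr_of_eventuallyEq ?_
    filter_upwards [e.open_baseSet.mem_nhds hxe] with y hy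
    simp only [φ]
    rw [Bundle.Trivialization.continuousLinearMapAt_apply,
      Bundle.Trivialization.coe_linearMapAt_of_mem _ hy]
  have hsx : ∀ i, ContMDiffAt (𝓡 6) 𝓘(ℝ, E6) 1 (φ (s i)) x := fun i =>
    hφ _ ((hs i).contMDiffAt hU)
  have hζx := (hφ ζ hζ.1).mdifferentiableAt one_ne_zero
  have hxU : x ∈ U := mem_of_mem_nhds hU
  -- a left inverse of the frame matrix at `x`
  have hlix : LinearIndependent ℝ (fun i => φ (s i) x) := by
    have h := (hli x hxU).1.map' (e.continuousLinearEquivAt ℝ x hxe).toLinearEquiv.toLinearMap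
      (LinearEquiv.ker _)
    have heq : (fun i => φ (s i) x) = (e.continuousLinearEquivAt ℝ x hxe) ∘ fun i => s i x :=
      funext fun i => (congrFun (e.coe_continuousLinearEquivAt_eq (R := ℝ) hxe) (s i x)).symm
    rw [heq]
    exact h
  obtain ⟨A, hA⟩ : ∃ A : E6 →ₗ[ℝ] (Fin r → ℝ), ∀ i, A (φ (s i) x) = Pi.single i 1 := by
    obtain ⟨A, hA⟩ := LinearMap.exists_extend
      (p := Submodule.span ℝ (Set.range fun i => φ (s i) x))
      ((Finsupp.linearEquivFunOnFinite ℝ ℝ (Fin r)).toLinearMap ∘ₗ hlix.repr)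
    refine ⟨A, fun i => ?_⟩
    have hm : φ (s i) x ∈ Submodule.span ℝ (Set.range fun i => φ (s i) x) :=
      Submodule.subset_span ⟨i, rfl⟩
    have := LinearMap.congr_fun hA ⟨_, hm⟩
    simp only [LinearMap.comp_apply, Submodule.subtype_apply] at this
    rw [this, hlix.repr_eq_single i ⟨_, hm⟩ rfl]
    simp
  let A' : E6 →L[ℝ] (Fin r → ℝ) := LinearMap.toContinuousLinearMap A
  have hA' : ∀ i, A' (φ (s i) x) = Pi.single i 1 := hA
  let G : M → ((Fin r → ℝ) →L[ℝ] (Fin r → ℝ)) := fun y =>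
    ∑ i, (ContinuousLinearMap.proj (R := ℝ) (φ := fun _ : Fin r => ℝ) i).smulRight
      (A' (φ (s i) y))
  have hGx : G x = 1 := by
    ext v j
    simp [G, hA', Pi.single_apply, Finset.sum_apply]
  have hGd : MDifferentiableAt (𝓡 6) 𝓘(ℝ, (Fin r → ℝ) →L[ℝ] (Fin r → ℝ)) G x := by
    let Λ : (Fin r → E6) → ((Fin r → ℝ) →L[ℝ] (Fin r → ℝ)) := fun w =>
      ∑ i, (ContinuousLinearMap.proj (R := ℝ) (φ := fun _ : Fin r => ℝ) i).smulRight (A' (w i))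
    have hΛ : Differentiable ℝ Λ := by
      intro w
      apply DifferentiableAt.fun_sum
      intro i _
      have h2 : DifferentiableAt ℝ (fun w : Fin r → E6 => A' (w i)) w :=
        A'.differentiableAt.comp w (differentiableAt_apply i w)
      exact ((ContinuousLinearMap.smulRightL ℝ (Fin r → ℝ) (Fin r → ℝ)
        (ContinuousLinearMap.proj (R := ℝ) (φ := fun _ : Fin r => ℝ) i)).differentiableAt).comp w h2
    have hpi : MDifferentiableAt (𝓡 6) 𝓘(ℝ, Fin r → E6) (fun y i => φ (s i) y) x :=
      (contMDiffAt_pi_space.2 hsx).mdifferentiableAt one_ne_zero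
    exact (hΛ _).mdifferentiableAt.comp x hpi
  have hinv : MDifferentiableAt (𝓡 6) 𝓘(ℝ, (Fin r → ℝ) →L[ℝ] (Fin r → ℝ))
      (fun y => Ring.inverse (G y)) x := by
    have h3 : DifferentiableAt ℝ
        (Ring.inverse : ((Fin r → ℝ) →L[ℝ] (Fin r → ℝ)) → _) (G x) :=
      differentiableAt_inverse (by rw [hGx]; exact isUnit_one)
    exact h3.mdifferentiableAt.comp x hGd
  have hGu : ∀ᶠ y in 𝓝 x, IsUnit (G y) :=
    hGd.continuousAt.eventually (Units.isOpen.mem_nhds (by rw [hGx]; exact isUnit_one))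
  let F : M → Fin r → ℝ := fun y => Ring.inverse (G y) (A' (φ ζ y))
  have hF : MDifferentiableAt (𝓡 6) 𝓘(ℝ, Fin r → ℝ) F x := by
    have h4 : MDifferentiableAt (𝓡 6) 𝓘(ℝ, Fin r → ℝ) (fun y => A' (φ ζ y)) x :=
      A'.differentiableAt.mdifferentiableAt.comp x hζx
    exact hinv.clm_apply h4
  refine ⟨fun i y => F y i, fun i =>
    (ContinuousLinearMap.proj (R := ℝ) (φ := fun _ : Fin r => ℝ) i).differentiableAt
      |>.mdifferentiableAt.comp x hF, ?_⟩
  filter_upwards [hU, hGu, hζ.2] with y hyU hyG hyζ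
  rw [← (hli y hyU).2] at hyζ
  obtain ⟨c, hc⟩ := (Submodule.mem_span_range_iff_exists_fun ℝ).1 hyζ
  have hFc : F y = c := by
    have h5 : A' (φ ζ y) = G y c := by
      simp only [φ, ← hc, map_sum, map_smul, G, sum_apply,
        ContinuousLinearMap.smulRight_apply, ContinuousLinearMap.proj_apply]
    simp only [F, h5]
    rw [← mul_apply_eq_comp, Ring.inverse_mul_cancel _ hyG]
    rfl
  rw [hFc, hc]

theorem mkQ_bracket_eq_sum {x : M} {U : Set M} (hU : U ∈ 𝓝 x)
    {s : Fin r → Π y : M, TangentSpace (𝓡 6) y}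
    (hs : ∀ i, ContMDiffOn (𝓡 6) (𝓡 6).tangent ∞
      (fun y => (s i y : TangentBundle (𝓡 6) M)) U)
    (hm : ∀ i, s i x ∈ D.fiber x)
    {ζ W : Π y : M, TangentSpace (𝓡 6) y} {f : Fin r → M → ℝ}
    (hf : ∀ i, MDifferentiableAt (𝓡 6) 𝓘(ℝ, ℝ) (f i) x)
    (hζ : ∀ᶠ y in 𝓝 x, ζ y = ∑ i, f i y • s i y) :
    (D.fiber x).mkQ (VectorField.mlieBracket (𝓡 6) ζ W x) =
      ∑ i, f i x • (D.fiber x).mkQ (VectorField.mlieBracket (𝓡 6) (s i) W x) := by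
  have hsd : ∀ i, MDifferentiableAt (𝓡 6) (𝓡 6).tangent
      (fun y => (s i y : TangentBundle (𝓡 6) M)) x := fun i =>
    ((hs i).contMDiffAt hU).mdifferentiableAt (by simp)
  have h1 : VectorField.mlieBracket (𝓡 6) ζ W x =
      VectorField.mlieBracket (𝓡 6) (∑ i, f i • s i) W x := by
    refine Filter.EventuallyEq.mlieBracket_vectorField_eq ?_ Filter.EventuallyEq.rfl
    filter_upwards [hζ] with y hy
    rw [hy, Finset.sum_apply]
    rfl
  have h2 : ∀ t : Finset (Fin r),
      MDifferentiableAt (𝓡 6) (𝓡 6).tangent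
        (fun y => ((∑ i ∈ t, f i • s i) y : TangentBundle (𝓡 6) M)) x ∧
      (D.fiber x).mkQ (VectorField.mlieBracket (𝓡 6) (∑ i ∈ t, f i • s i) W x) =
        ∑ i ∈ t, f i x • (D.fiber x).mkQ (VectorField.mlieBracket (𝓡 6) (s i) W x) := by
    intro t
    induction t using Finset.induction_on with
    | empty =>
      refine ⟨?_, ?_⟩
      · exact Bundle.mdifferentiableAt_zeroSection ..
      · simp [VectorField.mlieBracket_zero_left]
    | insert a t ha ih =>
      have h3 : MDifferentiableAt (𝓡 6) (𝓡 6).tangent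
          (fun y => ((f a • s a) y : TangentBundle (𝓡 6) M)) x := (hf a).smul_section (hsd a)
      refine ⟨?_, ?_⟩
      · rw [Finset.sum_insert ha]
        exact mdifferentiableAt_add_section h3 ih.1
      · rw [Finset.sum_insert ha, Finset.sum_insert ha,
          VectorField.mlieBracket_add_left h3 ih.1, map_add, ih.2,
          VectorField.mlieBracket_smul_left (hf a) (hsd a), map_add, map_smul, map_smul]
        have h4 : (D.fiber x).mkQ (s a x) = 0 := by simpa using hm a
        rw [h4, smul_zero, zero_add]
  rw [h1, (h2 Finset.univ).2]

/-- The bracket modulo `D` of two sections of `D` is tensorial. -/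
theorem exists_leviForm (x : M) :
    ∃ L : D.fiber x [⋀^Fin 2]→ₗ[ℝ] D.Quot x,
      ∀ (ξ η : Π y : M, TangentSpace (𝓡 6) y) (u v : D.fiber x),
        D.IsSectionAt ξ x → D.IsSectionAt η x → ξ x = u → η x = v →
        L ![u, v] = (D.fiber x).mkQ (VectorField.mlieBracket (𝓡 6) ξ η x) := by
  obtain ⟨U, hU, s, hs, hli⟩ := D.exists_frame x
  have hxU : x ∈ U := mem_of_mem_nhds hU
  have hm : ∀ i, s i x ∈ D.fiber x := fun i => by
    rw [← (hli x hxU).2]; exact Submodule.subset_span ⟨i, rfl⟩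
  have hlx : LinearIndependent ℝ (fun i => (⟨s i x, hm i⟩ : D.fiber x)) :=
    LinearIndependent.of_comp (D.fiber x).subtype (hli x hxU).1
  have hsp : ⊤ ≤ Submodule.span ℝ (Set.range fun i => (⟨s i x, hm i⟩ : D.fiber x)) := by
    rintro ⟨u, hu⟩ -
    rw [← (hli x hxU).2] at hu
    obtain ⟨c, hc⟩ := (Submodule.mem_span_range_iff_exists_fun ℝ).1 hu
    refine (Submodule.mem_span_range_iff_exists_fun ℝ).2 ⟨c, ?_⟩
    ext1
    simpa using hc
  let b := Module.Basis.mk hlx hsp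
  have hb : ∀ i, (b i : TangentSpace (𝓡 6) x) = s i x := fun i => by simp [b]
  let B : D.fiber x →ₗ[ℝ] D.fiber x →ₗ[ℝ] D.Quot x := b.constr ℝ fun i => b.constr ℝ fun j =>
    (D.fiber x).mkQ (VectorField.mlieBracket (𝓡 6) (s i) (s j) x)
  have hBb : ∀ i j, B (b i) (b j) =
      (D.fiber x).mkQ (VectorField.mlieBracket (𝓡 6) (s i) (s j) x) := fun i j => by
    simp only [B, Module.Basis.constr_basis]
  have hskew : ∀ u v, B u v = - B v u := by
    have : B = - B.flip := by
      refine b.ext fun i => b.ext fun j => ?_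
      simp only [LinearMap.neg_apply, LinearMap.flip_apply, hBb]
      rw [VectorField.mlieBracket_swap_apply, map_neg]
    intro u v
    conv_lhs => rw [this]
    rfl
  have halt : ∀ u, B u u = 0 := fun u => by
    have h := hskew u u
    have h2 : (2 : ℝ) • B u u = 0 := by rw [two_smul]; nth_rewrite 1 [h]; simp
    exact (smul_eq_zero.1 h2).resolve_left two_ne_zero
  let L : D.fiber x [⋀^Fin 2]→ₗ[ℝ] D.Quot x :=
    { toFun := fun v => B (v 0) (v 1)
      map_update_add' := by
        intro _ m i y z
        fin_cases i <;> simp [Function.update]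
      map_update_smul' := by
        intro _ m i c y
        fin_cases i <;> simp [Function.update]
      map_eq_zero_of_eq' := by
        intro v i j hij hne
        have h01 : v 0 = v 1 := by
          fin_cases i <;> fin_cases j
          · exact absurd rfl hne
          · exact hij
          · exact hij.symm
          · exact absurd rfl hne
        rw [h01]
        exact halt _ }
  refine ⟨L, fun ξ η u v hξ hη hu hv => ?_⟩
  obtain ⟨f, hf, hfξ⟩ := D.exists_coeff hU hs hli hξ
  obtain ⟨g, hg, hgη⟩ := D.exists_coeff hU hs hli hη
  have hu' : u = ∑ i, f i x • b i := by
    ext1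
    rw [← hu, hfξ.self_of_nhds]
    simp [hb]
  have hv' : v = ∑ i, g i x • b i := by
    ext1
    rw [← hv, hgη.self_of_nhds]
    simp [hb]
  change B u v = _
  rw [D.mkQ_bracket_eq_sum hU hs hm hf hfξ, hu', map_sum, LinearMap.sum_apply]
  refine Finset.sum_congr rfl fun i _ => ?_
  rw [map_smul, LinearMap.smul_apply, VectorField.mlieBracket_swap_apply, map_neg,
    D.mkQ_bracket_eq_sum hU hs hm hg hgη, hskew, hv', map_sum, LinearMap.sum_apply]
  congr 2
  refine Finset.sum_congr rfl fun j _ => ?_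
  rw [map_smul, LinearMap.smul_apply, hBb]

/-- The Levi form at `x`, a two-form on `D_x` with values in `T_x M / D_x`. -/
def leviForm (x : M) : D.fiber x [⋀^Fin 2]→ₗ[ℝ] D.Quot x :=
  (D.exists_leviForm x).choose

/-- `L(ξ, η) = [ξ, η] mod D` for sections `ξ, η` of the distribution. This determines `L`. -/
theorem leviForm_apply (x : M) (ξ η : Π y : M, TangentSpace (𝓡 6) y) (u v : D.fiber x)
    (hξ : D.IsSectionAt ξ x) (hη : D.IsSectionAt η x) (hu : ξ x = u) (hv : η x = v) :
    D.leviForm x ![u, v] = (D.fiber x).mkQ (VectorField.mlieBracket (𝓡 6) ξ η x) :=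
  (D.exists_leviForm x).choose_spec ξ η u v hξ hη hu hv

end Distribution

/-- A rank four distribution is elliptic if the wedge square of its Levi form is everywhere
definite. -/
def IsElliptic (D : Distribution M 4) : Prop := ∀ x : M, WedgeSqDefinite (D.leviForm x)

/-! ### Orientations and almost complex structures -/

variable (M) in
/-- An orientation of `M`: an orientation of every tangent space, such that near every point there
is a smooth local frame which is positively oriented. -/
structure ManifoldOrientation where
  at_point : Π x : M, Orientation ℝ (TangentSpace (𝓡 6) x) (Fin 6)
  exists_frame : ∀ x : M, ∃ U ∈ 𝓝 x, ∃ s : Fin 6 → Π y : M, TangentSpace (𝓡 6) y,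
    ∃ hs : IsLocalFrameOn (𝓡 6) E6 ∞ s U,
      ∀ (y : M) (hy : y ∈ U), (hs.toBasisAt hy).orientation = at_point y

variable (M) in
/-- A smooth almost complex structure on `M`. -/
structure AlmostComplexStructure where
  toFun : Π x : M, TangentSpace (𝓡 6) x →L[ℝ] TangentSpace (𝓡 6) x
  smooth : ContMDiff (𝓡 6) ((𝓡 6).prod 𝓘(ℝ, E6 →L[ℝ] E6)) ∞
    (fun x => Bundle.TotalSpace.mk' (E6 →L[ℝ] E6)
      (E := fun y : M => TangentSpace (𝓡 6) y →L[ℝ] TangentSpace (𝓡 6) y) x (toFun x))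
  sq_eq_neg : ∀ (x : M) (v : TangentSpace (𝓡 6) x), toFun x (toFun x v) = -v

namespace AlmostComplexStructure

variable (J : AlmostComplexStructure M)

/-- The vector field `J X`. -/
def app (X : Π x : M, TangentSpace (𝓡 6) x) : Π x : M, TangentSpace (𝓡 6) x :=
  fun x => J.toFun x (X x)

/-- The orientation induced by `J` is `o`: the bases `e₁, J e₁, e₂, J e₂, e₃, J e₃` are
positively oriented. -/
def Induces (o : ManifoldOrientation M) : Prop :=
  ∀ (x : M) (b : Module.Basis (Fin 6) ℝ (TangentSpace (𝓡 6) x)),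
    b 1 = J.toFun x (b 0) → b 3 = J.toFun x (b 2) → b 5 = J.toFun x (b 4) →
    b.orientation = o.at_point x

/-- `N(ξ, η) = [ξ, η] + J[Jξ, η] + J[ξ, Jη] - [Jξ, Jη]`. -/
def nijenhuis (ξ η : Π x : M, TangentSpace (𝓡 6) x) : Π x : M, TangentSpace (𝓡 6) x :=
  VectorField.mlieBracket (𝓡 6) ξ η
    + J.app (VectorField.mlieBracket (𝓡 6) (J.app ξ) η)
    + J.app (VectorField.mlieBracket (𝓡 6) ξ (J.app η))
    - VectorField.mlieBracket (𝓡 6) (J.app ξ) (J.app η)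

/-- The Nijenhuis tensor of `J` vanishes. -/
def NijenhuisVanishes : Prop :=
  ∀ ξ η : Π x : M, TangentSpace (𝓡 6) x, IsSmoothField ξ → IsSmoothField η → J.nijenhuis ξ η = 0

/-- The vector field `[ξ, η] + J[Jξ, η]`. -/
def halfBracket (ξ η : Π x : M, TangentSpace (𝓡 6) x) : Π x : M, TangentSpace (𝓡 6) x :=
  VectorField.mlieBracket (𝓡 6) ξ η + J.app (VectorField.mlieBracket (𝓡 6) (J.app ξ) η)

/-- The vector field `[ξ, η] + J[Jξ, η] - J[ξ, Jη] + [Jξ, Jη]`. -/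
def fullBracket (ξ η : Π x : M, TangentSpace (𝓡 6) x) : Π x : M, TangentSpace (𝓡 6) x :=
  VectorField.mlieBracket (𝓡 6) ξ η
    + J.app (VectorField.mlieBracket (𝓡 6) (J.app ξ) η)
    - J.app (VectorField.mlieBracket (𝓡 6) ξ (J.app η))
    + VectorField.mlieBracket (𝓡 6) (J.app ξ) (J.app η)

variable {r : ℕ} (D : Distribution M r)

/-- `J` preserves the distribution. -/
def Preserves : Prop := ∀ x : M, ∀ v ∈ D.fiber x, J.toFun x v ∈ D.fiber x

variable {J D}

/-- The complex structure induced on the fibre of `D`. -/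
def onFiber (h : J.Preserves D) (x : M) : D.fiber x →ₗ[ℝ] D.fiber x :=
  (J.toFun x).toLinearMap.restrict (h x)

/-- The complex structure induced on the fibre of `TM / D`. -/
def onQuot (h : J.Preserves D) (x : M) : D.Quot x →ₗ[ℝ] D.Quot x :=
  (D.fiber x).mapQ (D.fiber x) (J.toFun x).toLinearMap (h x)

/-- The Levi form is complex bilinear for the induced complex structures. -/
def LeviComplexBilinear (h : J.Preserves D) : Prop :=
  ∀ (x : M) (u v : D.fiber x),
    D.leviForm x ![onFiber h x u, v] = onQuot h x (D.leviForm x ![u, v]) ∧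
    D.leviForm x ![u, onFiber h x v] = onQuot h x (D.leviForm x ![u, v])

end AlmostComplexStructure

/-- The four properties which characterise `J`. -/
structure IsAdapted (o : ManifoldOrientation M) (D : Distribution M 4)
    (J : AlmostComplexStructure M) : Prop where
  preserves : J.Preserves D
  orientation : J.Induces o
  bilinear : AlmostComplexStructure.LeviComplexBilinear preserves
  bracket : ∀ ξ η : Π x : M, TangentSpace (𝓡 6) x,
    IsSmoothField ξ → D.IsSection η → D.Contains (J.fullBracket ξ η)

/-- The tensor field `S : Q ⊗ D → Q`, where `Q = TM / D`, is induced by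
`S(ξ, η) = [ξ, η] + J[Jξ, η] mod D` for `ξ ∈ Γ(TM)` and `η ∈ Γ(D)`. -/
def IsInducedTensor (D : Distribution M 4) (J : AlmostComplexStructure M)
    (S : Π x : M, D.Quot x ⊗[ℝ] D.fiber x →ₗ[ℝ] D.Quot x) : Prop :=
  ∀ (ξ η : Π x : M, TangentSpace (𝓡 6) x), IsSmoothField ξ → ∀ hη : D.IsSection η, ∀ x : M,
    S x ((D.fiber x).mkQ (ξ x) ⊗ₜ[ℝ] (⟨η x, hη.2 x⟩ : D.fiber x))
      = (D.fiber x).mkQ (J.halfBracket ξ η x)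

end SixDim

end

/-!
The components `ψ ∘ L` of the Levi form `L` of `D`, for `ψ ≠ 0` in `Q*`, are non-degenerate
two-forms on the fibres of `D`: a kernel vector would annihilate `(ψ ∘ L) ∧ (ψ ∘ L)`, against
definiteness (`WedgeSqDefinite.exists_apply_ne_zero`). In an adapted frame they form a pencil of
skew-symmetric matrices spanned by `a` and `c`, on which the Pfaffian is definite. With the Hodge
dual `*`, for which `a a*` is minus the Pfaffian of `a`, the matrix `a c* - c a*` normalised by
the square root of the discriminant is a complex structure on `D` that preserves the pencil, and
it makes `L` complex bilinear for a corresponding complex structure on `Q = TM/D`; all the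
coefficients are smooth (`exists_isCompatibleOn`). The pair of complex structures on `D` and `Q`
is unique up to a common sign (`Nondegenerate.complexStructure_unique`). Since the complex
dimension of `TM` is odd, `J` and `-J` induce opposite orientations, and so the given orientation
fixes the sign.

What remains free is a map `Q → D`. For each vector field `ξ`, the class `F_ξ(η) = [ξ, η] + J[Jξ,
η] - J[ξ, Jη] + [Jξ, Jη] mod D` is tensorial in `ξ` and in `η ∈ Γ(D)`, complex linear in `η` and
antilinear in `ξ`, and it vanishes for `ξ ∈ Γ(D)` if `L` is complex bilinear. When `J` is replaced
by a `J'` that agrees with it on `D` and on `Q`, then `F_ξ(η)` changes by `2 J L(J'ξ - Jξ, η)`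
(`IsCompatibleOn.fullTensor_sub`). By non-degeneracy of `L` there is exactly one `J'` with `F = 0`
(`IsCompatibleOn.exists_fullTensor_eq_zero`, `IsAdaptedOn.unique`). Local uniqueness lets the
local solutions be glued (`exists_isAdaptedOn_univ`).

The class `[ξ, η] + J[Jξ, η] mod D` of the first two terms is tensorial as well and vanishes for
`ξ ∈ Γ(D)`; it is the tensor `S`. As `F = 0`, the Nijenhuis tensor satisfies `N(ξ, η) ≡ 2 S(ξ, η)
mod D` for `η ∈ Γ(D)`, and so `N = 0` implies `S = 0`. Conversely `S = 0` says that the bracket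
with sections of `D` is complex linear modulo `D` in the other argument. Then `N(ξ, η) ∈ Γ(D)`,
and the Jacobi identity gives `[N(ξ, η), ζ] ≡ N(ξ, [η, ζ])` modulo `D` for `η, ζ ∈ Γ(D)`. The
left-hand side is complex linear in `ζ` and the right-hand side is antilinear, so that `L(N(ξ, η),
ζ) = 0` (`two_lie_lieNijenhuis_mem`) and `N(ξ, η) = 0`. As `Q` has complex rank one and `N(ξ, ξ) =
N(ξ, Jξ) = 0`, it follows that `N = 0` (`nijenhuisVanishes_of_isSection`).
-/

noncomputable section

namespace SixDim

/-! ### Definite wedge squares -/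

section LinearAlgebra

variable {V W : Type*} [AddCommGroup V] [Module ℝ V] [AddCommGroup W] [Module ℝ W]

/-- A vector in the kernel of `ψ ∘ L` is in the kernel of `(ψ ∘ L) ∧ (ψ ∘ L)`. -/
theorem quadOfTensor_wedgeSq_eq_zero {L : V [⋀^Fin 2]→ₗ[ℝ] W} {ψ : Module.Dual ℝ W} {v : V}
    (h : ∀ w, ψ (L ![v, w]) = 0) {m : Fin 2 ⊕ Fin 2 → V} {k : Fin 2 ⊕ Fin 2} (hk : m k = v) :
    quadOfTensor (wedgeSq L m) ψ = 0 := by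
  have h' : ∀ w, ψ (L ![w, v]) = 0 := fun w => by
    have := L.map_swap ![v, w] (i := 0) (j := 1) (by decide)
    have h2 : (![v, w] ∘ Equiv.swap (0 : Fin 2) 1) = ![w, v] := by
      ext i; fin_cases i <;> rfl
    rw [h2] at this
    rw [this, map_neg, h, neg_zero]
  have key : ∀ n : Fin 2 → V, (∃ i, n i = v) → ψ (L n) = 0 := by
    rintro n ⟨i, hi⟩
    have hn : n = ![n 0, n 1] := by ext i; fin_cases i <;> rfl
    rw [hn]
    fin_cases i
    · change n 0 = v at hi
      rw [hi]; exact h _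
    · change n 1 = v at hi
      rw [hi]; exact h' _
  change TensorProduct.dualDistrib ℝ W W (ψ ⊗ₜ ψ) (L.domCoprod L m) = 0
  rw [AlternatingMap.domCoprod_apply, sum_apply, map_sum]
  refine Finset.sum_eq_zero fun σ _ => ?_
  induction σ using Quotient.inductionOn' with | _ σ
  rw [AlternatingMap.domCoprod.summand_mk'', smul_apply, map_zsmul_unit,
    MultilinearMap.domDomCongr_apply, MultilinearMap.domCoprod_apply,
    TensorProduct.dualDistrib_apply]
  obtain ⟨j, rfl⟩ := σ.surjective k
  have : ψ (L fun i => m (σ (Sum.inl i))) * ψ (L fun i => m (σ (Sum.inr i))) = 0 := by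
    rcases j with j | j
    · rw [key _ ⟨j, hk⟩, zero_mul]
    · rw [key (fun i => m (σ (Sum.inr i))) ⟨j, hk⟩, mul_zero]
  erw [this]
  exact smul_zero _

/-- If `L ∧ L` is definite, then each of the two-forms `ψ ∘ L` with `ψ ≠ 0` is non-degenerate: a
kernel vector completed to a basis makes every term of `(ψ ∘ L) ∧ (ψ ∘ L)` vanish. -/
theorem WedgeSqDefinite.exists_apply_ne_zero {L : V [⋀^Fin 2]→ₗ[ℝ] W} (hL : WedgeSqDefinite L)
    {ψ : Module.Dual ℝ W} (hψ : ψ ≠ 0) {v : V} (hv : v ≠ 0) : ∃ w, ψ (L ![v, w]) ≠ 0 := by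
  by_contra! h
  obtain ⟨b, hb⟩ := hL
  have hb0 : quadOfTensor (wedgeSq L b) ψ ≠ 0 := by
    rcases hb with hb | hb
    · exact (hb ψ hψ).ne'
    · have := (hb ψ hψ).ne'
      rw [neg_apply] at this
      exact fun h => this (by rw [h, neg_zero])
  refine hb0 ?_
  obtain ⟨k, hk⟩ : ∃ k, b.repr v k ≠ 0 := by
    by_contra! h0
    exact hv (b.repr.map_eq_zero_iff.1 (Finsupp.ext h0))
  let f : V [⋀^Fin 2 ⊕ Fin 2]→ₗ[ℝ] ℝ :=
    (TensorProduct.dualDistrib ℝ W W (ψ ⊗ₜ ψ)).compAlternatingMap (wedgeSq L)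
  have hf : ∀ m, f m = quadOfTensor (wedgeSq L m) ψ := fun m => rfl
  have h1 : f (Function.update b k v) = b.repr v k * f b := by
    conv_lhs => rw [← b.sum_repr v]
    rw [f.map_update_sum, Finset.sum_eq_single k]
    · rw [f.map_update_smul, Function.update_eq_self, smul_eq_mul]
    · intro i _ hik
      rw [f.map_update_smul, f.map_update_self _ hik.symm, smul_zero]
    · simp
  rw [hf, quadOfTensor_wedgeSq_eq_zero h (k := k) (by simp)] at h1
  rw [← hf]
  exact (mul_eq_zero.1 h1.symm).resolve_left hk

end LinearAlgebra

/-! ### Skew-symmetric matrices of size four -/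

/-- The polarised Pfaffian of two skew-symmetric matrices of size four: `pfaffPolar a a` is twice
the Pfaffian of `a`. -/
def pfaffPolar (a c : Matrix (Fin 4) (Fin 4) ℝ) : ℝ :=
  a 0 1 * c 2 3 + a 2 3 * c 0 1 - a 0 2 * c 1 3 - a 1 3 * c 0 2 + a 0 3 * c 1 2 + a 1 2 * c 0 3

/-- The Hodge dual of a skew-symmetric matrix of size four. -/
def skewDual (a : Matrix (Fin 4) (Fin 4) ℝ) : Matrix (Fin 4) (Fin 4) ℝ :=
  !![0, a 2 3, -a 1 3, a 1 2;
     -a 2 3, 0, a 0 3, -a 0 2;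
     a 1 3, -a 0 3, 0, a 0 1;
     -a 1 2, a 0 2, -a 0 1, 0]

theorem eq_of_skew {a : Matrix (Fin 4) (Fin 4) ℝ} (ha : ∀ i j, a i j = -a j i) :
    a = !![0, a 0 1, a 0 2, a 0 3;
           -a 0 1, 0, a 1 2, a 1 3;
           -a 0 2, -a 1 2, 0, a 2 3;
           -a 0 3, -a 1 3, -a 2 3, 0] := by
  have hd : ∀ i, a i i = 0 := fun i => by linarith [ha i i]
  ext i j
  fin_cases i <;> fin_cases j <;> simp [hd] <;> exact ha _ _

theorem mul_skewDual_add {a c : Matrix (Fin 4) (Fin 4) ℝ} (ha : ∀ i j, a i j = -a j i)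
    (hc : ∀ i j, c i j = -c j i) :
    a * skewDual c + c * skewDual a = (-pfaffPolar a c) • (1 : Matrix (Fin 4) (Fin 4) ℝ) := by
  rw [eq_of_skew ha, eq_of_skew hc]
  ext i j
  fin_cases i <;> fin_cases j <;>
    simp [skewDual, pfaffPolar] <;> ring

theorem skewDual_mul_add {a c : Matrix (Fin 4) (Fin 4) ℝ} (ha : ∀ i j, a i j = -a j i)
    (hc : ∀ i j, c i j = -c j i) :
    skewDual a * c + skewDual c * a = (-pfaffPolar a c) • (1 : Matrix (Fin 4) (Fin 4) ℝ) := by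
  rw [eq_of_skew ha, eq_of_skew hc]
  ext i j
  fin_cases i <;> fin_cases j <;>
    simp [skewDual, pfaffPolar] <;> ring

theorem mul_skewDual_self {a : Matrix (Fin 4) (Fin 4) ℝ} (ha : ∀ i j, a i j = -a j i) :
    a * skewDual a = (-(pfaffPolar a a / 2)) • (1 : Matrix (Fin 4) (Fin 4) ℝ) := by
  have h := mul_skewDual_add ha ha
  rw [← two_smul ℝ] at h
  have h2 := congrArg (fun m => (1 / 2 : ℝ) • m) h
  simp only [smul_smul] at h2
  norm_num at h2
  rw [h2]; module

theorem skewDual_mul_self {a : Matrix (Fin 4) (Fin 4) ℝ} (ha : ∀ i j, a i j = -a j i) :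
    skewDual a * a = (-(pfaffPolar a a / 2)) • (1 : Matrix (Fin 4) (Fin 4) ℝ) := by
  have h := skewDual_mul_add ha ha
  rw [← two_smul ℝ] at h
  have h2 := congrArg (fun m => (1 / 2 : ℝ) • m) h
  simp only [smul_smul] at h2
  norm_num at h2
  rw [h2]; module

/-- A skew-symmetric matrix of size four whose Pfaffian vanishes is degenerate. -/
theorem exists_vecMul_eq_zero_of_pfaffPolar {a : Matrix (Fin 4) (Fin 4) ℝ}
    (ha : ∀ i j, a i j = -a j i) (h0 : pfaffPolar a a = 0) :
    ∃ v : Fin 4 → ℝ, v ≠ 0 ∧ Matrix.vecMul v a = 0 := by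
  have h := skewDual_mul_self ha
  rw [h0, zero_div, neg_zero, zero_smul] at h
  by_cases hz : ∃ i, skewDual a i ≠ 0
  · obtain ⟨i, hi⟩ := hz
    refine ⟨_, hi, ?_⟩
    have := congrFun h i
    rw [Matrix.mul_apply_eq_vecMul] at this
    exact this
  · push Not at hz
    have e : ∀ i j, skewDual a i j = 0 := fun i j => by rw [hz i]; rfl
    have e1 := e 0 1
    have e2 := e 0 2
    have e3 := e 0 3
    have e4 := e 1 2
    have e5 := e 1 3
    have e6 := e 2 3
    simp [skewDual] at e1 e2 e3 e4 e5 e6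
    refine ⟨fun _ => 1, fun h => one_ne_zero (congrFun h 0), ?_⟩
    rw [eq_of_skew ha, e1, e2, e3, e4, e5, e6]
    ext j
    fin_cases j <;> simp [Matrix.vecMul, dotProduct, Fin.sum_univ_four]

/-- The discriminant of the quadratic form `(x, y) ↦ Pf (x a + y c)`, up to a positive factor. -/
def pfaffDisc (a c : Matrix (Fin 4) (Fin 4) ℝ) : ℝ :=
  pfaffPolar a a * pfaffPolar c c - pfaffPolar a c ^ 2

/-- If no real combination of `a` and `c` is degenerate, then the Pfaffian is definite on the
pencil that they span. -/
theorem pfaffDisc_pos {a c : Matrix (Fin 4) (Fin 4) ℝ} (ha : ∀ i j, a i j = -a j i)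
    (hc : ∀ i j, c i j = -c j i)
    (h : ∀ x y : ℝ, (x ≠ 0 ∨ y ≠ 0) → ∀ v : Fin 4 → ℝ, v ≠ 0 →
      Matrix.vecMul v (x • a + y • c) ≠ 0) :
    0 < pfaffDisc a c := by
  have hP : ∀ x y : ℝ, (x ≠ 0 ∨ y ≠ 0) →
      x ^ 2 * pfaffPolar a a + 2 * x * y * pfaffPolar a c + y ^ 2 * pfaffPolar c c ≠ 0 := by
    intro x y hxy h0
    have hs : ∀ i j, (x • a + y • c) i j = -(x • a + y • c) j i := fun i j => by
      simp only [Matrix.add_apply, Matrix.smul_apply, smul_eq_mul]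
      rw [ha i j, hc i j]; ring
    obtain ⟨v, hv, hv0⟩ := exists_vecMul_eq_zero_of_pfaffPolar hs (by
      rw [← h0]
      simp only [pfaffPolar, Matrix.add_apply, Matrix.smul_apply, smul_eq_mul]
      ring)
    exact h x y hxy v hv hv0
  by_contra! hd
  unfold pfaffDisc at hd
  have hA : pfaffPolar a a ≠ 0 := by simpa using hP 1 0 (by simp)
  -- a real root of the quadratic polynomial `Pf (x a + c)`
  refine hP ((-pfaffPolar a c + √(pfaffPolar a c ^ 2 - pfaffPolar a a * pfaffPolar c c)) /
    pfaffPolar a a) 1 (by simp) ?_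
  have hs := Real.sq_sqrt (by linarith :
    0 ≤ pfaffPolar a c ^ 2 - pfaffPolar a a * pfaffPolar c c)
  field_simp
  ring_nf
  ring_nf at hs
  rw [hs]
  ring

/-- The matrix `a c* - c a*`, where `*` is the Hodge dual, normalised so that its square is `-1` if
`pfaffDisc a c` is positive. -/
def pencilJ (a c : Matrix (Fin 4) (Fin 4) ℝ) : Matrix (Fin 4) (Fin 4) ℝ :=
  (√(pfaffDisc a c))⁻¹ • (a * skewDual c - c * skewDual a)

theorem pencilJ_swap (a c : Matrix (Fin 4) (Fin 4) ℝ) : pencilJ c a = -pencilJ a c := by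
  have h : pfaffDisc c a = pfaffDisc a c := by unfold pfaffDisc pfaffPolar; ring
  unfold pencilJ
  rw [h, ← smul_neg, neg_sub]

/-- Left multiplication by `pencilJ a c` preserves the pencil spanned by `a` and `c`. -/
theorem pencilJ_mul_left {a c : Matrix (Fin 4) (Fin 4) ℝ} (ha : ∀ i j, a i j = -a j i)
    (hc : ∀ i j, c i j = -c j i) :
    pencilJ a c * a = (√(pfaffDisc a c))⁻¹ • (pfaffPolar a a • c - pfaffPolar a c • a) := by
  rw [pencilJ, Matrix.smul_mul]
  congr 1
  have h1 := skewDual_mul_add ha hc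
  have h2 := skewDual_mul_self ha
  have h3 : skewDual c * a = (-pfaffPolar a c) • 1 - skewDual a * c := by
    rw [← h1]; abel
  have h4 := mul_skewDual_self ha
  rw [Matrix.sub_mul, Matrix.mul_assoc, Matrix.mul_assoc, h3, h2, Matrix.mul_sub,
    ← Matrix.mul_assoc, h4]
  simp only [Matrix.mul_smul, Matrix.smul_mul, Matrix.mul_one, Matrix.one_mul]
  module

theorem pencilJ_mul_right {a c : Matrix (Fin 4) (Fin 4) ℝ} (ha : ∀ i j, a i j = -a j i)
    (hc : ∀ i j, c i j = -c j i) :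
    pencilJ a c * c = (√(pfaffDisc a c))⁻¹ • (pfaffPolar a c • c - pfaffPolar c c • a) := by
  have h := pencilJ_mul_left hc ha
  have h1 : pfaffDisc c a = pfaffDisc a c := by unfold pfaffDisc pfaffPolar; ring
  have h2 : pfaffPolar c a = pfaffPolar a c := by unfold pfaffPolar; ring
  rw [pencilJ_swap, h1, h2, Matrix.neg_mul, neg_eq_iff_eq_neg] at h
  rw [h]
  module

theorem pencilJ_mul_self {a c : Matrix (Fin 4) (Fin 4) ℝ} (ha : ∀ i j, a i j = -a j i)
    (hc : ∀ i j, c i j = -c j i) (hd : 0 < pfaffDisc a c) :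
    pencilJ a c * pencilJ a c = -1 := by
  have hr : (√(pfaffDisc a c))⁻¹ * (√(pfaffDisc a c))⁻¹ * pfaffDisc a c = 1 := by
    rw [← mul_inv, Real.mul_self_sqrt hd.le, inv_mul_cancel₀ hd.ne']
  have e : pencilJ a c * pencilJ a c =
    pencilJ a c * ((√(pfaffDisc a c))⁻¹ • (a * skewDual c - c * skewDual a)) := rfl
  rw [e, Matrix.mul_smul, Matrix.mul_sub, ← Matrix.mul_assoc, ← Matrix.mul_assoc,
    pencilJ_mul_left ha hc, pencilJ_mul_right ha hc]
  simp only [Matrix.sub_mul, Matrix.smul_mul, mul_skewDual_self ha, mul_skewDual_self hc]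
  have h1 := mul_skewDual_add ha hc
  have h3 : a * skewDual c = (-pfaffPolar a c) • 1 - c * skewDual a := by
    rw [← h1]; abel
  rw [h3]
  have : (-1 : Matrix (Fin 4) (Fin 4) ℝ) =
      (-((√(pfaffDisc a c))⁻¹ * (√(pfaffDisc a c))⁻¹ * pfaffDisc a c)) •
        (1 : Matrix (Fin 4) (Fin 4) ℝ) := by rw [hr]; simp
  rw [this]
  unfold pfaffDisc
  module

/-! ### Complex structures and orientations -/

section ComplexStructure

variable {V : Type*} [AddCommGroup V] [Module ℝ V]

/-- The complex vector space structure defined by an endomorphism with square `-1`. -/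
@[reducible] def complexModule (J : V →ₗ[ℝ] V) (hJ : ∀ v, J (J v) = -v) : Module ℂ V where
  smul z v := z.re • v + z.im • J v
  one_smul v := by change (1 : ℂ).re • v + (1 : ℂ).im • J v = v; simp
  mul_smul z w v := by
    change (z * w).re • v + (z * w).im • J v =
      z.re • (w.re • v + w.im • J v) + z.im • J (w.re • v + w.im • J v)
    simp only [Complex.mul_re, Complex.mul_im, map_add, map_smul, hJ]
    module
  smul_zero z := by change z.re • (0 : V) + z.im • J 0 = 0; simp
  smul_add z v w := by
    change z.re • (v + w) + z.im • J (v + w) =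
      (z.re • v + z.im • J v) + (z.re • w + z.im • J w)
    rw [map_add]; module
  add_smul z w v := by
    change (z + w).re • v + (z + w).im • J v =
      (z.re • v + z.im • J v) + (w.re • v + w.im • J v)
    simp only [Complex.add_re, Complex.add_im]; module
  zero_smul v := by change (0 : ℂ).re • v + (0 : ℂ).im • J v = 0; simp

theorem complexModule_isScalarTower (J : V →ₗ[ℝ] V) (hJ : ∀ v, J (J v) = -v) :
    letI := complexModule J hJ
    IsScalarTower ℝ ℂ V := by
  let := complexModule J hJ
  refine ⟨fun x z v => ?_⟩
  change (x • z).re • v + (x • z).im • J v = x • (z.re • v + z.im • J v)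
  simp only [Complex.real_smul, Complex.mul_re, Complex.ofReal_re, Complex.ofReal_im,
    Complex.mul_im]
  module

/-- The real determinant of a complex linear automorphism is positive, being the squared modulus of
the complex determinant. -/
theorem det_pos_of_commute {J : V →ₗ[ℝ] V} (hJ : ∀ v, J (J v) = -v) (f : V ≃ₗ[ℝ] V)
    (hf : ∀ v, f (J v) = J (f v)) : 0 < LinearMap.det (f : V →ₗ[ℝ] V) := by
  let := complexModule J hJ
  have := complexModule_isScalarTower J hJ
  let g : V →ₗ[ℂ] V :=
    { toFun := f
      map_add' := map_add f
      map_smul' := fun z v => by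
        change f (z.re • v + z.im • J v) = z.re • f v + z.im • J (f v)
        rw [map_add, map_smul, map_smul, hf] }
  have hg : g.restrictScalars ℝ = (f : V →ₗ[ℝ] V) := rfl
  have h1 : LinearMap.det (f : V →ₗ[ℝ] V) = Complex.normSq (LinearMap.det g) := by
    rw [← hg, LinearMap.det_restrictScalars, Algebra.norm_complex_apply]
  have h2 : LinearMap.det (f : V →ₗ[ℝ] V) ≠ 0 := (LinearEquiv.isUnit_det' f).ne_zero
  rw [h1] at h2 ⊢
  exact lt_of_le_of_ne (Complex.normSq_nonneg _) h2.symm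

/-- A basis of the form `e₁, J e₁, e₂, J e₂, e₃, J e₃`. -/
def IsComplexBasis (J : V →ₗ[ℝ] V) (b : Module.Basis (Fin 6) ℝ V) : Prop :=
  b 1 = J (b 0) ∧ b 3 = J (b 2) ∧ b 5 = J (b 4)

/-- All bases `e₁, J e₁, e₂, J e₂, e₃, J e₃` define the same orientation. -/
theorem IsComplexBasis.orientation_eq {J : V →ₗ[ℝ] V} (hJ : ∀ v, J (J v) = -v)
    {b b' : Module.Basis (Fin 6) ℝ V} (hb : IsComplexBasis J b) (hb' : IsComplexBasis J b') :
    b'.orientation = b.orientation := by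
  have hmap : b.map (b.equiv b' (Equiv.refl _)) = b' := by ext i; simp
  rw [← hmap, b.orientation_comp_linearEquiv_eq_iff_det_pos]
  refine det_pos_of_commute hJ _ fun v => ?_
  let f := (b.equiv b' (Equiv.refl _) : V →ₗ[ℝ] V)
  have hf : ∀ i, f (b i) = b' i := fun i => by simp [f]
  change (f ∘ₗ J) v = (J ∘ₗ f) v
  congr 1
  refine b.ext fun i => ?_
  simp only [LinearMap.comp_apply]
  obtain ⟨h0, h1, h2⟩ := hb
  obtain ⟨h0', h1', h2'⟩ := hb'
  fin_cases i
  · change f (J (b 0)) = J (f (b 0)); rw [← h0, hf, hf, h0']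
  · change f (J (b 1)) = J (f (b 1)); rw [h0, hJ, ← h0, map_neg, hf, hf, h0', hJ]
  · change f (J (b 2)) = J (f (b 2)); rw [← h1, hf, hf, h1']
  · change f (J (b 3)) = J (f (b 3)); rw [h1, hJ, ← h1, map_neg, hf, hf, h1', hJ]
  · change f (J (b 4)) = J (f (b 4)); rw [← h2, hf, hf, h2']
  · change f (J (b 5)) = J (f (b 5)); rw [h2, hJ, ← h2, map_neg, hf, hf, h2', hJ]

theorem exists_isComplexBasis {J : V →ₗ[ℝ] V} (hJ : ∀ v, J (J v) = -v)
    (h6 : Module.finrank ℝ V = 6) : ∃ b, IsComplexBasis J b := by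
  let := complexModule J hJ
  have := complexModule_isScalarTower J hJ
  have : FiniteDimensional ℝ V := Module.finite_of_finrank_pos (by rw [h6]; norm_num)
  have : FiniteDimensional ℂ V := Module.Finite.of_restrictScalars_finite ℝ ℂ V
  have h3 : Module.finrank ℂ V = 3 := by
    have := Module.finrank_mul_finrank ℝ ℂ V
    rw [Complex.finrank_real_complex, h6] at this
    omega
  let c : Module.Basis (Fin 3) ℂ V := Module.finBasisOfFinrankEq ℂ V h3
  let b := (Complex.basisOneI.smulTower' c).reindex (finProdFinEquiv : Fin 3 × Fin 2 ≃ Fin (3 * 2))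
  have hb0 : ∀ i : Fin 3, b (finProdFinEquiv (i, 0)) = c i := fun i => by
    simp only [b, Module.Basis.reindex_apply, Equiv.symm_apply_apply,
      Module.Basis.smulTower'_apply]
    simp
  have hb1 : ∀ i : Fin 3, b (finProdFinEquiv (i, 1)) = J (c i) := fun i => by
    simp only [b, Module.Basis.reindex_apply, Equiv.symm_apply_apply,
      Module.Basis.smulTower'_apply]
    simp only [Complex.coe_basisOneI, Matrix.cons_val_one]
    change Complex.I.re • c i + Complex.I.im • J (c i) = _
    simp
  refine ⟨b, ?_, ?_, ?_⟩
  · exact (hb1 0).trans (congrArg J (hb0 0).symm)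
  · exact (hb1 1).trans (congrArg J (hb0 1).symm)
  · exact (hb1 2).trans (congrArg J (hb0 2).symm)

/-- The complex structure `J` induces the orientation `o`. -/
def InducesOrientation (J : V →ₗ[ℝ] V) (o : Orientation ℝ V (Fin 6)) : Prop :=
  ∀ b : Module.Basis (Fin 6) ℝ V, IsComplexBasis J b → b.orientation = o

theorem IsComplexBasis.inducesOrientation {J : V →ₗ[ℝ] V} (hJ : ∀ v, J (J v) = -v)
    {b : Module.Basis (Fin 6) ℝ V} (hb : IsComplexBasis J b) :
    InducesOrientation J b.orientation := fun _ hb' => hb.orientation_eq hJ hb'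

/-- In complex dimension three, `-J` induces the opposite orientation. -/
theorem IsComplexBasis.exists_neg {J : V →ₗ[ℝ] V}
    {b : Module.Basis (Fin 6) ℝ V} (hb : IsComplexBasis J b) :
    ∃ b', IsComplexBasis (-J) b' ∧ b'.orientation = -b.orientation := by
  let w : Fin 6 → ℝˣ := ![1, -1, 1, -1, 1, -1]
  refine ⟨b.unitsSMul w, ?_, ?_⟩
  · simp only [IsComplexBasis, Module.Basis.unitsSMul_apply, w]
    simp [hb.1, hb.2.1, hb.2.2]
  · rw [Module.Basis.orientation_unitsSMul]
    simp [w, Fin.prod_univ_six]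

theorem inducesOrientation_or_neg {J : V →ₗ[ℝ] V} (hJ : ∀ v, J (J v) = -v)
    (h6 : Module.finrank ℝ V = 6) (o : Orientation ℝ V (Fin 6)) :
    InducesOrientation J o ∨ InducesOrientation (-J) o := by
  obtain ⟨b, hb⟩ := exists_isComplexBasis hJ h6
  obtain ⟨b', hb', ho⟩ := hb.exists_neg
  rcases b.orientation_eq_or_eq_neg o with h | h
  · left; rw [h]; exact hb.inducesOrientation hJ
  · right; rw [h, ← ho]; exact hb'.inducesOrientation fun v => by simp [hJ]

theorem InducesOrientation.not_neg {J : V →ₗ[ℝ] V} (hJ : ∀ v, J (J v) = -v)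
    (h6 : Module.finrank ℝ V = 6) {o : Orientation ℝ V (Fin 6)} (h : InducesOrientation J o) :
    ¬ InducesOrientation (-J) o := by
  intro h'
  obtain ⟨b, hb⟩ := exists_isComplexBasis hJ h6
  obtain ⟨b', hb', ho⟩ := hb.exists_neg
  rw [h b hb, h' b' hb'] at ho
  exact Module.Ray.ne_neg_self _ ho

/-- Complex structures which differ by a map `V/H → H` induce the same orientation: with
`B = K - J`, the unipotent map `1 - JB/2` intertwines `K` and `J`. -/
theorem InducesOrientation.congr {J K : V →ₗ[ℝ] V} (hJ : ∀ v, J (J v) = -v)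
    (hK : ∀ v, K (K v) = -v) {H : Submodule ℝ V}
    (hJH : ∀ v ∈ H, J v ∈ H) (hH : ∀ v ∈ H, K v = J v) (hQ : ∀ v, K v - J v ∈ H)
    {o : Orientation ℝ V (Fin 6)} (h : InducesOrientation J o) : InducesOrientation K o := by
  let N : V →ₗ[ℝ] V := (-(1 / 2 : ℝ)) • (J ∘ₗ (K - J))
  have hN : ∀ v, N v = (-(1 / 2 : ℝ)) • J (K v - J v) := fun v => rfl
  have hNH : ∀ v, N v ∈ H := fun v => H.smul_mem _ (hJH _ (hQ v))
  have hN0 : ∀ v ∈ H, N v = 0 := fun v hv => by rw [hN, hH v hv, sub_self, map_zero, smul_zero]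
  let U : ℝ → V →ₗ[ℝ] V := fun t => LinearMap.id + t • N
  have hU : ∀ s t, U s ∘ₗ U t = U (s + t) := fun s t => by
    ext v
    simp only [U, LinearMap.comp_apply, LinearMap.add_apply, LinearMap.id_apply,
      LinearMap.smul_apply, map_add, map_smul, hN0 _ (hNH v), smul_zero, add_zero]
    module
  have hU0 : U 0 = LinearMap.id := by simp [U]
  let g : V ≃ₗ[ℝ] V := LinearEquiv.ofLinearMap (U 1) (U (-1)) (by rw [hU]; simp [hU0])
    (by rw [hU]; simp [hU0])
  have hg : ∀ v, g v = v + N v := fun v => by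
    change v + (1 : ℝ) • N v = _
    rw [one_smul]
  have hdet : 0 < LinearMap.det (g : V →ₗ[ℝ] V) := by
    have h1 : (g : V →ₗ[ℝ] V) = U (1 / 2) ∘ₗ U (1 / 2) := by
      rw [hU]; norm_num; rfl
    have h2 : LinearMap.det (g : V →ₗ[ℝ] V) ≠ 0 := (LinearEquiv.isUnit_det' g).ne_zero
    rw [h1, LinearMap.det_comp] at h2 ⊢
    exact lt_of_le_of_ne (mul_self_nonneg _) h2.symm
  have hgK : ∀ v, J (g v) = g (K v) := fun v => by
    rw [hg, hg, hN, hN, map_add, map_smul]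
    simp only [map_sub, hJ, hK, map_neg]
    module
  intro b hb
  rw [← (b.orientation_comp_linearEquiv_eq_iff_det_pos g).2 hdet]
  apply h
  refine ⟨?_, ?_, ?_⟩ <;> simp only [Module.Basis.map_apply]
  · rw [hb.1, hgK]
  · rw [hb.2.1, hgK]
  · rw [hb.2.2, hgK]

end ComplexStructure

/-! ### Complex bilinear two-forms -/

section Uniqueness

variable {V W : Type*} [AddCommGroup V] [Module ℝ V] [AddCommGroup W] [Module ℝ W]

/-- A vector-valued two-form is non-degenerate if all its non-zero real components are. -/
def Nondegenerate (L : V [⋀^Fin 2]→ₗ[ℝ] W) : Prop :=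
  ∀ ψ : Module.Dual ℝ W, ψ ≠ 0 → ∀ v : V, v ≠ 0 → ∃ w, ψ (L ![v, w]) ≠ 0

theorem map_cons_add_left (L : V [⋀^Fin 2]→ₗ[ℝ] W) (u u' v : V) :
    L ![u + u', v] = L ![u, v] + L ![u', v] := L.map_vecCons_add _ _ _

theorem map_cons_smul_left (L : V [⋀^Fin 2]→ₗ[ℝ] W) (x : ℝ) (u v : V) :
    L ![x • u, v] = x • L ![u, v] := L.map_vecCons_smul _ _ _

theorem map_swap_two (L : V [⋀^Fin 2]→ₗ[ℝ] W) (u v : V) : L ![u, v] = -L ![v, u] := by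
  have := L.map_swap ![v, u] (i := 0) (j := 1) (by decide)
  have h2 : (![v, u] ∘ Equiv.swap (0 : Fin 2) 1) = ![u, v] := by
    ext i; fin_cases i <;> rfl
  rwa [h2] at this

/-- The bilinear map underlying a two-form. -/
def twoFormBilin (L : V [⋀^Fin 2]→ₗ[ℝ] W) : V →ₗ[ℝ] V →ₗ[ℝ] W :=
  LinearMap.mk₂ ℝ (fun u v => L ![u, v]) (map_cons_add_left L) (map_cons_smul_left L)
    (fun u v v' => by
      rw [map_swap_two, map_cons_add_left, map_swap_two L v, map_swap_two L v']; abel)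
    (fun x u v => by rw [map_swap_two, map_cons_smul_left, map_swap_two L v]; simp)

@[simp] theorem twoFormBilin_apply (L : V [⋀^Fin 2]→ₗ[ℝ] W) (u v : V) :
    twoFormBilin L u v = L ![u, v] := rfl

theorem Nondegenerate.eq_zero_of_dual {L : V [⋀^Fin 2]→ₗ[ℝ] W} (hL : Nondegenerate L)
    {ψ : Module.Dual ℝ W} (hψ : ψ ≠ 0) {v : V} (h : ∀ w, ψ (L ![v, w]) = 0) : v = 0 := by
  by_contra hv
  obtain ⟨w, hw⟩ := hL ψ hψ v hv
  exact hw (h w)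

theorem Nondegenerate.eq_zero [Nontrivial W] {L : V [⋀^Fin 2]→ₗ[ℝ] W} (hL : Nondegenerate L)
    {v : V} (h : ∀ w, L ![v, w] = 0) : v = 0 := by
  obtain ⟨w, hw⟩ := exists_ne (0 : W)
  obtain ⟨ψ, hψ⟩ := Module.Projective.exists_dual_ne_zero ℝ hw
  exact hL.eq_zero_of_dual (ψ := ψ) (fun h => hψ (by simp [h])) fun w => by simp [h]

/-- On a non-zero space with complex structure `K`, the vectors `u` and `K u` are independent. -/
theorem eq_zero_of_smul_add_smul {K : W →ₗ[ℝ] W} (hK : ∀ w, K (K w) = -w) {w : W} (hw : w ≠ 0)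
    {x y : ℝ} (h : x • w + y • K w = 0) : x = 0 ∧ y = 0 := by
  have h2 : x • K w - y • w = 0 := by
    have := congrArg K h
    simp only [map_add, map_smul, hK, map_zero] at this
    rw [← this]; module
  have h3 : (x * x + y * y) • w = 0 := by
    have : (x * x + y * y) • w = x • (x • w + y • K w) - y • (x • K w - y • w) := by module
    rw [this, h, h2]; simp
  have h4 := (smul_eq_zero.1 h3).resolve_right hw
  constructor <;> nlinarith [mul_self_nonneg x, mul_self_nonneg y]

/-- Two functionals `ψ` and `ψ ∘ K` determine a vector of a plane with complex structure `K`. -/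
theorem eq_zero_of_dual_pair (h2 : Module.finrank ℝ W = 2) {K : W →ₗ[ℝ] W}
    (hK : ∀ w, K (K w) = -w) {ψ : Module.Dual ℝ W} (hψ : ψ ≠ 0) {w : W} (h0 : ψ w = 0)
    (h1 : ψ (K w) = 0) : w = 0 := by
  by_contra hw
  have hli : LinearIndependent ℝ ![w, K w] := by
    rw [LinearIndependent.pair_iff]
    exact fun x y h => eq_zero_of_smul_add_smul hK hw h
  have hsp := hli.span_eq_top_of_card_eq_finrank (by simp [h2])
  refine hψ (LinearMap.ext_on_range hsp fun i => ?_)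
  fin_cases i
  · exact h0
  · exact h1

/-- If a non-degenerate two-form with values in a plane is complex bilinear, the two complex
structures are determined up to a common sign. -/
theorem Nondegenerate.complexStructure_unique [Nontrivial V] {L : V [⋀^Fin 2]→ₗ[ℝ] W}
    (hL : Nondegenerate L) (h2 : Module.finrank ℝ W = 2) {J J' : V →ₗ[ℝ] V} {K K' : W →ₗ[ℝ] W}
    (hJ : ∀ v, J (J v) = -v) (hJ' : ∀ v, J' (J' v) = -v) (hK : ∀ w, K (K w) = -w)
    (hb : ∀ u v, L ![J u, v] = K (L ![u, v])) (hb' : ∀ u v, L ![J' u, v] = K' (L ![u, v])) :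
    (J' = J ∧ K' = K) ∨ (J' = -J ∧ K' = -K) := by
  have : FiniteDimensional ℝ W := Module.finite_of_finrank_pos (by rw [h2]; norm_num)
  have : Nontrivial W := Module.nontrivial_of_finrank_pos (R := ℝ) (by rw [h2]; norm_num)
  obtain ⟨w, hw⟩ := exists_ne (0 : W)
  obtain ⟨ψ, hψw⟩ := Module.Projective.exists_dual_ne_zero ℝ hw
  have hψ : ψ ≠ 0 := fun h => hψw (by simp [h])
  -- the functional `ψ ∘ K'` is a combination of `ψ` and `ψ ∘ K`
  obtain ⟨x, y, hxy⟩ : ∃ x y : ℝ, ∀ w, ψ (K' w) = x * ψ w + y * ψ (K w) := by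
    have hli : LinearIndependent ℝ ![ψ, ψ ∘ₗ K] := by
      rw [LinearIndependent.pair_iff]
      intro x y h
      by_contra hne
      have key : ∀ w, ψ (x • w + y • K w) = 0 := fun w => by
        have := LinearMap.congr_fun h w
        simpa using this
      have h3 : ∀ w, ψ ((x * x + y * y) • w) = 0 := fun w => by
        have : (x * x + y * y) • w = (x • (x • w) + y • K (x • w))
            + (x • ((-y) • K w) + y • K ((-y) • K w)) := by
          simp only [map_smul, hK]; module
        rw [this, map_add, key, key, add_zero]
      refine hψ (LinearMap.ext fun w => ?_)
      have h4 := h3 w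
      rw [map_smul, smul_eq_mul] at h4
      refine (mul_eq_zero.1 h4).resolve_left fun h5 => hne ?_
      constructor <;> nlinarith [mul_self_nonneg x, mul_self_nonneg y]
    have hsp := hli.span_eq_top_of_card_eq_finrank (by simp [h2])
    have hm : ψ ∘ₗ K' ∈ Submodule.span ℝ (Set.range ![ψ, ψ ∘ₗ K]) := by
      rw [hsp]; exact Submodule.mem_top
    obtain ⟨c, hc⟩ := (Submodule.mem_span_range_iff_exists_fun ℝ).1 hm
    refine ⟨c 0, c 1, fun w => ?_⟩
    have := LinearMap.congr_fun hc w
    simpa [Fin.sum_univ_two] using this.symm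
  have hJJ : ∀ u, J' u = x • u + y • J u := fun u => by
    rw [← sub_eq_zero]
    refine hL.eq_zero_of_dual hψ fun v => ?_
    rw [← twoFormBilin_apply]
    simp only [map_sub, map_add, map_smul, LinearMap.sub_apply, LinearMap.add_apply,
      LinearMap.smul_apply, twoFormBilin_apply, hb, hb', hxy, smul_eq_mul]
    ring
  obtain ⟨u, hu⟩ := exists_ne (0 : V)
  have hq : (x * x - y * y + 1) • u + (2 * x * y) • J u = 0 := by
    have := hJ' u
    rw [hJJ (J' u), hJJ u] at this
    simp only [map_add, map_smul, hJ] at this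
    rw [← sub_eq_zero] at this
    rw [← this]; module
  obtain ⟨h3, h4⟩ := eq_zero_of_smul_add_smul hJ hu hq
  have hx : x = 0 := by
    rcases mul_eq_zero.1 h4 with h | h
    · linarith
    · rw [h] at h3; nlinarith [mul_self_nonneg x]
  subst hx
  have hcomp : ∀ ε : ℝ, (∀ u, J' u = ε • J u) → K' = ε • K := by
    intro ε hε
    by_contra hne
    have hne' : K' - ε • K ≠ 0 := sub_ne_zero.2 hne
    obtain ⟨w, hw⟩ : ∃ w, (K' - ε • K) w ≠ 0 := by
      by_contra! h; exact hne' (LinearMap.ext h)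
    obtain ⟨φ, hφ⟩ := Module.Projective.exists_dual_ne_zero ℝ hw
    obtain ⟨v, hv⟩ := hL (φ ∘ₗ (K' - ε • K)) (fun h => hφ (LinearMap.congr_fun h w)) u hu
    refine hv ?_
    rw [LinearMap.comp_apply, LinearMap.sub_apply, LinearMap.smul_apply, ← hb, ← hb', hε,
      map_cons_smul_left, sub_self, map_zero]
  have hy : (y - 1) * (y + 1) = 0 := by linarith
  rcases mul_eq_zero.1 hy with h | h
  · have hy1 : y = 1 := by linarith
    subst hy1
    exact Or.inl ⟨LinearMap.ext fun u => by rw [hJJ]; simp, by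
      have := hcomp 1 fun u => by rw [hJJ]; simp
      rwa [one_smul] at this⟩
  · have hy1 : y = -1 := by linarith
    subst hy1
    exact Or.inr ⟨LinearMap.ext fun u => by rw [hJJ]; simp, by
      have := hcomp (-1) fun u => by rw [hJJ]; simp
      rwa [neg_smul, one_smul] at this⟩

end Uniqueness

/-! ### The Jacobi identity and the Nijenhuis tensor -/

section LieRing

variable {𝔤 : Type*} [LieRing 𝔤]

/-- The Nijenhuis expression of an additive endomorphism of a Lie ring. -/
def lieNijenhuis (J : 𝔤 →+ 𝔤) (x y : 𝔤) : 𝔤 := ⁅x, y⁆ + J ⁅J x, y⁆ + J ⁅x, J y⁆ - ⁅J x, J y⁆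

theorem lieNijenhuis_self (J : 𝔤 →+ 𝔤) (x : 𝔤) : lieNijenhuis J x x = 0 := by
  simp only [lieNijenhuis, lie_self]
  rw [← lie_skew x (J x), map_neg]
  abel

theorem lieNijenhuis_skew (J : 𝔤 →+ 𝔤) (x y : 𝔤) : lieNijenhuis J x y = -lieNijenhuis J y x := by
  simp only [lieNijenhuis]
  rw [← lie_skew x y, ← lie_skew (J x) y, ← lie_skew x (J y), ← lie_skew (J x) (J y)]
  simp only [map_neg]
  abel

theorem lieNijenhuis_apply_right {J : 𝔤 →+ 𝔤} (hJ : ∀ x, J (J x) = -x) (x y : 𝔤) :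
    lieNijenhuis J x (J y) = -J (lieNijenhuis J x y) := by
  simp only [lieNijenhuis, map_add, map_sub, hJ, lie_neg, map_neg]
  abel

/-- If the bracket with elements of `𝔥` is complex linear modulo `𝔥` in the other argument, then
the Nijenhuis expressions `N(x, y)` with `y ∈ 𝔥` lie in `𝔥`, and the bracket of them with
elements of `𝔥` lies in `𝔥`. By the Jacobi identity `[N(x, y), z]` and `N(x, [y, z])` agree
modulo `𝔥`; the former is complex linear and the latter antilinear in `z`. -/
theorem two_lie_lieNijenhuis_mem {J : 𝔤 →+ 𝔤} (hJ : ∀ x, J (J x) = -x) {𝔥 : AddSubgroup 𝔤}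
    (hJ𝔥 : ∀ x ∈ 𝔥, J x ∈ 𝔥) (hlin : ∀ x, ∀ y ∈ 𝔥, ⁅J x, y⁆ - J ⁅x, y⁆ ∈ 𝔥) (x : 𝔤) {y z : 𝔤}
    (hy : y ∈ 𝔥) (hz : z ∈ 𝔥) :
    lieNijenhuis J x y ∈ 𝔥 ∧ 2 • ⁅lieNijenhuis J x y, z⁆ ∈ 𝔥 := by
  have hN : ∀ x, ∀ y ∈ 𝔥, lieNijenhuis J x y ∈ 𝔥 := fun x y hy => by
    have h1 := hJ𝔥 _ (hlin x y hy)
    have h2 := hlin x (J y) (hJ𝔥 y hy)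
    have := 𝔥.sub_mem h1 h2
    rw [map_sub, hJ] at this
    convert this using 1
    unfold lieNijenhuis
    abel
  have hNsub : ∀ x y y', lieNijenhuis J x (y - y') = lieNijenhuis J x y - lieNijenhuis J x y' :=
    fun x y y' => by
      simp only [lieNijenhuis, map_sub, lie_sub]
      abel
  have hlin' : ∀ x ∈ 𝔥, ∀ y, ⁅x, J y⁆ - J ⁅x, y⁆ ∈ 𝔥 := fun x hx y => by
    have := 𝔥.neg_mem (hlin y x hx)
    rw [← lie_skew x (J y), ← lie_skew x y]
    convert this using 1
    simp only [map_neg]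
    abel
  have key : ∀ z ∈ 𝔥, ⁅lieNijenhuis J x y, z⁆ - lieNijenhuis J x ⁅y, z⁆ ∈ 𝔥 := by
    intro z hz
    have h1 := hlin y z hz
    have h2 := hlin x z hz
    have := 𝔥.add_mem (𝔥.add_mem (hlin ⁅J x, y⁆ z hz) (hlin ⁅x, J y⁆ z hz))
      (𝔥.add_mem (𝔥.sub_mem (hlin y _ h2) (hlin x _ h1)) (hN ⁅x, z⁆ y hy))
    convert this using 1
    rw [lieNijenhuis_skew J ⁅x, z⁆ y]
    simp only [lieNijenhuis, add_lie, sub_lie, lie_lie, lie_sub, map_sub]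
    abel
  refine ⟨hN x y hy, ?_⟩
  have h1 := hJ𝔥 _ (key z hz)
  have h2 := key (J z) (hJ𝔥 z hz)
  have h3 := hlin' _ (hN x y hy) z
  have h4 := hN x _ (hlin' y hy z)
  rw [hNsub, lieNijenhuis_apply_right hJ] at h4
  have h5 := 𝔥.neg_mem (hJ𝔥 _ (𝔥.add_mem (𝔥.add_mem (𝔥.sub_mem h2 h3) h4) h1))
  convert h5 using 1
  simp only [map_add, map_sub, map_neg, hJ]
  abel

end LieRing

variable {M : Type*} [TopologicalSpace M] [ChartedSpace E6 M] [IsManifold (𝓡 6) ∞ M]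

/-! ### Smooth fields and local frames -/

instance (x : M) : FiniteDimensional ℝ (TangentSpace (𝓡 6) x) :=
  inferInstanceAs (FiniteDimensional ℝ E6)

instance (x : M) : T2Space (TangentSpace (𝓡 6) x) := inferInstanceAs (T2Space E6)

instance : IsManifold (𝓡 6) (minSmoothness ℝ 2) M :=
  IsManifold.of_le (n := ∞) (by simpa using ENat.LEInfty.out)

instance : IsManifold (𝓡 6) (minSmoothness ℝ 3) M :=
  IsManifold.of_le (n := ∞) (by simpa using ENat.LEInfty.out)

omit [IsManifold (𝓡 6) ∞ M] in
theorem finrank_tangentSpace (x : M) : Module.finrank ℝ (TangentSpace (𝓡 6) x) = 6 :=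
  (finrank_euclideanSpace_fin : Module.finrank ℝ E6 = 6)

/-- The vector field `X` is smooth at `x`. -/
abbrev SmoothAt (X : Π y : M, TangentSpace (𝓡 6) y) (x : M) : Prop :=
  ContMDiffAt (𝓡 6) (𝓡 6).tangent ∞ (fun y => (X y : TangentBundle (𝓡 6) M)) x

/-- The vector field `X` is differentiable at `x`. -/
abbrev DiffAt (X : Π y : M, TangentSpace (𝓡 6) y) (x : M) : Prop :=
  MDifferentiableAt (𝓡 6) (𝓡 6).tangent (fun y => (X y : TangentBundle (𝓡 6) M)) x

/-- The field `J` of endomorphisms of the tangent spaces is smooth at `x`. -/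
abbrev EndSmoothAt (J : Π y : M, TangentSpace (𝓡 6) y →L[ℝ] TangentSpace (𝓡 6) y) (x : M) : Prop :=
  ContMDiffAt (𝓡 6) ((𝓡 6).prod 𝓘(ℝ, E6 →L[ℝ] E6)) ∞
    (fun x => Bundle.TotalSpace.mk' (E6 →L[ℝ] E6)
      (E := fun y : M => TangentSpace (𝓡 6) y →L[ℝ] TangentSpace (𝓡 6) y) x (J x)) x

theorem SmoothAt.diffAt {X : Π y : M, TangentSpace (𝓡 6) y} {x : M} (h : SmoothAt X x) :
    DiffAt X x := h.mdifferentiableAt (by simp)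

theorem EndSmoothAt.apply {J : Π y : M, TangentSpace (𝓡 6) y →L[ℝ] TangentSpace (𝓡 6) y} {x : M}
    (hJ : EndSmoothAt J x) {X : Π y : M, TangentSpace (𝓡 6) y} (hX : SmoothAt X x) :
    SmoothAt (fun y => J y (X y)) x :=
  ContMDiffAt.clm_bundle_apply (b := fun y : M => y) hJ hX

theorem EndSmoothAt.apply_diffAt {J : Π y : M, TangentSpace (𝓡 6) y →L[ℝ] TangentSpace (𝓡 6) y}
    {x : M} (hJ : EndSmoothAt J x) {X : Π y : M, TangentSpace (𝓡 6) y} (hX : DiffAt X x) :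
    DiffAt (fun y => J y (X y)) x :=
  MDifferentiableAt.clm_bundle_apply (b := fun y : M => y) (hJ.mdifferentiableAt (by simp)) hX

theorem SmoothAt.mlieBracket {X Y : Π y : M, TangentSpace (𝓡 6) y} {x : M} (hX : SmoothAt X x)
    (hY : SmoothAt Y x) : SmoothAt (VectorField.mlieBracket (𝓡 6) X Y) x := by
  have : IsManifold (𝓡 6) (((⊤ : ℕ∞) : WithTop ℕ∞) + 1) M := ‹IsManifold (𝓡 6) ∞ M›
  exact ContMDiffAt.mlieBracket_vectorField (m := (⊤ : ℕ∞)) (n := (⊤ : ℕ∞)) hX hY (by simp)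

variable {ι : Type*} [Fintype ι]

/-- The components of a smooth field with respect to a smooth local frame are smooth. -/
theorem contMDiffAt_coeff {s : ι → Π y : M, TangentSpace (𝓡 6) y} {U : Set M}
    (hs : IsLocalFrameOn (𝓡 6) E6 ∞ s U) {x : M} (hU : U ∈ 𝓝 x)
    {X : Π y : M, TangentSpace (𝓡 6) y} (hX : SmoothAt X x) (i : ι) :
    ContMDiffAt (𝓡 6) 𝓘(ℝ, ℝ) ∞ (fun y => hs.coeff i y (X y)) x := by
  classical
  set e := trivializationAt E6 (TangentSpace (𝓡 6) : M → Type _) x with he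
  have hxe : x ∈ e.baseSet := FiberBundle.mem_baseSet_trivializationAt' x
  let φ : (Π y : M, TangentSpace (𝓡 6) y) → M → E6 := fun X y => e.continuousLinearMapAt ℝ y (X y)
  have hφ : ∀ X : Π y : M, TangentSpace (𝓡 6) y, SmoothAt X x →
      ContMDiffAt (𝓡 6) 𝓘(ℝ, E6) ∞ (φ X) x := by
    intro X hX
    have h1 := (Bundle.contMDiffAt_section x).1 hX
    refine h1.congr_of_eventuallyEq ?_
    filter_upwards [e.open_baseSet.mem_nhds hxe] with y hy
    simp only [φ]
    rw [Bundle.Trivialization.continuousLinearMapAt_apply,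
      Bundle.Trivialization.coe_linearMapAt_of_mem _ hy]
  let G : M → ((ι → ℝ) →L[ℝ] E6) := fun y =>
    ∑ i, (ContinuousLinearMap.proj (R := ℝ) (φ := fun _ : ι => ℝ) i).smulRight (φ (s i) y)
  have hG : ContMDiffAt (𝓡 6) 𝓘(ℝ, (ι → ℝ) →L[ℝ] E6) ∞ G x := by
    refine ContMDiffAt.sum fun i _ => ?_
    exact (ContinuousLinearMap.contDiff (ContinuousLinearMap.smulRightL ℝ (ι → ℝ) E6
      (ContinuousLinearMap.proj (R := ℝ) (φ := fun _ : ι => ℝ) i))).contMDiff.contMDiffAt.comp x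
      (hφ (s i) ((hs.contMDiffOn i).contMDiffAt hU))
  -- on the frame domain, `G` is the coordinate isomorphism of the frame
  have hGe : ∀ y ∈ U, y ∈ e.baseSet → ∃ g : (ι → ℝ) ≃L[ℝ] E6, (g : (ι → ℝ) →L[ℝ] E6) = G y ∧
      ∀ v, g.symm (e.continuousLinearMapAt ℝ y v) = fun i => hs.coeff i y v := by
    intro y hyU hye
    let b := hs.toBasisAt hyU
    let g := (b.equivFun.symm.toContinuousLinearEquiv).trans (e.continuousLinearEquivAt ℝ y hye)
    have hge : ∀ v, e.continuousLinearEquivAt ℝ y hye v = e.continuousLinearMapAt ℝ y v :=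
      fun v => congrFun (e.coe_continuousLinearEquivAt_eq (R := ℝ) hye) v
    refine ⟨g, ?_, fun v => ?_⟩
    · ext1 c
      have h1 : g c = e.continuousLinearMapAt ℝ y (∑ i, c i • b i) := by
        rw [← hge, ← b.equivFun_symm_apply]; rfl
      change g c = _
      rw [h1]
      simp [G, φ, b]
    · rw [← hge]
      have : g.symm (e.continuousLinearEquivAt ℝ y hye v) = b.equivFun v := by
        change b.equivFun ((e.continuousLinearEquivAt ℝ y hye).symm
          (e.continuousLinearEquivAt ℝ y hye v)) = _
        rw [ContinuousLinearEquiv.symm_apply_apply]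
      rw [this]
      ext i
      simp [IsLocalFrameOn.coeff, hyU, b]
  have hinv : ContMDiffAt (𝓡 6) 𝓘(ℝ, E6 →L[ℝ] (ι → ℝ)) ∞
      (fun y => ContinuousLinearMap.inverse (G y)) x := by
    obtain ⟨g, hg, -⟩ := hGe x (mem_of_mem_nhds hU) hxe
    have h3 : ContDiffAt ℝ ∞ (ContinuousLinearMap.inverse : ((ι → ℝ) →L[ℝ] E6) → _) (G x) := by
      rw [← hg]; exact contDiffAt_map_inverse g
    exact h3.contMDiffAt.comp x hG
  have hF : ContMDiffAt (𝓡 6) 𝓘(ℝ, ι → ℝ) ∞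
      (fun y => ContinuousLinearMap.inverse (G y) (φ X y)) x := hinv.clm_apply (hφ X hX)
  have hF' := (contMDiffAt_pi_space.1 hF) i
  refine hF'.congr_of_eventuallyEq ?_
  filter_upwards [hU, e.open_baseSet.mem_nhds hxe] with y hyU hye
  obtain ⟨g, hg, hg2⟩ := hGe y hyU hye
  rw [← hg, ContinuousLinearMap.inverse_equiv]
  exact (congrFun (hg2 (X y)) i).symm

theorem SmoothAt.smul {X : Π y : M, TangentSpace (𝓡 6) y} {f : M → ℝ} {x : M}
    (hf : ContMDiffAt (𝓡 6) 𝓘(ℝ, ℝ) ∞ f x) (hX : SmoothAt X x) :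
    SmoothAt (fun y => f y • X y) x := ContMDiffAt.smul_section hf hX

theorem SmoothAt.add {X Y : Π y : M, TangentSpace (𝓡 6) y} {x : M}
    (hX : SmoothAt X x) (hY : SmoothAt Y x) :
    SmoothAt (fun y => X y + Y y) x := ContMDiffAt.add_section hX hY

theorem SmoothAt.sum {X : ι → Π y : M, TangentSpace (𝓡 6) y} {x : M}
    (hX : ∀ i, SmoothAt (X i) x) : SmoothAt (fun y => ∑ i, X i y) x :=
  ContMDiffAt.sum_section fun i _ => hX i

/-- A field of endomorphisms is smooth if it maps the members of a smooth local frame to smooth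
fields. -/
theorem endSmoothAt_of_frame {s : ι → Π y : M, TangentSpace (𝓡 6) y} {U : Set M}
    (hs : IsLocalFrameOn (𝓡 6) E6 ∞ s U) {x : M} (hU : U ∈ 𝓝 x)
    {J : Π y : M, TangentSpace (𝓡 6) y →L[ℝ] TangentSpace (𝓡 6) y}
    (hJ : ∀ i, SmoothAt (fun y => J y (s i y)) x) : EndSmoothAt J x := by
  have hJX : ∀ X : Π y : M, TangentSpace (𝓡 6) y, SmoothAt X x →
      SmoothAt (fun y => J y (X y)) x := fun X hX => by
    have h1 : SmoothAt (fun y => ∑ i, hs.coeff i y (X y) • J y (s i y)) x :=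
      SmoothAt.sum fun i => SmoothAt.smul (contMDiffAt_coeff hs hU hX i) (hJ i)
    refine h1.congr_of_eventuallyEq ?_
    filter_upwards [hU] with y hy
    have h2 : J y (X y) = ∑ i, hs.coeff i y (X y) • J y (s i y) := by
      conv_lhs => rw [hs.coeff_sum_eq X hy]
      rw [map_sum]
      simp
    rw [h2]
  set e := trivializationAt E6 (TangentSpace (𝓡 6) : M → Type _) x with he
  have hxe : x ∈ e.baseSet := FiberBundle.mem_baseSet_trivializationAt' x
  refine (contMDiffAt_hom_bundle _).2 ⟨contMDiffAt_id, ?_⟩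
  let b := (EuclideanSpace.basisFun (Fin 6) ℝ).toBasis
  let c : Fin 6 → E6 →L[ℝ] ℝ := fun i => LinearMap.toContinuousLinearMap (b.coord i)
  have h2 : ContMDiffAt (𝓡 6) 𝓘(ℝ, E6 →L[ℝ] E6) ∞ (fun y => ∑ i, (c i).smulRight
      (e.continuousLinearMapAt ℝ y (J y (e.symmL ℝ y (b i))))) x := by
    refine ContMDiffAt.sum fun i _ => ?_
    refine (ContinuousLinearMap.contDiff (ContinuousLinearMap.smulRightL ℝ E6 E6
      (c i))).contMDiff.contMDiffAt.comp x ?_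
    have h3 : SmoothAt (fun y => e.symmL ℝ y (b i)) x := by
      refine (contMDiffAt_localFrame_of_mem ∞ e b i hxe).congr_of_eventuallyEq ?_
      filter_upwards [e.open_baseSet.mem_nhds hxe] with y hy
      rw [e.localFrame_apply_of_mem_baseSet b hy]
      simp [Bundle.Trivialization.basisAt, Bundle.Trivialization.symmL_apply _ hy]
    have h1 := (Bundle.contMDiffAt_section x).1 (hJX _ h3)
    refine h1.congr_of_eventuallyEq ?_
    filter_upwards [e.open_baseSet.mem_nhds hxe] with y hy
    rw [Bundle.Trivialization.continuousLinearMapAt_apply,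
      Bundle.Trivialization.coe_linearMapAt_of_mem _ hy]
  refine h2.congr_of_eventuallyEq (Filter.Eventually.of_forall fun y => ?_)
  ext1 v
  have hv : v = ∑ i, c i v • b i := (b.sum_repr v).symm
  simp only [ContinuousLinearMap.inCoordinates]
  change e.continuousLinearMapAt ℝ y (J y (e.symmL ℝ y v)) = _
  conv_lhs => rw [hv]
  simp [map_sum]

open Bundle in
/-- Linear independence of smooth fields is an open condition; a maximal independent family
is a local frame. -/
theorem exists_isLocalFrameOn {s : ι → Π y : M, TangentSpace (𝓡 6) y} {U : Set M} {x : M}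
    (hU : U ∈ 𝓝 x) (hs : ∀ i, ContMDiffOn (𝓡 6) (𝓡 6).tangent ∞
      (fun y => (s i y : TangentBundle (𝓡 6) M)) U)
    (hli : LinearIndependent ℝ fun i => s i x) (hι : Fintype.card ι = 6) :
    ∃ U' ⊆ U, IsOpen U' ∧ x ∈ U' ∧ IsLocalFrameOn (𝓡 6) E6 ∞ s U' := by
  set e := trivializationAt E6 (TangentSpace (𝓡 6) : M → Type _) x with he
  have hxe : x ∈ e.baseSet := FiberBundle.mem_baseSet_trivializationAt' x
  let φ : M → ι → E6 := fun y i => e.continuousLinearMapAt ℝ y (s i y)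
  have hφ : ContinuousAt φ x := by
    refine continuousAt_pi.2 fun i => ?_
    have h1 := ((Bundle.contMDiffAt_section x).1 ((hs i).contMDiffAt hU)).continuousAt
    refine h1.congr ?_
    filter_upwards [e.open_baseSet.mem_nhds hxe] with y hy
    symm
    change e.continuousLinearMapAt ℝ y (s i y) = _
    rw [Bundle.Trivialization.continuousLinearMapAt_apply,
      Bundle.Trivialization.coe_linearMapAt_of_mem _ hy]
  have hlix : LinearIndependent ℝ (φ x) := by
    have h := hli.map' (e.continuousLinearEquivAt ℝ x hxe).toLinearEquiv.toLinearMap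
      (LinearEquiv.ker _)
    have heq : φ x = (e.continuousLinearEquivAt ℝ x hxe) ∘ fun i => s i x :=
      funext fun i => (congrFun (e.coe_continuousLinearEquivAt_eq (R := ℝ) hxe) (s i x)).symm
    rw [heq]
    exact h
  have hopen : ∀ᶠ y in 𝓝 x, LinearIndependent ℝ (φ y) :=
    hφ.eventually (isOpen_setOfPred_linearIndependent.mem_nhds hlix)
  obtain ⟨U', hU', hU'o, hxU'⟩ := mem_nhds_iff.1
    (Filter.inter_mem hU hopen)
  have hi : ∀ y ∈ U', LinearIndependent ℝ fun i => s i y := fun y hy =>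
    LinearIndependent.of_comp (e.continuousLinearMapAt ℝ y).toLinearMap (hU' hy).2
  refine ⟨U', fun y hy => (hU' hy).1, hU'o, hxU', ⟨fun {y} hy => hi y hy, fun {y} hy => ?_,
    fun i => (hs i).mono fun y hy => (hU' hy).1⟩⟩
  rw [(hi y hy).span_eq_top_of_card_eq_finrank' (by rw [hι, finrank_tangentSpace])]

/-- A smooth field defined near `x` agrees near `x` with a global one, which is a multiple of it. -/
theorem exists_global_extension [T2Space M] {X : Π y : M, TangentSpace (𝓡 6) y} {U : Set M} {x : M}
    (hU : U ∈ 𝓝 x) (hX : ContMDiffOn (𝓡 6) (𝓡 6).tangent ∞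
      (fun y => (X y : TangentBundle (𝓡 6) M)) U) :
    ∃ f : M → ℝ, f x = 1 ∧ (∀ y ∉ U, f y = 0) ∧ IsSmoothField fun y => f y • X y := by
  obtain ⟨U', hU', hU'o, hxU'⟩ := mem_nhds_iff.1 hU
  obtain ⟨f, -, hf⟩ := ((SmoothBumpFunction.nhds_basis_tsupport (I := 𝓡 6) x).mem_iff).1
    (hU'o.mem_nhds hxU')
  refine ⟨f, f.eq_one, fun y hy => image_eq_zero_of_notMem_tsupport fun h => hy (hU' (hf h)), ?_⟩
  exact ContMDiffOn.smul_section_of_tsupport (f.contMDiff.contMDiffOn) hU'o hf (hX.mono hU')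

/-- Every tangent vector is the value of a smooth vector field. -/
theorem exists_isSmoothField [T2Space M] (x : M) (v : TangentSpace (𝓡 6) x) :
    ∃ X : Π y : M, TangentSpace (𝓡 6) y, IsSmoothField X ∧ X x = v := by
  set e := trivializationAt E6 (TangentSpace (𝓡 6) : M → Type _) x with he
  have hxe : x ∈ e.baseSet := FiberBundle.mem_baseSet_trivializationAt' x
  let b := (EuclideanSpace.basisFun (Fin 6) ℝ).toBasis
  have hs := e.isLocalFrameOn_localFrame_baseSet (𝓡 6) ∞ b
  have hX : ContMDiffOn (𝓡 6) (𝓡 6).tangent ∞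
      (fun y => ((∑ i, hs.coeff i x v • e.localFrame b i y : TangentSpace (𝓡 6) y) :
        TangentBundle (𝓡 6) M)) e.baseSet :=
    ContMDiffOn.sum_section fun i _ => (hs.contMDiffOn i).const_smul_section
  obtain ⟨f, hf, -, hfX⟩ := exists_global_extension (e.open_baseSet.mem_nhds hxe) hX
  refine ⟨_, hfX, ?_⟩
  have h1 := (hs.toBasisAt hxe).sum_repr v
  simp only [hf, one_smul, IsLocalFrameOn.coeff, hxe, dif_pos, Module.Basis.coord_apply]
  simpa using h1

/-- Every vector of a distribution is the value of a smooth section. -/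
theorem Distribution.exists_isSection [T2Space M] {r : ℕ} (D : Distribution M r) {x : M}
    {v : TangentSpace (𝓡 6) x} (hv : v ∈ D.fiber x) :
    ∃ X : Π y : M, TangentSpace (𝓡 6) y, D.IsSection X ∧ X x = v := by
  obtain ⟨U, hU, s, hs, hli⟩ := D.exists_frame x
  rw [← (hli x (mem_of_mem_nhds hU)).2] at hv
  obtain ⟨c, hc⟩ := (Submodule.mem_span_range_iff_exists_fun ℝ).1 hv
  have hX : ContMDiffOn (𝓡 6) (𝓡 6).tangent ∞
      (fun y => ((∑ i, c i • s i y : TangentSpace (𝓡 6) y) : TangentBundle (𝓡 6) M)) U :=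
    ContMDiffOn.sum_section fun i _ => (hs i).const_smul_section
  obtain ⟨f, hf, hf0, hfX⟩ := exists_global_extension hU hX
  refine ⟨_, ⟨hfX, fun y => ?_⟩, by simp only [hf, one_smul, hc]⟩
  by_cases hy : y ∈ U
  · rw [← (hli y hy).2]
    exact Submodule.smul_mem _ _ (Submodule.sum_mem _ fun i _ => Submodule.smul_mem _ _
      (Submodule.subset_span ⟨i, rfl⟩))
  · simp only [hf0 y hy, zero_smul]
    exact Submodule.zero_mem _

theorem Distribution.IsSection.isSectionAt {r : ℕ} {D : Distribution M r}
    {X : Π y : M, TangentSpace (𝓡 6) y} (h : D.IsSection X) (x : M) : D.IsSectionAt X x :=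
  ⟨h.1 x, Filter.Eventually.of_forall h.2⟩

theorem Distribution.finrank_fiber {r : ℕ} (D : Distribution M r) (x : M) :
    Module.finrank ℝ (D.fiber x) = r := by
  obtain ⟨U, hU, s, hs, hli⟩ := D.exists_frame x
  obtain ⟨h1, h2⟩ := hli x (mem_of_mem_nhds hU)
  rw [← h2, finrank_span_eq_card h1, Fintype.card_fin]

theorem Distribution.finrank_quot (D : Distribution M 4) (x : M) :
    Module.finrank ℝ (D.Quot x) = 2 := by
  have := (D.fiber x).finrank_quotient_add_finrank
  rw [D.finrank_fiber, finrank_tangentSpace] at this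
  exact Nat.add_right_cancel (m := 4) this

/-- Two fields which are independent modulo a distribution of rank four complete a frame of the
distribution to a local frame of the tangent bundle. -/
theorem Distribution.exists_adapted_frame (D : Distribution M 4)
    {t : Fin 2 → Π y : M, TangentSpace (𝓡 6) y} {U : Set M} {x : M} (hU : U ∈ 𝓝 x)
    (ht : ∀ i, ContMDiffOn (𝓡 6) (𝓡 6).tangent ∞
      (fun y => (t i y : TangentBundle (𝓡 6) M)) U)
    (hli : LinearIndependent ℝ fun i => (D.fiber x).mkQ (t i x)) :
    ∃ U' ⊆ U, IsOpen U' ∧ x ∈ U' ∧ ∃ s : Fin 4 → Π y : M, TangentSpace (𝓡 6) y,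
      IsLocalFrameOn (𝓡 6) E6 ∞ (Sum.elim s t) U' ∧
      ∀ y ∈ U', Submodule.span ℝ (Set.range fun i => s i y) = D.fiber y := by
  obtain ⟨U₁, hU₁, s, hs, hsli⟩ := D.exists_frame x
  have hx₁ := mem_of_mem_nhds hU₁
  have hm : ∀ i, s i x ∈ D.fiber x := fun i => by
    rw [← (hsli x hx₁).2]; exact Submodule.subset_span ⟨i, rfl⟩
  have hli' : LinearIndependent ℝ fun i => Sum.elim s t i x := by
    have h1 : LinearIndependent ℝ (fun i => (⟨s i x, hm i⟩ : D.fiber x)) :=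
      LinearIndependent.of_comp (D.fiber x).subtype (hsli x hx₁).1
    have h2 := h1.sumElim_of_quotient (fun i => t i x) hli
    have heq : (fun i => Sum.elim s t i x) =
        Sum.elim (fun i => ((⟨s i x, hm i⟩ : D.fiber x) : TangentSpace (𝓡 6) x))
          fun i => t i x := funext fun i => by cases i <;> rfl
    rw [heq]
    exact h2
  obtain ⟨U', hU', hU'o, hxU', hf⟩ := exists_isLocalFrameOn (s := Sum.elim s t)
    (Filter.inter_mem hU hU₁) (by
      rintro (i | i)
      · exact (hs i).mono Set.inter_subset_right
      · exact (ht i).mono Set.inter_subset_left) hli' (by simp)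
  exact ⟨U', fun y hy => (hU' hy).1, hU'o, hxU', s, hf, fun y hy => (hsli y (hU' hy).2).2⟩

/-! ### Brackets with sections of the distribution -/

namespace Distribution

variable {r : ℕ} (D : Distribution M r)

/-- A local frame of a distribution gives bases of its fibres. -/
theorem exists_basis_of_frame {x : M} {s : Fin r → TangentSpace (𝓡 6) x}
    (hli : LinearIndependent ℝ s) (hsp : Submodule.span ℝ (Set.range s) = D.fiber x) :
    ∃ b : Module.Basis (Fin r) ℝ (D.fiber x), ∀ i, (b i : TangentSpace (𝓡 6) x) = s i := by
  have hm : ∀ i, s i ∈ D.fiber x := fun i => by rw [← hsp]; exact Submodule.subset_span ⟨i, rfl⟩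
  have hlx : LinearIndependent ℝ (fun i => (⟨s i, hm i⟩ : D.fiber x)) :=
    LinearIndependent.of_comp (D.fiber x).subtype hli
  refine ⟨Module.Basis.mk hlx ?_, fun i => by rw [Module.Basis.mk_apply]⟩
  rintro ⟨u, hu⟩ -
  rw [← hsp] at hu
  obtain ⟨c, hc⟩ := (Submodule.mem_span_range_iff_exists_fun ℝ).1 hu
  refine (Submodule.mem_span_range_iff_exists_fun ℝ).2 ⟨c, ?_⟩
  ext1
  simpa using hc

/-- Modulo `D`, the bracket of a vector field with a section of `D` depends only on the value of
the section. -/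
theorem exists_lieMod (W : Π y : M, TangentSpace (𝓡 6) y) (x : M) :
    ∃ A : D.fiber x →ₗ[ℝ] D.Quot x, ∀ (ζ : Π y : M, TangentSpace (𝓡 6) y) (v : D.fiber x),
      D.IsSectionAt ζ x → ζ x = v →
        A v = (D.fiber x).mkQ (VectorField.mlieBracket (𝓡 6) W ζ x) := by
  obtain ⟨U, hU, s, hs, hli⟩ := D.exists_frame x
  have hxU : x ∈ U := mem_of_mem_nhds hU
  obtain ⟨b, hb⟩ := D.exists_basis_of_frame (hli x hxU).1 (hli x hxU).2
  refine ⟨b.constr ℝ fun i => (D.fiber x).mkQ (VectorField.mlieBracket (𝓡 6) W (s i) x),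
    fun ζ v hζ hv => ?_⟩
  obtain ⟨f, hf, hfζ⟩ := D.exists_coeff hU hs hli hζ
  have hv' : v = ∑ i, f i x • b i := by
    ext1
    rw [← hv, hfζ.self_of_nhds]
    simp [hb]
  rw [hv', map_sum, VectorField.mlieBracket_swap_apply, map_neg,
    D.mkQ_bracket_eq_sum hU hs (fun i => by rw [← hb]; exact (b i).2) hf hfζ,
    ← Finset.sum_neg_distrib]
  refine Finset.sum_congr rfl fun i _ => ?_
  rw [map_smul, Module.Basis.constr_basis, VectorField.mlieBracket_swap_apply, map_neg, smul_neg]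

/-- The bracket `ζ ↦ [W, ζ] mod D` with a fixed vector field `W` is tensorial on sections of `D`;
this is the resulting linear map on the fibre at `x`. -/
def lieMod (W : Π y : M, TangentSpace (𝓡 6) y) (x : M) : D.fiber x →ₗ[ℝ] D.Quot x :=
  (D.exists_lieMod W x).choose

theorem lieMod_apply (W : Π y : M, TangentSpace (𝓡 6) y) {x : M}
    {ζ : Π y : M, TangentSpace (𝓡 6) y} {v : D.fiber x} (hζ : D.IsSectionAt ζ x) (hv : ζ x = v) :
    D.lieMod W x v = (D.fiber x).mkQ (VectorField.mlieBracket (𝓡 6) W ζ x) :=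
  (D.exists_lieMod W x).choose_spec ζ v hζ hv

variable [T2Space M]

theorem exists_isSectionAt {x : M} (v : D.fiber x) :
    ∃ ζ : Π y : M, TangentSpace (𝓡 6) y, D.IsSectionAt ζ x ∧ ζ x = v := by
  obtain ⟨ζ, h1, h2⟩ := D.exists_isSection v.2
  exact ⟨ζ, h1.isSectionAt x, h2⟩

theorem lieMod_congr {W W' : Π y : M, TangentSpace (𝓡 6) y} {x : M} (h : W =ᶠ[𝓝 x] W') :
    D.lieMod W x = D.lieMod W' x := by
  ext1 v
  obtain ⟨ζ, hζ, hv⟩ := D.exists_isSectionAt v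
  rw [D.lieMod_apply W hζ hv, D.lieMod_apply W' hζ hv]
  exact congrArg _ (Filter.EventuallyEq.mlieBracket_vectorField_eq h Filter.EventuallyEq.rfl)

theorem lieMod_add {W W' : Π y : M, TangentSpace (𝓡 6) y} {x : M} (h : DiffAt W x)
    (h' : DiffAt W' x) : D.lieMod (W + W') x = D.lieMod W x + D.lieMod W' x := by
  ext1 v
  obtain ⟨ζ, hζ, hv⟩ := D.exists_isSectionAt v
  rw [LinearMap.add_apply, D.lieMod_apply _ hζ hv, D.lieMod_apply _ hζ hv, D.lieMod_apply _ hζ hv,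
    VectorField.mlieBracket_add_left h h', map_add]

/-- Failure of `lieMod` to be linear over functions. -/
theorem exists_lieMod_smul {f : M → ℝ} {x : M} (hf : MDifferentiableAt (𝓡 6) 𝓘(ℝ, ℝ) f x) :
    ∃ δ : D.fiber x →ₗ[ℝ] ℝ, ∀ (W : Π y : M, TangentSpace (𝓡 6) y) (v : D.fiber x), DiffAt W x →
      D.lieMod (f • W) x v = f x • D.lieMod W x v - δ v • (D.fiber x).mkQ (W x) := by
  refine ⟨(mfderiv (𝓡 6) 𝓘(ℝ, ℝ) f x).toLinearMap ∘ₗ (D.fiber x).subtype, fun W v hW => ?_⟩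
  obtain ⟨ζ, hζ, hv⟩ := D.exists_isSectionAt v
  rw [D.lieMod_apply _ hζ hv, D.lieMod_apply _ hζ hv, VectorField.mlieBracket_smul_left hf hW,
    map_add, map_smul, map_smul, hv]
  rw [neg_smul, neg_add_eq_sub]
  rfl

theorem lieMod_of_isSectionAt {W : Π y : M, TangentSpace (𝓡 6) y} {x : M} (h : D.IsSectionAt W x)
    {u : D.fiber x} (hu : W x = u) (v : D.fiber x) :
    D.lieMod W x v = D.leviForm x ![u, v] := by
  obtain ⟨ζ, hζ, hv⟩ := D.exists_isSectionAt v
  rw [D.lieMod_apply _ hζ hv, D.leviForm_apply x W ζ u v h hζ hu hv]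

end Distribution

/-! ### Compatible fields of complex structures -/

section Compatible

variable {r : ℕ} {D : Distribution M r} {x : M}

/-- The restriction to the fibre of the distribution of an endomorphism which preserves it. -/
def fiberMap {j : TangentSpace (𝓡 6) x →L[ℝ] TangentSpace (𝓡 6) x}
    (h : ∀ v ∈ D.fiber x, j v ∈ D.fiber x) : D.fiber x →ₗ[ℝ] D.fiber x :=
  j.toLinearMap.restrict h

/-- The endomorphism of the fibre of the quotient bundle induced by an endomorphism which preserves
the distribution. -/
def quotMap {j : TangentSpace (𝓡 6) x →L[ℝ] TangentSpace (𝓡 6) x}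
    (h : ∀ v ∈ D.fiber x, j v ∈ D.fiber x) : D.Quot x →ₗ[ℝ] D.Quot x :=
  (D.fiber x).mapQ (D.fiber x) j.toLinearMap h

@[simp] theorem coe_fiberMap {j : TangentSpace (𝓡 6) x →L[ℝ] TangentSpace (𝓡 6) x}
    (h : ∀ v ∈ D.fiber x, j v ∈ D.fiber x) (v : D.fiber x) :
    (fiberMap h v : TangentSpace (𝓡 6) x) = j v := rfl

theorem quotMap_mkQ {j : TangentSpace (𝓡 6) x →L[ℝ] TangentSpace (𝓡 6) x}
    (h : ∀ v ∈ D.fiber x, j v ∈ D.fiber x) (v : TangentSpace (𝓡 6) x) :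
    quotMap h ((D.fiber x).mkQ v) = (D.fiber x).mkQ (j v) := rfl

theorem fiberMap_sq {j : TangentSpace (𝓡 6) x →L[ℝ] TangentSpace (𝓡 6) x}
    (h : ∀ v ∈ D.fiber x, j v ∈ D.fiber x) (hj : ∀ v, j (j v) = -v) (v : D.fiber x) :
    fiberMap h (fiberMap h v) = -v := Subtype.ext (hj v)

theorem quotMap_sq {j : TangentSpace (𝓡 6) x →L[ℝ] TangentSpace (𝓡 6) x}
    (h : ∀ v ∈ D.fiber x, j v ∈ D.fiber x) (hj : ∀ v, j (j v) = -v) (w : D.Quot x) :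
    quotMap h (quotMap h w) = -w := by
  obtain ⟨v, rfl⟩ := (D.fiber x).mkQ_surjective w
  rw [quotMap_mkQ, quotMap_mkQ, hj, map_neg]

variable (D) in
/-- On the set `U`, the field `J` is a smooth field of complex structures which preserve `D` and for
which the Levi form is complex bilinear. -/
structure IsCompatibleOn (J : Π y : M, TangentSpace (𝓡 6) y →L[ℝ] TangentSpace (𝓡 6) y)
    (U : Set M) : Prop where
  smooth : ∀ y ∈ U, EndSmoothAt J y
  sq : ∀ y ∈ U, ∀ v, J y (J y v) = -v
  preserves : ∀ y ∈ U, ∀ v ∈ D.fiber y, J y v ∈ D.fiber y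
  bilinear : ∀ y (hy : y ∈ U) (u v : D.fiber y),
    D.leviForm y ![fiberMap (preserves y hy) u, v] =
      quotMap (preserves y hy) (D.leviForm y ![u, v])

variable {J : Π y : M, TangentSpace (𝓡 6) y →L[ℝ] TangentSpace (𝓡 6) y}

/-- The linear map `η ↦ [ξ, η] + J[Jξ, η] mod D` on the fibre of `D` at `x`. -/
def halfTensor (h : ∀ v ∈ D.fiber x, J x v ∈ D.fiber x) (ξ : Π y : M, TangentSpace (𝓡 6) y) :
    D.fiber x →ₗ[ℝ] D.Quot x :=
  D.lieMod ξ x + quotMap h ∘ₗ D.lieMod (fun y => J y (ξ y)) x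

/-- The linear map `η ↦ [ξ, η] + J[Jξ, η] - J[ξ, Jη] + [Jξ, Jη] mod D` on the fibre of `D`
at `x`. -/
def fullTensor (h : ∀ v ∈ D.fiber x, J x v ∈ D.fiber x) (ξ : Π y : M, TangentSpace (𝓡 6) y) :
    D.fiber x →ₗ[ℝ] D.Quot x :=
  halfTensor h ξ - quotMap h ∘ₗ halfTensor h ξ ∘ₗ fiberMap h

theorem fullTensor_apply (h : ∀ v ∈ D.fiber x, J x v ∈ D.fiber x) (hj : ∀ v, J x (J x v) = -v)
    (ξ : Π y : M, TangentSpace (𝓡 6) y) (v : D.fiber x) :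
    fullTensor h ξ v = D.lieMod ξ x v + quotMap h (D.lieMod (fun y => J y (ξ y)) x v)
      - quotMap h (D.lieMod ξ x (fiberMap h v))
      + D.lieMod (fun y => J y (ξ y)) x (fiberMap h v) := by
  simp only [fullTensor, halfTensor, LinearMap.sub_apply, LinearMap.add_apply,
    LinearMap.comp_apply, map_add, quotMap_sq h hj]
  abel

/-- Complex linearity in `η`. -/
theorem fullTensor_fiberMap (h : ∀ v ∈ D.fiber x, J x v ∈ D.fiber x) (hj : ∀ v, J x (J x v) = -v)
    (ξ : Π y : M, TangentSpace (𝓡 6) y) (v : D.fiber x) :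
    fullTensor h ξ (fiberMap h v) = quotMap h (fullTensor h ξ v) := by
  simp only [fullTensor, LinearMap.sub_apply, LinearMap.comp_apply, map_sub, quotMap_sq h hj,
    fiberMap_sq h hj, map_neg]
  abel

variable {U : Set M}

theorem IsCompatibleOn.diffAt_apply (hJ : IsCompatibleOn D J U) (hx : x ∈ U)
    {ξ : Π y : M, TangentSpace (𝓡 6) y} (hξ : DiffAt ξ x) : DiffAt (fun y => J y (ξ y)) x :=
  (hJ.smooth x hx).apply_diffAt hξ

theorem IsCompatibleOn.isSectionAt_apply (hJ : IsCompatibleOn D J U) (hU : IsOpen U) (hx : x ∈ U)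
    {ξ : Π y : M, TangentSpace (𝓡 6) y} (hξ : D.IsSectionAt ξ x) :
    D.IsSectionAt (fun y => J y (ξ y)) x := by
  refine ⟨(hJ.smooth x hx).apply hξ.1, ?_⟩
  filter_upwards [hξ.2, hU.mem_nhds hx] with y h1 h2
  exact hJ.preserves y h2 _ h1

variable [T2Space M]

theorem IsCompatibleOn.halfTensor_tensorial (hJ : IsCompatibleOn D J U) (hx : x ∈ U) :
    TensorialAt (𝓡 6) E6 (halfTensor (hJ.preserves x hx)) x where
  smul {f σ} hf hσ := by
    obtain ⟨δ, hδ⟩ := D.exists_lieMod_smul hf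
    ext1 v
    have h1 : (fun y => J y ((f • σ) y)) = f • fun y => J y (σ y) := by
      ext1 y; exact (J y).map_smul _ _
    simp only [halfTensor, LinearMap.smul_apply, LinearMap.add_apply, LinearMap.comp_apply, h1]
    rw [hδ σ v hσ, hδ _ v (hJ.diffAt_apply hx hσ), map_sub, map_smul, map_smul, quotMap_mkQ,
      hJ.sq x hx, map_neg]
    module
  add {σ σ'} hσ hσ' := by
    have h1 : (fun y => J y ((σ + σ') y)) = (fun y => J y (σ y)) + fun y => J y (σ' y) := by
      ext1 y; exact (J y).map_add _ _
    simp only [halfTensor, h1]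
    rw [D.lieMod_add hσ hσ', D.lieMod_add (hJ.diffAt_apply hx hσ) (hJ.diffAt_apply hx hσ'),
      LinearMap.comp_add]
    abel

theorem IsCompatibleOn.fullTensor_tensorial (hJ : IsCompatibleOn D J U) (hx : x ∈ U) :
    TensorialAt (𝓡 6) E6 (fullTensor (hJ.preserves x hx)) x where
  smul hf hσ := by
    simp only [fullTensor, (hJ.halfTensor_tensorial hx).smul hf hσ]
    rw [LinearMap.smul_comp, LinearMap.comp_smul, smul_sub]
  add hσ hσ' := by
    simp only [fullTensor, (hJ.halfTensor_tensorial hx).add hσ hσ']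
    rw [LinearMap.add_comp, LinearMap.comp_add]
    abel

/-- Complex bilinearity of the Levi form makes the tensor vanish on `D`. -/
theorem IsCompatibleOn.halfTensor_eq_zero (hJ : IsCompatibleOn D J U) (hU : IsOpen U) (hx : x ∈ U)
    {ξ : Π y : M, TangentSpace (𝓡 6) y} (hξ : DiffAt ξ x) (hξx : ξ x ∈ D.fiber x) :
    halfTensor (hJ.preserves x hx) ξ = 0 := by
  obtain ⟨ζ, hζ, hv⟩ := D.exists_isSectionAt ⟨ξ x, hξx⟩
  rw [(hJ.halfTensor_tensorial hx).pointwise hξ (SmoothAt.diffAt hζ.1) hv.symm]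
  ext1 v
  have h1 : (fun y => J y (ζ y)) x = fiberMap (hJ.preserves x hx) ⟨ξ x, hξx⟩ := by
    simp [hv]
  simp only [halfTensor, LinearMap.add_apply, LinearMap.comp_apply]
  rw [D.lieMod_of_isSectionAt hζ hv, D.lieMod_of_isSectionAt (hJ.isSectionAt_apply hU hx hζ) h1,
    hJ.bilinear x hx, quotMap_sq _ (hJ.sq x hx)]
  simp

theorem IsCompatibleOn.fullTensor_eq_zero (hJ : IsCompatibleOn D J U) (hU : IsOpen U) (hx : x ∈ U)
    {ξ : Π y : M, TangentSpace (𝓡 6) y} (hξ : DiffAt ξ x) (hξx : ξ x ∈ D.fiber x) :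
    fullTensor (hJ.preserves x hx) ξ = 0 := by
  rw [fullTensor, hJ.halfTensor_eq_zero hU hx hξ hξx]
  simp

theorem lieMod_neg (W : Π y : M, TangentSpace (𝓡 6) y) (hW : DiffAt W x) :
    D.lieMod (-W) x = -D.lieMod W x := by
  ext1 v
  obtain ⟨ζ, hζ, hv⟩ := D.exists_isSectionAt v
  have h1 : (-W) = (-1 : ℝ) • W := by simp
  rw [LinearMap.neg_apply, D.lieMod_apply _ hζ hv, D.lieMod_apply _ hζ hv, h1,
    VectorField.mlieBracket_const_smul_left hW, map_smul, neg_one_smul]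

/-- Complex antilinearity in `ξ`. -/
theorem IsCompatibleOn.fullTensor_app (hJ : IsCompatibleOn D J U) (hU : IsOpen U) (hx : x ∈ U)
    {ξ : Π y : M, TangentSpace (𝓡 6) y} (hξ : DiffAt ξ x) (v : D.fiber x) :
    fullTensor (hJ.preserves x hx) (fun y => J y (ξ y)) v =
      -quotMap (hJ.preserves x hx) (fullTensor (hJ.preserves x hx) ξ v) := by
  have h1 : D.lieMod (fun y => J y (J y (ξ y))) x = -D.lieMod ξ x := by
    rw [← lieMod_neg ξ hξ]
    refine D.lieMod_congr ?_
    filter_upwards [hU.mem_nhds hx] with y hy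
    exact hJ.sq y hy _
  simp only [fullTensor_apply _ (hJ.sq x hx), h1, map_add, map_sub, LinearMap.neg_apply, map_neg,
    quotMap_sq _ (hJ.sq x hx)]
  abel

/-- If two compatible fields agree on `D` and on `TM/D`, their tensors differ by a Levi form. -/
theorem IsCompatibleOn.fullTensor_sub
    {J' : Π y : M, TangentSpace (𝓡 6) y →L[ℝ] TangentSpace (𝓡 6) y}
    (hJ : IsCompatibleOn D J U) (hJ' : IsCompatibleOn D J' U) (hU : IsOpen U) (hx : x ∈ U)
    (hD : ∀ y ∈ U, ∀ v ∈ D.fiber y, J' y v = J y v) (hQ : ∀ y ∈ U, ∀ v, J' y v - J y v ∈ D.fiber y)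
    {ξ : Π y : M, TangentSpace (𝓡 6) y} (hξ : SmoothAt ξ x) (v : D.fiber x) :
    fullTensor (hJ'.preserves x hx) ξ v = fullTensor (hJ.preserves x hx) ξ v +
      (2 : ℝ) • quotMap (hJ.preserves x hx) (D.leviForm x ![⟨_, hQ x hx (ξ x)⟩, v]) := by
  have hf : fiberMap (hJ'.preserves x hx) v = fiberMap (hJ.preserves x hx) v :=
    Subtype.ext (hD x hx _ v.2)
  have hq : quotMap (hJ'.preserves x hx) = quotMap (hJ.preserves x hx) := by
    ext w
    exact (Submodule.Quotient.eq _).2 (hQ x hx w)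
  have hs : D.IsSectionAt ((fun y => J' y (ξ y)) - fun y => J y (ξ y)) x := by
    refine ⟨((hJ'.smooth x hx).apply hξ).sub_section ((hJ.smooth x hx).apply hξ), ?_⟩
    filter_upwards [hU.mem_nhds hx] with y hy
    exact hQ y hy _
  have hl : D.lieMod (fun y => J' y (ξ y)) x = D.lieMod (fun y => J y (ξ y)) x +
      D.lieMod ((fun y => J' y (ξ y)) - fun y => J y (ξ y)) x := by
    rw [← D.lieMod_add (hJ.diffAt_apply hx hξ.diffAt) (SmoothAt.diffAt hs.1)]
    congr 1
    abel
  have hskew : D.leviForm x ![⟨_, hQ x hx (ξ x)⟩, fiberMap (hJ.preserves x hx) v] =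
      quotMap (hJ.preserves x hx) (D.leviForm x ![⟨_, hQ x hx (ξ x)⟩, v]) := by
    rw [map_swap_two, hJ.bilinear x hx, map_swap_two (D.leviForm x) v, map_neg, neg_neg]
  rw [fullTensor_apply _ (hJ.sq x hx), fullTensor_apply _ (hJ'.sq x hx), hf, hq, hl]
  simp only [LinearMap.add_apply, map_add]
  rw [D.lieMod_of_isSectionAt hs (u := ⟨_, hQ x hx (ξ x)⟩) rfl,
    D.lieMod_of_isSectionAt hs (u := ⟨_, hQ x hx (ξ x)⟩) rfl, hskew]
  module

end Compatible

/-! ### Local existence of compatible complex structures -/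

theorem IsElliptic.nondegenerate {D : Distribution M 4} (hD : IsElliptic D) (x : M) :
    Nondegenerate (D.leviForm x) := fun _ hψ _ hv => (hD x).exists_apply_ne_zero hψ hv

instance (D : Distribution M 4) (x : M) : Nontrivial (D.Quot x) :=
  Module.nontrivial_of_finrank_pos (R := ℝ) (by rw [D.finrank_quot]; norm_num)

instance (D : Distribution M 4) (x : M) : Nontrivial (D.fiber x) :=
  Module.nontrivial_of_finrank_pos (R := ℝ) (by rw [D.finrank_fiber]; norm_num)

section Frame

variable {ι : Type*} [Fintype ι] {s : ι → Π y : M, TangentSpace (𝓡 6) y} {U : Set M}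

omit [Fintype ι] in
theorem coeff_frame [DecidableEq ι] (hs : IsLocalFrameOn (𝓡 6) E6 ∞ s U) {y : M} (hy : y ∈ U)
    (i j : ι) : hs.coeff i y (s j y) = if j = i then 1 else 0 := by
  have h := hs.toBasisAt_coe hy j
  rw [← h]
  simp only [IsLocalFrameOn.coeff, hy, dif_pos, Module.Basis.coord_apply, Module.Basis.repr_self]
  rw [Finsupp.single_apply]

omit [Fintype ι] in
theorem frame_ext (hs : IsLocalFrameOn (𝓡 6) E6 ∞ s U) {y : M} (hy : y ∈ U) {W : Type*}
    [AddCommGroup W] [Module ℝ W] {f g : TangentSpace (𝓡 6) y →ₗ[ℝ] W}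
    (h : ∀ i, f (s i y) = g (s i y)) : f = g :=
  (hs.toBasisAt hy).ext fun i => by rw [hs.toBasisAt_coe hy]; exact h i

omit [Fintype ι] in
/-- A field of endomorphisms can be prescribed on a local frame. -/
theorem exists_endField (hs : IsLocalFrameOn (𝓡 6) E6 ∞ s U)
    (Y : ι → Π y : M, TangentSpace (𝓡 6) y) :
    ∃ J : Π y : M, TangentSpace (𝓡 6) y →L[ℝ] TangentSpace (𝓡 6) y,
      ∀ y ∈ U, ∀ i, J y (s i y) = Y i y := by
  classical
  refine ⟨fun y => if hy : y ∈ U then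
    LinearMap.toContinuousLinearMap ((hs.toBasisAt hy).constr ℝ fun i => Y i y) else 0,
    fun y hy i => ?_⟩
  have h := (hs.toBasisAt hy).constr_basis ℝ (fun i => Y i y) i
  rw [hs.toBasisAt_coe hy] at h
  simp only [hy, dif_pos]
  exact h

theorem endSmoothAt_of_eq_on_frame (hs : IsLocalFrameOn (𝓡 6) E6 ∞ s U) (hU : IsOpen U) {x : M}
    (hx : x ∈ U) {Y : ι → Π y : M, TangentSpace (𝓡 6) y}
    {J : Π y : M, TangentSpace (𝓡 6) y →L[ℝ] TangentSpace (𝓡 6) y}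
    (hJ : ∀ y ∈ U, ∀ i, J y (s i y) = Y i y) (hY : ∀ i, SmoothAt (Y i) x) : EndSmoothAt J x := by
  refine endSmoothAt_of_frame hs (hU.mem_nhds hx) fun i => (hY i).congr_of_eventuallyEq ?_
  filter_upwards [hU.mem_nhds hx] with y hy
  rw [hJ y hy]

end Frame

/-- A smooth local frame `s₀, …, s₃, t₀, t₁` of the tangent bundle whose first four members span the
distribution `D`. -/
structure AdaptedFrame (D : Distribution M 4) (s : Fin 4 → Π y : M, TangentSpace (𝓡 6) y)
    (t : Fin 2 → Π y : M, TangentSpace (𝓡 6) y) (U : Set M) : Prop where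
  isOpen : IsOpen U
  frame : IsLocalFrameOn (𝓡 6) E6 ∞ (Sum.elim s t) U
  span_eq : ∀ y ∈ U, Submodule.span ℝ (Set.range fun i => s i y) = D.fiber y

namespace AdaptedFrame

variable {D : Distribution M 4} {s : Fin 4 → Π y : M, TangentSpace (𝓡 6) y}
  {t : Fin 2 → Π y : M, TangentSpace (𝓡 6) y} {U : Set M} (h : AdaptedFrame D s t U) {x : M}
  (hx : x ∈ U)

include h hx

theorem smoothAt_left (i : Fin 4) : SmoothAt (s i) x :=
  h.frame.contMDiffAt h.isOpen hx (Sum.inl i)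

theorem smoothAt_right (i : Fin 2) : SmoothAt (t i) x :=
  h.frame.contMDiffAt h.isOpen hx (Sum.inr i)

theorem mem_fiber (i : Fin 4) : s i x ∈ D.fiber x := by
  rw [← h.span_eq x hx]; exact Submodule.subset_span ⟨i, rfl⟩

theorem isSectionAt (i : Fin 4) : D.IsSectionAt (s i) x := by
  refine ⟨h.smoothAt_left hx i, ?_⟩
  filter_upwards [h.isOpen.mem_nhds hx] with y hy
  exact h.mem_fiber hy i

theorem exists_fiber_basis : ∃ b : Module.Basis (Fin 4) ℝ (D.fiber x),
    ∀ i, (b i : TangentSpace (𝓡 6) x) = s i x :=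
  D.exists_basis_of_frame
    ((h.frame.linearIndependent hx).comp Sum.inl Sum.inl_injective) (h.span_eq x hx)

theorem coeff_inr_eq_zero (k : Fin 2) {v : TangentSpace (𝓡 6) x} (hv : v ∈ D.fiber x) :
    h.frame.coeff (Sum.inr k) x v = 0 := by
  rw [← h.span_eq x hx] at hv
  obtain ⟨c, rfl⟩ := (Submodule.mem_span_range_iff_exists_fun ℝ).1 hv
  rw [map_sum]
  refine Finset.sum_eq_zero fun i _ => ?_
  rw [map_smul]
  have := coeff_frame h.frame hx (Sum.inr k) (Sum.inl i)
  simp only [Sum.elim_inl] at this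
  rw [this]
  simp

/-- The classes of `t₀` and `t₁` form a basis of the fibre of `TM/D`. -/
theorem exists_quot_basis : ∃ q : Module.Basis (Fin 2) ℝ (D.Quot x),
    (∀ k, q k = (D.fiber x).mkQ (t k x)) ∧
    ∀ k v, q.repr ((D.fiber x).mkQ v) k = h.frame.coeff (Sum.inr k) x v := by
  let Φ : D.Quot x →ₗ[ℝ] (Fin 2 → ℝ) := (D.fiber x).liftQ
    (LinearMap.pi fun k => h.frame.coeff (Sum.inr k) x) fun v hv => by
      rw [LinearMap.mem_ker]
      ext k
      exact h.coeff_inr_eq_zero hx k hv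
  have hΦ : ∀ v k, Φ ((D.fiber x).mkQ v) k = h.frame.coeff (Sum.inr k) x v := fun v k => rfl
  have hΦt : ∀ k, Φ ((D.fiber x).mkQ (t k x)) = Pi.single k 1 := fun k => by
    ext j
    rw [hΦ]
    have := coeff_frame h.frame hx (Sum.inr j) (Sum.inr k)
    simp only [Sum.elim_inr] at this
    rw [this, Pi.single_apply]
    simp [eq_comm]
  have hsurj : Function.Surjective Φ := fun c => by
    refine ⟨∑ k, c k • (D.fiber x).mkQ (t k x), ?_⟩
    rw [map_sum]
    simp only [map_smul, hΦt]
    ext j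
    simp [Finset.sum_apply, Pi.single_apply]
  have hinj : Function.Injective Φ :=
    (LinearMap.injective_iff_surjective_of_finrank_eq_finrank
      (by rw [D.finrank_quot, Module.finrank_fin_fun])).2 hsurj
  refine ⟨Module.Basis.ofEquivFun (LinearEquiv.ofBijective Φ ⟨hinj, hsurj⟩), fun k => ?_,
    fun k v => ?_⟩
  · rw [Module.Basis.coe_ofEquivFun]
    refine (LinearEquiv.symm_apply_eq _).2 ?_
    exact (hΦt k).symm
  · exact hΦ v k

end AdaptedFrame

/-- The matrix of the component of the Levi form with index `k` in an adapted frame. -/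
def leviMatrix {D : Distribution M 4} {s : Fin 4 → Π y : M, TangentSpace (𝓡 6) y}
    {t : Fin 2 → Π y : M, TangentSpace (𝓡 6) y} {U : Set M} (h : AdaptedFrame D s t U) (k : Fin 2)
    (x : M) : Matrix (Fin 4) (Fin 4) ℝ :=
  fun i j => h.frame.coeff (Sum.inr k) x (VectorField.mlieBracket (𝓡 6) (s i) (s j) x)

namespace AdaptedFrame

variable {D : Distribution M 4} {s : Fin 4 → Π y : M, TangentSpace (𝓡 6) y}
  {t : Fin 2 → Π y : M, TangentSpace (𝓡 6) y} {U : Set M} (h : AdaptedFrame D s t U) {x : M}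

theorem leviMatrix_skew (k : Fin 2) (x : M) (i j : Fin 4) :
    leviMatrix h k x i j = -leviMatrix h k x j i := by
  simp only [leviMatrix]
  rw [VectorField.mlieBracket_swap_apply, map_neg]

variable (hx : x ∈ U)

include hx

theorem contMDiffAt_leviMatrix (k : Fin 2) (i j : Fin 4) :
    ContMDiffAt (𝓡 6) 𝓘(ℝ, ℝ) ∞ (fun y => leviMatrix h k y i j) x :=
  contMDiffAt_coeff h.frame (h.isOpen.mem_nhds hx)
    ((h.smoothAt_left hx i).mlieBracket (h.smoothAt_left hx j)) _

theorem leviForm_repr {b : Module.Basis (Fin 4) ℝ (D.fiber x)}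
    (hb : ∀ i, (b i : TangentSpace (𝓡 6) x) = s i x) {q : Module.Basis (Fin 2) ℝ (D.Quot x)}
    (hq : ∀ k v, q.repr ((D.fiber x).mkQ v) k = h.frame.coeff (Sum.inr k) x v) (k : Fin 2)
    (i j : Fin 4) : q.repr (D.leviForm x ![b i, b j]) k = leviMatrix h k x i j := by
  rw [D.leviForm_apply x (s i) (s j) (b i) (b j) (h.isSectionAt hx i) (h.isSectionAt hx j)
    (hb i).symm (hb j).symm, hq]
  rfl

/-- Non-zero combinations of the component matrices of an elliptic Levi form are non-degenerate. -/
theorem vecMul_leviMatrix_ne_zero (hD : IsElliptic D) {α β : ℝ} (hαβ : α ≠ 0 ∨ β ≠ 0)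
    {v : Fin 4 → ℝ} (hv : v ≠ 0) :
    Matrix.vecMul v (α • leviMatrix h 0 x + β • leviMatrix h 1 x) ≠ 0 := by
  obtain ⟨b, hb⟩ := h.exists_fiber_basis hx
  obtain ⟨q, hq, hqr⟩ := h.exists_quot_basis hx
  intro h0
  let ψ : Module.Dual ℝ (D.Quot x) := α • q.coord 0 + β • q.coord 1
  have hψ : ψ ≠ 0 := by
    intro hz
    have h1 := LinearMap.congr_fun hz (q 0)
    have h2 := LinearMap.congr_fun hz (q 1)
    simp [ψ] at h1 h2
    rcases hαβ with h | h
    · exact h h1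
    · exact h h2
  have hu : (∑ i, v i • b i) ≠ 0 := fun hz =>
    hv (funext fun i => Fintype.linearIndependent_iff.1 b.linearIndependent v hz i)
  refine hu ((hD.nondegenerate x).eq_zero_of_dual hψ fun w => ?_)
  have h1 : ψ ∘ₗ twoFormBilin (D.leviForm x) (∑ i, v i • b i) = 0 := by
    refine b.ext fun j => ?_
    have h2 := congrFun h0 j
    simp only [Matrix.vecMul, dotProduct, Matrix.add_apply, Matrix.smul_apply, smul_eq_mul,
      Pi.zero_apply] at h2
    simp only [LinearMap.comp_apply, map_sum, map_smul, LinearMap.sum_apply, LinearMap.smul_apply,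
      twoFormBilin_apply, LinearMap.zero_apply, ψ, LinearMap.add_apply, Module.Basis.coord_apply,
      h.leviForm_repr hx hb hqr, smul_eq_mul]
    rw [← h2]
  exact LinearMap.congr_fun h1 w

theorem pfaffDisc_leviMatrix_pos (hD : IsElliptic D) :
    0 < pfaffDisc (leviMatrix h 0 x) (leviMatrix h 1 x) :=
  pfaffDisc_pos (h.leviMatrix_skew 0 x) (h.leviMatrix_skew 1 x) fun _ _ hαβ _ hv =>
    h.vecMul_leviMatrix_ne_zero hx hD hαβ hv

theorem pfaffPolar_leviMatrix_ne_zero (hD : IsElliptic D) :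
    pfaffPolar (leviMatrix h 0 x) (leviMatrix h 0 x) ≠ 0 := fun h0 => by
  obtain ⟨v, hv, hv0⟩ := exists_vecMul_eq_zero_of_pfaffPolar (h.leviMatrix_skew 0 x) h0
  exact h.vecMul_leviMatrix_ne_zero hx hD (α := 1) (β := 0) (by simp) hv (by simpa using hv0)

end AdaptedFrame

theorem Distribution.exists_adaptedFrame (D : Distribution M 4)
    {t : Fin 2 → Π y : M, TangentSpace (𝓡 6) y} {U : Set M} {x : M} (hU : U ∈ 𝓝 x)
    (ht : ∀ i, ContMDiffOn (𝓡 6) (𝓡 6).tangent ∞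
      (fun y => (t i y : TangentBundle (𝓡 6) M)) U)
    (hli : LinearIndependent ℝ fun i => (D.fiber x).mkQ (t i x)) :
    ∃ U' ⊆ U, x ∈ U' ∧ ∃ s, AdaptedFrame D s t U' := by
  obtain ⟨U', h1, h2, h3, s, h4, h5⟩ := D.exists_adapted_frame hU ht hli
  exact ⟨U', h1, h3, s, h2, h4, h5⟩

section Smoothness

variable {x : M} {a c : M → Matrix (Fin 4) (Fin 4) ℝ}

omit [IsManifold (𝓡 6) ∞ M] in
theorem contMDiffAt_skewDual
    (ha : ∀ i j, ContMDiffAt (𝓡 6) 𝓘(ℝ, ℝ) ∞ (fun y => a y i j) x) (i j : Fin 4) :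
    ContMDiffAt (𝓡 6) 𝓘(ℝ, ℝ) ∞ (fun y => skewDual (a y) i j) x := by
  have h0 : ContMDiffAt (𝓡 6) 𝓘(ℝ, ℝ) ∞ (fun _ : M => (0 : ℝ)) x := contMDiffAt_const
  have hn : ∀ i j, ContMDiffAt (𝓡 6) 𝓘(ℝ, ℝ) ∞ (fun y => -a y i j) x := fun i j =>
    contDiff_neg.contMDiff.contMDiffAt.comp x (ha i j)
  fin_cases i <;> fin_cases j <;> first | exact h0 | exact ha _ _ | exact hn _ _

omit [IsManifold (𝓡 6) ∞ M] in
theorem contMDiffAt_pfaffPolar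
    (ha : ∀ i j, ContMDiffAt (𝓡 6) 𝓘(ℝ, ℝ) ∞ (fun y => a y i j) x)
    (hc : ∀ i j, ContMDiffAt (𝓡 6) 𝓘(ℝ, ℝ) ∞ (fun y => c y i j) x) :
    ContMDiffAt (𝓡 6) 𝓘(ℝ, ℝ) ∞ (fun y => pfaffPolar (a y) (c y)) x :=
  ((((((ha _ _).mul (hc _ _)).add ((ha _ _).mul (hc _ _))).sub ((ha _ _).mul (hc _ _))).sub
    ((ha _ _).mul (hc _ _))).add ((ha _ _).mul (hc _ _))).add ((ha _ _).mul (hc _ _))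

omit [IsManifold (𝓡 6) ∞ M] in
theorem contMDiffAt_inv_sqrt_pfaffDisc
    (ha : ∀ i j, ContMDiffAt (𝓡 6) 𝓘(ℝ, ℝ) ∞ (fun y => a y i j) x)
    (hc : ∀ i j, ContMDiffAt (𝓡 6) 𝓘(ℝ, ℝ) ∞ (fun y => c y i j) x)
    (hd : 0 < pfaffDisc (a x) (c x)) :
    ContMDiffAt (𝓡 6) 𝓘(ℝ, ℝ) ∞ (fun y => (√(pfaffDisc (a y) (c y)))⁻¹) x := by
  have h1 : ContMDiffAt (𝓡 6) 𝓘(ℝ, ℝ) ∞ (fun y => pfaffDisc (a y) (c y)) x := by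
    have h2 := contMDiffAt_pfaffPolar ha hc
    have := ((contMDiffAt_pfaffPolar ha ha).mul (contMDiffAt_pfaffPolar hc hc)).sub (h2.mul h2)
    refine this.congr_of_eventuallyEq (Filter.Eventually.of_forall fun y => ?_)
    simp only [pfaffDisc, Pi.mul_apply]
    ring
  have h3 : ContDiffAt ℝ ∞ (fun d : ℝ => (√d)⁻¹) (pfaffDisc (a x) (c x)) :=
    (Real.contDiffAt_sqrt hd.ne').inv (Real.sqrt_ne_zero'.2 hd)
  exact ContMDiffAt.comp (g := fun d : ℝ => (√d)⁻¹) x h3.contMDiffAt h1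

omit [IsManifold (𝓡 6) ∞ M] in
theorem contMDiffAt_pencilJ
    (ha : ∀ i j, ContMDiffAt (𝓡 6) 𝓘(ℝ, ℝ) ∞ (fun y => a y i j) x)
    (hc : ∀ i j, ContMDiffAt (𝓡 6) 𝓘(ℝ, ℝ) ∞ (fun y => c y i j) x)
    (hd : 0 < pfaffDisc (a x) (c x)) (i j : Fin 4) :
    ContMDiffAt (𝓡 6) 𝓘(ℝ, ℝ) ∞ (fun y => pencilJ (a y) (c y) i j) x := by
  have h1 : ContMDiffAt (𝓡 6) 𝓘(ℝ, ℝ) ∞ (fun y => ∑ k, a y i k * skewDual (c y) k j) x :=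
    ContMDiffAt.sum fun k _ => (ha i k).mul (contMDiffAt_skewDual hc k j)
  have h2 : ContMDiffAt (𝓡 6) 𝓘(ℝ, ℝ) ∞ (fun y => ∑ k, c y i k * skewDual (a y) k j) x :=
    ContMDiffAt.sum fun k _ => (hc i k).mul (contMDiffAt_skewDual ha k j)
  exact (contMDiffAt_inv_sqrt_pfaffDisc ha hc hd).mul (h1.sub h2)

end Smoothness

section Existence

variable [T2Space M]

/-- Near every point there is a smooth field of complex structures which preserves an elliptic
distribution and makes its Levi form complex bilinear. -/
theorem exists_isCompatibleOn {D : Distribution M 4} (hD : IsElliptic D) (x : M) :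
    ∃ (U : Set M) (J : Π y : M, TangentSpace (𝓡 6) y →L[ℝ] TangentSpace (𝓡 6) y),
      IsOpen U ∧ x ∈ U ∧ IsCompatibleOn D J U := by
  let w : Module.Basis (Fin 2) ℝ (D.Quot x) :=
    Module.finBasisOfFinrankEq ℝ (D.Quot x) (D.finrank_quot x)
  choose v hv using fun k => (D.fiber x).mkQ_surjective (w k)
  choose t ht htv using fun k => exists_isSmoothField x (v k)
  obtain ⟨U, -, hxU, s, h⟩ := D.exists_adaptedFrame (U := Set.univ) (x := x) (t := t)
    Filter.univ_mem (fun i => (ht i).contMDiffOn)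
    (by simp only [htv, hv]; exact w.linearIndependent)
  let a : M → Matrix (Fin 4) (Fin 4) ℝ := leviMatrix h 0
  let c : M → Matrix (Fin 4) (Fin 4) ℝ := leviMatrix h 1
  let ρ : M → ℝ := fun y => (√(pfaffDisc (a y) (c y)))⁻¹
  let K : M → Matrix (Fin 4) (Fin 4) ℝ := fun y => pencilJ (a y) (c y)
  have hK : ∀ y ∈ U, K y * K y = -1 := fun y hy =>
    pencilJ_mul_self (h.leviMatrix_skew 0 y) (h.leviMatrix_skew 1 y)
      (h.pfaffDisc_leviMatrix_pos hy hD)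
  have hρ : ∀ y ∈ U, ρ y * ρ y * (pfaffPolar (a y) (a y) * pfaffPolar (c y) (c y) -
      pfaffPolar (a y) (c y) ^ 2) = 1 := fun y hy => by
    have hd := h.pfaffDisc_leviMatrix_pos hy hD
    change ρ y * ρ y * pfaffDisc (a y) (c y) = 1
    simp only [ρ]
    rw [← mul_inv, Real.mul_self_sqrt hd.le, inv_mul_cancel₀ hd.ne']
  -- on `TM/D`, the coefficients are those by which `pencilJ a c` acts on the pencil of `a` and `c`
  let Y : Fin 4 ⊕ Fin 2 → Π y : M, TangentSpace (𝓡 6) y := Sum.elim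
    (fun i y => ∑ j, K y i j • s j y)
    ![fun y => (-(ρ y * pfaffPolar (a y) (c y))) • t 0 y +
        (-(ρ y * pfaffPolar (c y) (c y))) • t 1 y,
      fun y => (ρ y * pfaffPolar (a y) (a y)) • t 0 y + (ρ y * pfaffPolar (a y) (c y)) • t 1 y]
  obtain ⟨J, hJ⟩ := exists_endField h.frame Y
  have hJs : ∀ y ∈ U, ∀ i, J y (s i y) = ∑ j, K y i j • s j y := fun y hy i => hJ y hy (Sum.inl i)
  have hJ0 : ∀ y ∈ U, J y (t 0 y) = (-(ρ y * pfaffPolar (a y) (c y))) • t 0 y +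
      (-(ρ y * pfaffPolar (c y) (c y))) • t 1 y := fun y hy => hJ y hy (Sum.inr 0)
  have hJ1 : ∀ y ∈ U, J y (t 1 y) = (ρ y * pfaffPolar (a y) (a y)) • t 0 y +
      (ρ y * pfaffPolar (a y) (c y)) • t 1 y := fun y hy => hJ y hy (Sum.inr 1)
  have hpres : ∀ y ∈ U, ∀ v ∈ D.fiber y, J y v ∈ D.fiber y := fun y hy v hv => by
    rw [← h.span_eq y hy] at hv
    obtain ⟨β, rfl⟩ := (Submodule.mem_span_range_iff_exists_fun ℝ).1 hv
    rw [map_sum]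
    refine Submodule.sum_mem _ fun i _ => ?_
    rw [map_smul, hJs y hy]
    exact Submodule.smul_mem _ _ (Submodule.sum_mem _ fun j _ => Submodule.smul_mem _ _
      (h.mem_fiber hy j))
  refine ⟨U, J, h.isOpen, hxU, ⟨fun y hy => ?_, fun y hy v => ?_, hpres, fun y hy u v => ?_⟩⟩
  · have ha : ∀ i j, ContMDiffAt (𝓡 6) 𝓘(ℝ, ℝ) ∞ (fun y => a y i j) y :=
      h.contMDiffAt_leviMatrix hy 0
    have hc : ∀ i j, ContMDiffAt (𝓡 6) 𝓘(ℝ, ℝ) ∞ (fun y => c y i j) y :=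
      h.contMDiffAt_leviMatrix hy 1
    have hd := h.pfaffDisc_leviMatrix_pos hy hD
    have hρs : ContMDiffAt (𝓡 6) 𝓘(ℝ, ℝ) ∞ ρ y := contMDiffAt_inv_sqrt_pfaffDisc ha hc hd
    have hn : ∀ {f : M → ℝ}, ContMDiffAt (𝓡 6) 𝓘(ℝ, ℝ) ∞ f y →
        ContMDiffAt (𝓡 6) 𝓘(ℝ, ℝ) ∞ (fun z => -f z) y := fun hf =>
      contDiff_neg.contMDiff.contMDiffAt.comp y hf
    refine endSmoothAt_of_eq_on_frame h.frame h.isOpen hy hJ ?_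
    rintro (i | k)
    · exact SmoothAt.sum fun j => SmoothAt.smul (contMDiffAt_pencilJ ha hc hd i j)
        (h.smoothAt_left hy j)
    · fin_cases k
      · exact SmoothAt.add
          (SmoothAt.smul (hn (hρs.mul (contMDiffAt_pfaffPolar ha hc))) (h.smoothAt_right hy 0))
          (SmoothAt.smul (hn (hρs.mul (contMDiffAt_pfaffPolar hc hc))) (h.smoothAt_right hy 1))
      · exact SmoothAt.add
          (SmoothAt.smul (hρs.mul (contMDiffAt_pfaffPolar ha ha)) (h.smoothAt_right hy 0))
          (SmoothAt.smul (hρs.mul (contMDiffAt_pfaffPolar ha hc)) (h.smoothAt_right hy 1))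
  · have key : (J y).toLinearMap ∘ₗ (J y).toLinearMap = -LinearMap.id := by
      refine frame_ext h.frame hy ?_
      rintro (i | k)
      · change J y (J y (s i y)) = -s i y
        rw [hJs y hy, map_sum]
        simp only [map_smul, hJs y hy, Finset.smul_sum, smul_smul]
        rw [Finset.sum_comm]
        have h1 : ∀ k, ∑ j, (K y i j * K y j k) • s k y = (K y * K y) i k • s k y := fun k => by
          rw [Matrix.mul_apply, Finset.sum_smul]
        simp only [h1, hK y hy, Matrix.neg_apply, Matrix.one_apply, neg_smul, ite_smul, one_smul,
          zero_smul, Finset.sum_neg_distrib, Finset.sum_ite_eq, Finset.mem_univ, if_true]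
      · fin_cases k
        · change J y (J y (t 0 y)) = -t 0 y
          rw [hJ0 y hy, map_add, map_smul, map_smul, hJ0 y hy, hJ1 y hy]
          have h1 := hρ y hy
          calc _ = (-(ρ y * ρ y * (pfaffPolar (a y) (a y) * pfaffPolar (c y) (c y) -
                pfaffPolar (a y) (c y) ^ 2))) • t 0 y := by module
            _ = _ := by rw [h1, neg_smul, one_smul]
        · change J y (J y (t 1 y)) = -t 1 y
          rw [hJ1 y hy, map_add, map_smul, map_smul, hJ0 y hy, hJ1 y hy]
          have h1 := hρ y hy
          calc _ = (-(ρ y * ρ y * (pfaffPolar (a y) (a y) * pfaffPolar (c y) (c y) -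
                pfaffPolar (a y) (c y) ^ 2))) • t 1 y := by module
            _ = _ := by rw [h1, neg_smul, one_smul]
    exact LinearMap.congr_fun key v
  · obtain ⟨b, hb⟩ := h.exists_fiber_basis hy
    obtain ⟨q, hq, hqr⟩ := h.exists_quot_basis hy
    have hfb : ∀ i, fiberMap (hpres y hy) (b i) = ∑ j, K y i j • b j := fun i => by
      ext1
      rw [coe_fiberMap, hb, hJs y hy]
      simp [hb]
    have hL : ∀ i j, D.leviForm y ![b i, b j] = a y i j • q 0 + c y i j • q 1 := fun i j => by
      rw [← q.sum_repr (D.leviForm y ![b i, b j]), Fin.sum_univ_two,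
        h.leviForm_repr hy hb hqr, h.leviForm_repr hy hb hqr]
    have hq0 : quotMap (hpres y hy) (q 0) = (-(ρ y * pfaffPolar (a y) (c y))) • q 0 +
        (-(ρ y * pfaffPolar (c y) (c y))) • q 1 := by
      rw [hq, hq, quotMap_mkQ, hJ0 y hy, map_add, map_smul, map_smul]
    have hq1 : quotMap (hpres y hy) (q 1) = (ρ y * pfaffPolar (a y) (a y)) • q 0 +
        (ρ y * pfaffPolar (a y) (c y)) • q 1 := by
      rw [hq, hq, quotMap_mkQ, hJ1 y hy, map_add, map_smul, map_smul]
    have key : twoFormBilin (D.leviForm y) ∘ₗ fiberMap (hpres y hy) =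
        (twoFormBilin (D.leviForm y)).compr₂ (quotMap (hpres y hy)) := by
      refine b.ext fun i => b.ext fun j => ?_
      simp only [LinearMap.comp_apply, LinearMap.compr₂_apply, hfb, map_sum, map_smul,
        LinearMap.sum_apply, LinearMap.smul_apply, twoFormBilin_apply, hL, map_add, hq0, hq1]
      have e1 : (K y * a y) i j = ρ y * (pfaffPolar (a y) (a y) * c y i j -
          pfaffPolar (a y) (c y) * a y i j) := by
        simp only [K]
        rw [pencilJ_mul_left (h.leviMatrix_skew 0 y) (h.leviMatrix_skew 1 y)]
        rfl
      have e2 : (K y * c y) i j = ρ y * (pfaffPolar (a y) (c y) * c y i j -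
          pfaffPolar (c y) (c y) * a y i j) := by
        simp only [K]
        rw [pencilJ_mul_right (h.leviMatrix_skew 0 y) (h.leviMatrix_skew 1 y)]
        rfl
      have e3 : ∑ k, K y i k • (a y k j • q 0 + c y k j • q 1) =
          (K y * a y) i j • q 0 + (K y * c y) i j • q 1 := by
        simp only [smul_add, smul_smul, Finset.sum_add_distrib, Matrix.mul_apply, Finset.sum_smul]
      rw [e3, e1, e2]
      module
    exact LinearMap.congr_fun (LinearMap.congr_fun key u) v

end Existence

/-! ### Normalising the full bracket -/

/-- A tensorial operation is given by a linear map on the tangent space. -/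
theorem TensorialAt.exists_linearMap {A : Type*} [AddCommGroup A] [Module ℝ A]
    {Φ : (Π y : M, TangentSpace (𝓡 6) y) → A} {x : M} (hΦ : TensorialAt (𝓡 6) E6 Φ x) :
    ∃ φ : TangentSpace (𝓡 6) x →ₗ[ℝ] A, ∀ ξ : Π y : M, TangentSpace (𝓡 6) y, DiffAt ξ x →
      φ (ξ x) = Φ ξ := by
  have hE : ∀ v : TangentSpace (𝓡 6) x, DiffAt (FiberBundle.extend E6 v) x := fun v =>
    FiberBundle.mdifferentiableAt_extend ..
  refine ⟨⟨⟨fun v => Φ (FiberBundle.extend E6 v), fun v w => ?_⟩, fun c v => ?_⟩, fun ξ hξ => ?_⟩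
  · rw [← hΦ.add (hE v) (hE w)]
    exact hΦ.pointwise (hE _) (mdifferentiableAt_add_section (hE v) (hE w)) (by simp)
  · simp only [RingHom.id_apply]
    rw [← hΦ.smul (f := fun _ => c) mdifferentiableAt_const (hE v)]
    exact hΦ.pointwise (hE _) (mdifferentiableAt_const.smul_section (hE v)) (by simp)
  · exact hΦ.pointwise (hE _) hξ (by simp)

theorem linearIndependent_mkQ_pair {D : Distribution M 4} {x : M}
    {j : TangentSpace (𝓡 6) x →L[ℝ] TangentSpace (𝓡 6) x} (hj : ∀ v, j (j v) = -v)
    (h : ∀ v ∈ D.fiber x, j v ∈ D.fiber x) {v : TangentSpace (𝓡 6) x} (hv : v ∉ D.fiber x) :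
    LinearIndependent ℝ ![(D.fiber x).mkQ v, (D.fiber x).mkQ (j v)] := by
  rw [LinearIndependent.pair_iff]
  intro α β h0
  exact eq_zero_of_smul_add_smul (K := quotMap h) (quotMap_sq h hj)
    (fun hz => hv ((Submodule.Quotient.mk_eq_zero _).1 hz)) h0

/-- A compatible field can be changed by a map `TM/D → D` so that `[ξ, η] + J[Jξ, η] - J[ξ, Jη] +
[Jξ, Jη]` becomes a section of `D` for all sections `η` of `D`. The correction `H` of `Jτ`, for
one field `τ` not in `D`, solves `2 L(H, η) = J F(τ, η)` with `F` the class of the expression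
modulo `D`; both sides are complex linear in `η`, and so it suffices to solve a real component of
this equation, which is non-degenerate. -/
theorem IsCompatibleOn.exists_fullTensor_eq_zero [T2Space M] {D : Distribution M 4}
    (hD : IsElliptic D)
    {J : Π y : M, TangentSpace (𝓡 6) y →L[ℝ] TangentSpace (𝓡 6) y} {U : Set M}
    (hJ : IsCompatibleOn D J U) (hU : IsOpen U) {x : M} (hx : x ∈ U) :
    ∃ (U' : Set M) (J' : Π y : M, TangentSpace (𝓡 6) y →L[ℝ] TangentSpace (𝓡 6) y),
      IsOpen U' ∧ x ∈ U' ∧ ∃ hJ' : IsCompatibleOn D J' U', ∀ y (hy : y ∈ U')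
        (ξ : Π y : M, TangentSpace (𝓡 6) y), DiffAt ξ y →
        fullTensor (hJ'.preserves y hy) ξ = 0 := by
  obtain ⟨w, hw⟩ := exists_ne (0 : D.Quot x)
  obtain ⟨v, rfl⟩ := (D.fiber x).mkQ_surjective w
  have hv : v ∉ D.fiber x := fun h => hw ((Submodule.Quotient.mk_eq_zero _).2 h)
  obtain ⟨τ, hτ, rfl⟩ := exists_isSmoothField x v
  let t : Fin 2 → Π y : M, TangentSpace (𝓡 6) y := ![τ, fun y => J y (τ y)]
  obtain ⟨U', hU'U, hxU', s, h⟩ := D.exists_adaptedFrame (U := U) (x := x) (t := t)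
    (hU.mem_nhds hx) (by
      intro i y hy
      fin_cases i
      · exact (hτ y).contMDiffWithinAt
      · exact ((hJ.smooth y hy).apply (hτ y)).contMDiffWithinAt) (by
      convert linearIndependent_mkQ_pair (hJ.sq x hx) (hJ.preserves x hx) hv using 1
      ext i
      fin_cases i <;> rfl)
  have hJ₀ : IsCompatibleOn D J U' := ⟨fun y hy => hJ.smooth y (hU'U hy),
    fun y hy => hJ.sq y (hU'U hy), fun y hy => hJ.preserves y (hU'U hy),
    fun y hy => hJ.bilinear y (hU'U hy)⟩
  -- the fields representing the values of the tensor of `τ` on the frame of `D`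
  let G : Fin 4 → Π y : M, TangentSpace (𝓡 6) y := fun j =>
    VectorField.mlieBracket (𝓡 6) τ (s j)
      + (fun y => J y (VectorField.mlieBracket (𝓡 6) (fun y => J y (τ y)) (s j) y))
      - (fun y => J y (VectorField.mlieBracket (𝓡 6) τ (fun y => J y (s j y)) y))
      + VectorField.mlieBracket (𝓡 6) (fun y => J y (τ y)) (fun y => J y (s j y))
  have hGs : ∀ y ∈ U', ∀ j, SmoothAt (G j) y := fun y hy j => by
    have h1 : SmoothAt (fun y => J y (τ y)) y := (hJ₀.smooth y hy).apply (hτ y)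
    have h2 : SmoothAt (fun y => J y (s j y)) y := (hJ₀.smooth y hy).apply (h.smoothAt_left hy j)
    exact (((SmoothAt.mlieBracket (hτ y) (h.smoothAt_left hy j)).add_section
      ((hJ₀.smooth y hy).apply (h1.mlieBracket (h.smoothAt_left hy j)))).sub_section
      ((hJ₀.smooth y hy).apply (SmoothAt.mlieBracket (hτ y) h2))).add_section (h1.mlieBracket h2)
  have hG : ∀ y (hy : y ∈ U') (b : D.fiber y) (j : Fin 4), (b : TangentSpace (𝓡 6) y) = s j y →
      fullTensor (hJ₀.preserves y hy) τ b = (D.fiber y).mkQ (G j y) := fun y hy b j hb => by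
    have h1 := h.isSectionAt hy j
    have h2 := hJ₀.isSectionAt_apply h.isOpen hy h1
    have h3 : (fun z => J z (s j z)) y = fiberMap (hJ₀.preserves y hy) b := by
      rw [coe_fiberMap, hb]
    rw [fullTensor_apply _ (hJ₀.sq y hy), D.lieMod_apply _ h1 hb.symm, D.lieMod_apply _ h1 hb.symm,
      D.lieMod_apply _ h2 h3, D.lieMod_apply _ h2 h3, quotMap_mkQ, quotMap_mkQ]
    simp only [G, Pi.add_apply, Pi.sub_apply, map_add, map_sub]
  -- the real component with index `0`, solved by means of the Hodge dual
  let a : M → Matrix (Fin 4) (Fin 4) ℝ := leviMatrix h 0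
  let g : Fin 4 → M → ℝ := fun j y => (1 / 2) * h.frame.coeff (Sum.inr 0) y (J y (G j y))
  let c : Fin 4 → M → ℝ := fun i y =>
    -(2 / pfaffPolar (a y) (a y)) * ∑ j, g j y * skewDual (a y) j i
  let H : Π y : M, TangentSpace (𝓡 6) y := fun y => ∑ i, c i y • s i y
  have hHs : ∀ y ∈ U', SmoothAt H y := fun y hy => by
    have ha : ∀ i j, ContMDiffAt (𝓡 6) 𝓘(ℝ, ℝ) ∞ (fun y => a y i j) y :=
      h.contMDiffAt_leviMatrix hy 0
    have hP : ContMDiffAt (𝓡 6) 𝓘(ℝ, ℝ) ∞ (fun y => -(2 / pfaffPolar (a y) (a y))) y := by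
      have h3 : ContDiffAt ℝ ∞ (fun d : ℝ => -(2 / d)) (pfaffPolar (a y) (a y)) :=
        (contDiffAt_const.div contDiffAt_id (h.pfaffPolar_leviMatrix_ne_zero hy hD)).neg
      exact ContMDiffAt.comp (g := fun d : ℝ => -(2 / d)) y h3.contMDiffAt
        (contMDiffAt_pfaffPolar ha ha)
    have hg : ∀ j, ContMDiffAt (𝓡 6) 𝓘(ℝ, ℝ) ∞ (g j) y := fun j =>
      contMDiffAt_const.mul (contMDiffAt_coeff h.frame (h.isOpen.mem_nhds hy)
        ((hJ₀.smooth y hy).apply (hGs y hy j)) _)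
    refine SmoothAt.sum fun i => SmoothAt.smul (hP.mul ?_) (h.smoothAt_left hy i)
    exact ContMDiffAt.sum fun j _ => (hg j).mul (contMDiffAt_skewDual ha j i)
  have hHD : ∀ y ∈ U', H y ∈ D.fiber y := fun y hy =>
    Submodule.sum_mem _ fun i _ => Submodule.smul_mem _ _ (h.mem_fiber hy i)
  -- the equation which the correction `H` has to satisfy
  have hH : ∀ y (hy : y ∈ U') (u : D.fiber y), D.leviForm y ![⟨H y, hHD y hy⟩, u] =
      (1 / 2 : ℝ) • quotMap (hJ₀.preserves y hy) (fullTensor (hJ₀.preserves y hy) τ u) := by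
    intro y hy
    obtain ⟨b, hb⟩ := h.exists_fiber_basis hy
    obtain ⟨q, hq, hqr⟩ := h.exists_quot_basis hy
    let Δ : D.fiber y →ₗ[ℝ] D.Quot y := twoFormBilin (D.leviForm y) ⟨H y, hHD y hy⟩ -
      (1 / 2 : ℝ) • quotMap (hJ₀.preserves y hy) ∘ₗ fullTensor (hJ₀.preserves y hy) τ
    have hΔJ : ∀ u, Δ (fiberMap (hJ₀.preserves y hy) u) = quotMap (hJ₀.preserves y hy) (Δ u) := by
      intro u
      simp only [Δ, LinearMap.sub_apply, LinearMap.smul_apply, LinearMap.comp_apply,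
        twoFormBilin_apply, fullTensor_fiberMap _ (hJ₀.sq y hy), map_sub, map_smul]
      rw [map_swap_two, hJ₀.bilinear y hy, map_swap_two (D.leviForm y) u, map_neg, neg_neg]
    have hH' : (⟨H y, hHD y hy⟩ : D.fiber y) = ∑ i, c i y • b i := by
      ext1
      simp [H, hb]
    have hΔ0 : q.coord 0 ∘ₗ Δ = 0 := by
      refine b.ext fun j => ?_
      simp only [Δ, LinearMap.comp_apply, LinearMap.sub_apply, LinearMap.smul_apply, map_sub, hH',
        map_sum, map_smul, LinearMap.sum_apply, twoFormBilin_apply, Module.Basis.coord_apply,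
        h.leviForm_repr hy hb hqr, hG y hy (b j) j (hb j), quotMap_mkQ, LinearMap.zero_apply, hqr,
        smul_eq_mul]
      have hP := h.pfaffPolar_leviMatrix_ne_zero hy hD
      have h1 : ∑ i, (∑ k, g k y * skewDual (a y) k i) * a y i j =
          -(pfaffPolar (a y) (a y) / 2) * g j y := by
        have h2 := skewDual_mul_self (h.leviMatrix_skew 0 y)
        have h3 : ∀ k, ∑ i, skewDual (a y) k i * a y i j =
            (-(pfaffPolar (a y) (a y) / 2)) * (1 : Matrix (Fin 4) (Fin 4) ℝ) k j := fun k =>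
          congrFun (congrFun h2 k) j
        simp only [Finset.sum_mul, mul_assoc]
        rw [Finset.sum_comm]
        simp only [← Finset.mul_sum, h3, Matrix.one_apply]
        simp
        ring
      have h4 : ∑ i, c i y * a y i j = g j y := by
        simp only [c, mul_assoc, ← Finset.mul_sum]
        rw [h1]
        have : pfaffPolar (a y) (a y) ≠ 0 := hP
        field_simp
      rw [sub_eq_zero]
      exact h4
    intro u
    have h5 : Δ u = 0 := by
      refine eq_zero_of_dual_pair (D.finrank_quot y)
        (quotMap_sq (hJ₀.preserves y hy) (hJ₀.sq y hy))
        (ψ := q.coord 0) (fun hz => ?_) (LinearMap.congr_fun hΔ0 u) ?_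
      · have := LinearMap.congr_fun hz (q 0)
        simp at this
      · rw [← hΔJ]
        exact LinearMap.congr_fun hΔ0 _
    exact sub_eq_zero.1 h5
  -- the value on `J τ` is dictated by `J' (J' τ) = -τ`
  obtain ⟨J', hJ'⟩ := exists_endField h.frame (Sum.elim (fun i y => J y (s i y))
    ![fun y => J y (τ y) + H y, fun y => -τ y + (-1 : ℝ) • J y (H y)])
  have hJ's : ∀ y ∈ U', ∀ i, J' y (s i y) = J y (s i y) := fun y hy i => hJ' y hy (Sum.inl i)
  have hJ'0 : ∀ y ∈ U', J' y (τ y) = J y (τ y) + H y := fun y hy => hJ' y hy (Sum.inr 0)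
  have hJ'1 : ∀ y ∈ U', J' y (J y (τ y)) = -τ y + (-1 : ℝ) • J y (H y) := fun y hy =>
    hJ' y hy (Sum.inr 1)
  have hJ'D : ∀ y ∈ U', ∀ v ∈ D.fiber y, J' y v = J y v := fun y hy v hv => by
    rw [← h.span_eq y hy] at hv
    obtain ⟨β, rfl⟩ := (Submodule.mem_span_range_iff_exists_fun ℝ).1 hv
    simp only [map_sum, map_smul, hJ's y hy]
  have hJ'Q : ∀ y ∈ U', ∀ v, J' y v - J y v ∈ D.fiber y := fun y hy v => by
    have key : (D.fiber y).mkQ ∘ₗ ((J' y).toLinearMap - (J y).toLinearMap) = 0 := by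
      refine frame_ext h.frame hy ?_
      rintro (i | k)
      · change (D.fiber y).mkQ (J' y (s i y) - J y (s i y)) = 0
        rw [hJ's y hy, sub_self, map_zero]
      · fin_cases k
        · change (D.fiber y).mkQ (J' y (τ y) - J y (τ y)) = 0
          rw [hJ'0 y hy, add_sub_cancel_left]
          exact (Submodule.Quotient.mk_eq_zero _).2 (hHD y hy)
        · change (D.fiber y).mkQ (J' y (J y (τ y)) - J y (J y (τ y))) = 0
          rw [hJ'1 y hy, hJ₀.sq y hy, add_sub_cancel_left]
          exact (Submodule.Quotient.mk_eq_zero _).2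
            (Submodule.smul_mem _ _ (hJ₀.preserves y hy _ (hHD y hy)))
    exact (Submodule.Quotient.mk_eq_zero _).1 (LinearMap.congr_fun key v)
  have hpres : ∀ y ∈ U', ∀ v ∈ D.fiber y, J' y v ∈ D.fiber y := fun y hy v hv => by
    rw [hJ'D y hy v hv]; exact hJ₀.preserves y hy v hv
  have hcomp : IsCompatibleOn D J' U' := by
    refine ⟨fun y hy => ?_, fun y hy v => ?_, hpres, fun y hy u v => ?_⟩
    · refine endSmoothAt_of_eq_on_frame h.frame h.isOpen hy hJ' ?_
      rintro (i | k)
      · exact (hJ₀.smooth y hy).apply (h.smoothAt_left hy i)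
      · fin_cases k
        · exact SmoothAt.add ((hJ₀.smooth y hy).apply (hτ y)) (hHs y hy)
        · exact SmoothAt.add (ContMDiffAt.neg_section (hτ y))
            (SmoothAt.smul contMDiffAt_const ((hJ₀.smooth y hy).apply (hHs y hy)))
    · have key : (J' y).toLinearMap ∘ₗ (J' y).toLinearMap = -LinearMap.id := by
        refine frame_ext h.frame hy ?_
        have hHJ : J' y (H y) = J y (H y) := hJ'D y hy _ (hHD y hy)
        rintro (i | k)
        · change J' y (J' y (s i y)) = -s i y
          rw [hJ's y hy, hJ'D y hy _ (hJ₀.preserves y hy _ (h.mem_fiber hy i)), hJ₀.sq y hy]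
        · fin_cases k
          · change J' y (J' y (τ y)) = -τ y
            rw [hJ'0 y hy, map_add, hJ'1 y hy, hHJ]
            module
          · change J' y (J' y (J y (τ y))) = -J y (τ y)
            rw [hJ'1 y hy, map_add, map_neg, map_smul, hJ'0 y hy,
              hJ'D y hy _ (hJ₀.preserves y hy _ (hHD y hy)), hJ₀.sq y hy]
            module
      exact LinearMap.congr_fun key v
    · have hf : fiberMap (hpres y hy) u = fiberMap (hJ₀.preserves y hy) u :=
        Subtype.ext (hJ'D y hy _ u.2)
      have hq : quotMap (hpres y hy) = quotMap (hJ₀.preserves y hy) := by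
        ext w
        exact (Submodule.Quotient.eq _).2 (hJ'Q y hy w)
      rw [hf, hq, hJ₀.bilinear y hy]
  refine ⟨U', J', h.isOpen, hxU', hcomp, fun y hy ξ hξ => ?_⟩
  -- the new tensor vanishes at `τ`, hence at `J'τ`, and on `D`
  have hτ0 : fullTensor (hcomp.preserves y hy) τ = 0 := by
    ext1 u
    have hB : (⟨J' y (τ y) - J y (τ y), hJ'Q y hy (τ y)⟩ : D.fiber y) = ⟨H y, hHD y hy⟩ := by
      ext1
      simp only [hJ'0 y hy, add_sub_cancel_left]
    rw [hJ₀.fullTensor_sub hcomp h.isOpen hy hJ'D hJ'Q (hτ y), hB, hH y hy, map_smul,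
      quotMap_sq _ (hJ₀.sq y hy)]
    simp
  obtain ⟨φ, hφ⟩ := TensorialAt.exists_linearMap (hcomp.fullTensor_tensorial hy)
  have hφD : ∀ v ∈ D.fiber y, φ v = 0 := fun v hv => by
    obtain ⟨ζ, hζ, rfl⟩ := D.exists_isSection hv
    rw [hφ ζ (SmoothAt.diffAt (hζ.1 y)), hcomp.fullTensor_eq_zero h.isOpen hy
      (SmoothAt.diffAt (hζ.1 y)) hv]
  have hφτ : φ (τ y) = 0 := by rw [hφ τ (SmoothAt.diffAt (hτ y)), hτ0]
  have hφJτ : φ (J' y (τ y)) = 0 := by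
    rw [hφ (fun z => J' z (τ z)) (hcomp.diffAt_apply hy (SmoothAt.diffAt (hτ y)))]
    ext1 u
    rw [hcomp.fullTensor_app h.isOpen hy (SmoothAt.diffAt (hτ y)), hτ0]
    simp
  have hφ0 : φ = 0 := by
    refine frame_ext h.frame hy ?_
    rintro (i | k)
    · exact hφD _ (h.mem_fiber hy i)
    · fin_cases k
      · exact hφτ
      · change φ (J y (τ y)) = 0
        rwa [hJ'0 y hy, map_add, hφD _ (hHD y hy), add_zero] at hφJτ
  rw [← hφ ξ hξ, hφ0, LinearMap.zero_apply]

/-! ### Orientation, local uniqueness and gluing -/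

theorem continuousAt_det {X n : Type*} [TopologicalSpace X] [Fintype n] [DecidableEq n]
    {A : X → Matrix n n ℝ} {x : X} (h : ∀ i j, ContinuousAt (fun y => A y i j) x) :
    ContinuousAt (fun y => (A y).det) x := by
  have h1 : ContinuousAt A x := continuousAt_pi.2 fun i => continuousAt_pi.2 (h i)
  have h2 : Continuous (Matrix.det : Matrix n n ℝ → ℝ) := Continuous.matrix_det continuous_id
  exact ContinuousAt.comp (g := Matrix.det) (f := A) h2.continuousAt h1

section Local

variable {D : Distribution M 4}
  {J : Π y : M, TangentSpace (𝓡 6) y →L[ℝ] TangentSpace (𝓡 6) y} {U : Set M} {x : M}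

theorem fiberMap_congr {j j' : TangentSpace (𝓡 6) x →L[ℝ] TangentSpace (𝓡 6) x} (hj : j = j')
    (h : ∀ v ∈ D.fiber x, j v ∈ D.fiber x) (h' : ∀ v ∈ D.fiber x, j' v ∈ D.fiber x) :
    fiberMap h = fiberMap h' := by subst hj; rfl

theorem quotMap_congr {j j' : TangentSpace (𝓡 6) x →L[ℝ] TangentSpace (𝓡 6) x} (hj : j = j')
    (h : ∀ v ∈ D.fiber x, j v ∈ D.fiber x) (h' : ∀ v ∈ D.fiber x, j' v ∈ D.fiber x) :
    quotMap h = quotMap h' := by subst hj; rfl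

theorem IsCompatibleOn.mono (hJ : IsCompatibleOn D J U) {U' : Set M} (h : U' ⊆ U) :
    IsCompatibleOn D J U' :=
  ⟨fun y hy => hJ.smooth y (h hy), fun y hy => hJ.sq y (h hy), fun y hy => hJ.preserves y (h hy),
    fun y hy => hJ.bilinear y (h hy)⟩

variable (o : ManifoldOrientation M) (D J U) in
/-- On the set `U`, the field `J` has the properties which characterise the adapted almost complex
structure. -/
structure IsAdaptedOn : Prop where
  compatible : IsCompatibleOn D J U
  orientation : ∀ y ∈ U, InducesOrientation (J y).toLinearMap (o.at_point y)
  bracket : ∀ y (hy : y ∈ U) (ξ : Π z : M, TangentSpace (𝓡 6) z), SmoothAt ξ y →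
    fullTensor (compatible.preserves y hy) ξ = 0

/-- The conjugate of a compatible field is compatible. -/
theorem IsCompatibleOn.neg (hJ : IsCompatibleOn D J U) :
    IsCompatibleOn D (fun y => -J y) U where
  smooth y hy := by
    have := ContMDiffAt.neg_section (hJ.smooth y hy)
    exact this
  sq y hy v := by simp [hJ.sq y hy]
  preserves y hy v hv := by
    simpa using (D.fiber y).neg_mem (hJ.preserves y hy v hv)
  bilinear y hy u v := by
    have h1 : ∀ h : ∀ v ∈ D.fiber y, (-J y) v ∈ D.fiber y,
        fiberMap h u = (-1 : ℝ) • fiberMap (hJ.preserves y hy) u := fun h => by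
      ext1; simp
    have h2 : ∀ h : ∀ v ∈ D.fiber y, (-J y) v ∈ D.fiber y,
        quotMap h = -quotMap (hJ.preserves y hy) := fun h => by
      ext w; rfl
    rw [h1, h2, map_cons_smul_left, hJ.bilinear y hy, LinearMap.neg_apply, neg_one_smul]

theorem IsAdaptedOn.mono {o : ManifoldOrientation M} (hJ : IsAdaptedOn D J U o) {U' : Set M}
    (h : U' ⊆ U) : IsAdaptedOn D J U' o :=
  ⟨hJ.compatible.mono h, fun y hy => hJ.orientation y (h hy), fun y hy => hJ.bracket y (h hy)⟩

/-- The Levi form and the orientation determine `J` on `D` and on `TM/D`. -/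
theorem IsAdaptedOn.eq_on {o : ManifoldOrientation M} (hD : IsElliptic D)
    {J' : Π y : M, TangentSpace (𝓡 6) y →L[ℝ] TangentSpace (𝓡 6) y}
    (hJ : IsAdaptedOn D J U o) (hJ' : IsAdaptedOn D J' U o) (hx : x ∈ U) :
    (∀ v ∈ D.fiber x, J' x v = J x v) ∧ ∀ v, J' x v - J x v ∈ D.fiber x := by
  rcases (hD.nondegenerate x).complexStructure_unique (D.finrank_quot x)
    (fiberMap_sq (hJ.compatible.preserves x hx) (hJ.compatible.sq x hx))
    (fiberMap_sq (hJ'.compatible.preserves x hx) (hJ'.compatible.sq x hx))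
    (quotMap_sq (hJ.compatible.preserves x hx) (hJ.compatible.sq x hx))
    (hJ.compatible.bilinear x hx) (hJ'.compatible.bilinear x hx) with ⟨h1, h2⟩ | ⟨h1, h2⟩
  · refine ⟨fun v hv => congrArg Subtype.val (LinearMap.congr_fun h1 ⟨v, hv⟩), fun v => ?_⟩
    exact (Submodule.Quotient.eq _).1 (LinearMap.congr_fun h2 ((D.fiber x).mkQ v))
  · -- in the remaining case `J'` and `-J` induce the same orientation
    exfalso
    have h3 : InducesOrientation (-(J x).toLinearMap) (o.at_point x) := by
      refine InducesOrientation.congr (J := (J' x).toLinearMap) (H := D.fiber x)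
        (hJ'.compatible.sq x hx) (fun v => ?_) (hJ'.compatible.preserves x hx) (fun v hv => ?_)
        (fun v => ?_) (hJ'.orientation x hx)
      · simpa using hJ.compatible.sq x hx v
      · exact (congrArg Subtype.val (LinearMap.congr_fun h1 ⟨v, hv⟩)).symm
      · exact (Submodule.Quotient.eq _).1 (LinearMap.congr_fun h2 ((D.fiber x).mkQ v)).symm
    exact InducesOrientation.not_neg (hJ.compatible.sq x hx) (finrank_tangentSpace x)
      (hJ.orientation x hx) h3

variable [T2Space M]

/-- A smooth field of complex structures which induces the given orientation at `x` does so
near `x`. -/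
theorem IsCompatibleOn.eventually_inducesOrientation (o : ManifoldOrientation M)
    (hJ : IsCompatibleOn D J U) (hU : IsOpen U) (hx : x ∈ U)
    (h : InducesOrientation (J x).toLinearMap (o.at_point x)) :
    ∀ᶠ y in 𝓝 x, InducesOrientation (J y).toLinearMap (o.at_point y) := by
  obtain ⟨b, hb1, hb3, hb5⟩ := exists_isComplexBasis (J := (J x).toLinearMap) (hJ.sq x hx)
    (finrank_tangentSpace x)
  obtain ⟨X₀, hX₀, h0⟩ := exists_isSmoothField x (b 0)
  obtain ⟨X₂, hX₂, h2⟩ := exists_isSmoothField x (b 2)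
  obtain ⟨X₄, hX₄, h4⟩ := exists_isSmoothField x (b 4)
  -- an extension of the complex basis at `x` to fields which form complex bases near `x`
  let X : Fin 6 → Π y : M, TangentSpace (𝓡 6) y :=
    ![X₀, fun y => J y (X₀ y), X₂, fun y => J y (X₂ y), X₄, fun y => J y (X₄ y)]
  have hXs : ∀ i, ∀ y ∈ U, SmoothAt (X i) y := fun i y hy => by
    fin_cases i
    · exact hX₀ y
    · exact (hJ.smooth y hy).apply (hX₀ y)
    · exact hX₂ y
    · exact (hJ.smooth y hy).apply (hX₂ y)
    · exact hX₄ y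
    · exact (hJ.smooth y hy).apply (hX₄ y)
  have hXb : (fun i => X i x) = b := by
    ext1 i
    fin_cases i
    · exact h0
    · exact (congrArg (J x) h0).trans hb1.symm
    · exact h2
    · exact (congrArg (J x) h2).trans hb3.symm
    · exact h4
    · exact (congrArg (J x) h4).trans hb5.symm
  obtain ⟨U', hU'U, hU', hxU', f⟩ := exists_isLocalFrameOn (s := X) (hU.mem_nhds hx)
    (fun i y hy => (hXs i y hy).contMDiffWithinAt)
    (by rw [hXb]; exact b.linearIndependent) (by simp)
  have hf : ∀ y (hy : y ∈ U'), IsComplexBasis (J y).toLinearMap (f.toBasisAt hy) := fun y hy => by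
    refine ⟨?_, ?_, ?_⟩ <;> rw [f.toBasisAt_coe hy, f.toBasisAt_coe hy] <;> rfl
  obtain ⟨U₂, hU₂, s, hs, ho⟩ := o.exists_frame x
  have hdet : ∀ y (hy : y ∈ U') (hy₂ : y ∈ U₂), (hs.toBasisAt hy₂).det (f.toBasisAt hy) =
      Matrix.det (fun i j => hs.coeff i y (X j y)) := fun y hy hy₂ => by
    rw [Module.Basis.det_apply]
    congr 1
    ext i j
    rw [Module.Basis.toMatrix_apply, IsLocalFrameOn.toBasisAt_coe]
    simp [IsLocalFrameOn.coeff, hy₂]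
  have hcont : ContinuousAt (fun y => Matrix.det fun i j => hs.coeff i y (X j y)) x :=
    continuousAt_det fun i j => (contMDiffAt_coeff hs hU₂ (hXs j x hx) i).continuousAt
  have hpos : 0 < Matrix.det fun i j => hs.coeff i x (X j x) := by
    rw [← hdet x hxU' (mem_of_mem_nhds hU₂), ← Module.Basis.orientation_eq_iff_det_pos,
      ho x (mem_of_mem_nhds hU₂), h _ (hf x hxU')]
  filter_upwards [hU'.mem_nhds hxU', hU₂, hcont.eventually (lt_mem_nhds hpos)] with y hy hy₂ hyp
  rw [← hdet y hy hy₂, ← Module.Basis.orientation_eq_iff_det_pos, ho y hy₂] at hyp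
  rw [hyp]
  exact (hf y hy).inducesOrientation (hJ.sq y (hU'U hy))

theorem IsCompatibleOn.fullTensor_neg (hJ : IsCompatibleOn D J U) (hx : x ∈ U)
    {ξ : Π y : M, TangentSpace (𝓡 6) y} (hξ : DiffAt ξ x) :
    fullTensor (J := fun y => -J y) (hJ.neg.preserves x hx) ξ =
      fullTensor (hJ.preserves x hx) ξ := by
  have h1 : ∀ u, fiberMap (hJ.neg.preserves x hx) u = -fiberMap (hJ.preserves x hx) u :=
    fun u => rfl
  have h2 : quotMap (hJ.neg.preserves x hx) = -quotMap (hJ.preserves x hx) := by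
    ext w; rfl
  have h3 : D.lieMod (fun y => (-J y) (ξ y)) x = -D.lieMod (fun y => J y (ξ y)) x :=
    lieMod_neg _ (hJ.diffAt_apply hx hξ)
  ext1 v
  rw [fullTensor_apply _ (hJ.neg.sq x hx), fullTensor_apply _ (hJ.sq x hx), h1, h2, h3]
  simp

theorem exists_isAdaptedOn (o : ManifoldOrientation M) (hD : IsElliptic D) (x : M) :
    ∃ (U : Set M) (J : Π y : M, TangentSpace (𝓡 6) y →L[ℝ] TangentSpace (𝓡 6) y),
      IsOpen U ∧ x ∈ U ∧ IsAdaptedOn D J U o := by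
  obtain ⟨U₁, J₁, hU₁, hx₁, hJ₁⟩ := exists_isCompatibleOn hD x
  obtain ⟨U, J, hU, hx, hJ, hT⟩ := hJ₁.exists_fullTensor_eq_zero hD hU₁ hx₁
  obtain ⟨J', hJ', hT', ho⟩ : ∃ (J' : Π y : M, TangentSpace (𝓡 6) y →L[ℝ] TangentSpace (𝓡 6) y)
      (hJ' : IsCompatibleOn D J' U), (∀ y (hy : y ∈ U) (ξ : Π z : M, TangentSpace (𝓡 6) z),
        DiffAt ξ y → fullTensor (hJ'.preserves y hy) ξ = 0) ∧
        InducesOrientation (J' x).toLinearMap (o.at_point x) := by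
    rcases inducesOrientation_or_neg (J := (J x).toLinearMap) (hJ.sq x hx) (finrank_tangentSpace x)
      (o.at_point x) with h | h
    · exact ⟨J, hJ, hT, h⟩
    · exact ⟨_, hJ.neg, fun y hy ξ hξ => by rw [hJ.fullTensor_neg hy hξ, hT y hy ξ hξ], h⟩
  obtain ⟨U', hU', hU'o, hxU'⟩ := mem_nhds_iff.1
    (Filter.inter_mem (hU.mem_nhds hx) (hJ'.eventually_inducesOrientation o hU hx ho))
  exact ⟨U', J', hU'o, hxU', hJ'.mono fun y hy => (hU' hy).1, fun y hy => (hU' hy).2,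
    fun y hy ξ hξ => hT' y (hU' hy).1 ξ (SmoothAt.diffAt hξ)⟩

/-- An adapted structure is unique, because its full bracket determines it once it is known on `D`
and on `TM/D`. -/
theorem IsAdaptedOn.unique {o : ManifoldOrientation M} (hD : IsElliptic D)
    {J' : Π y : M, TangentSpace (𝓡 6) y →L[ℝ] TangentSpace (𝓡 6) y}
    (hJ : IsAdaptedOn D J U o) (hJ' : IsAdaptedOn D J' U o) (hU : IsOpen U) (hx : x ∈ U) :
    J' x = J x := by
  ext1 w
  obtain ⟨ξ, hξ, rfl⟩ := exists_isSmoothField x w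
  have hDQ := fun y (hy : y ∈ U) => hJ.eq_on hD hJ' hy
  have h0 : (⟨_, (hDQ x hx).2 (ξ x)⟩ : D.fiber x) = 0 := by
    refine (hD.nondegenerate x).eq_zero fun v => ?_
    have h1 := hJ.compatible.fullTensor_sub hJ'.compatible hU hx (fun y hy => (hDQ y hy).1)
      (fun y hy => (hDQ y hy).2) (hξ x) v
    rw [hJ.bracket x hx ξ (hξ x), hJ'.bracket x hx ξ (hξ x), LinearMap.zero_apply, zero_add] at h1
    have h2 := (smul_eq_zero.1 h1.symm).resolve_left two_ne_zero
    have h3 := quotMap_sq (hJ.compatible.preserves x hx) (hJ.compatible.sq x hx)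
      (D.leviForm x ![⟨_, (hDQ x hx).2 (ξ x)⟩, v])
    rw [h2, map_zero] at h3
    exact neg_eq_zero.1 h3.symm
  exact sub_eq_zero.1 (congrArg Subtype.val h0)

/-- The properties of an adapted structure at a point depend only on its germ there. -/
theorem isAdaptedOn_of_eventuallyEq {o : ManifoldOrientation M} (h : ∀ x : M,
      ∃ (U : Set M) (J' : Π y : M, TangentSpace (𝓡 6) y →L[ℝ] TangentSpace (𝓡 6) y),
        x ∈ U ∧ IsAdaptedOn D J' U o ∧ ∀ᶠ y in 𝓝 x, J y = J' y) : IsAdaptedOn D J Set.univ o := by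
  have hp : ∀ y, ∀ v ∈ D.fiber y, J y v ∈ D.fiber y := fun y => by
    obtain ⟨U, J', hy, hJ', he⟩ := h y
    rw [he.self_of_nhds]
    exact hJ'.compatible.preserves y hy
  refine ⟨⟨fun y _ => ?_, fun y _ => ?_, fun y _ => hp y, fun y _ => ?_⟩, fun y _ => ?_,
    fun y _ ξ hξ => ?_⟩
  · obtain ⟨U, J', hy, hJ', he⟩ := h y
    refine (hJ'.compatible.smooth y hy).congr_of_eventuallyEq ?_
    filter_upwards [he] with z hz
    rw [hz]
  · obtain ⟨U, J', hy, hJ', he⟩ := h y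
    rw [he.self_of_nhds]
    exact hJ'.compatible.sq y hy
  · obtain ⟨U, J', hy, hJ', he⟩ := h y
    intro u v
    rw [fiberMap_congr he.self_of_nhds (hp y) (hJ'.compatible.preserves y hy),
      quotMap_congr he.self_of_nhds (hp y) (hJ'.compatible.preserves y hy)]
    exact hJ'.compatible.bilinear y hy u v
  · obtain ⟨U, J', hy, hJ', he⟩ := h y
    rw [he.self_of_nhds]
    exact hJ'.orientation y hy
  · obtain ⟨U, J', hy, hJ', he⟩ := h y
    have h1 := hJ'.bracket y hy ξ hξ
    have h2 : (fun z => J z (ξ z)) =ᶠ[𝓝 y] fun z => J' z (ξ z) := by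
      filter_upwards [he] with z hz
      rw [hz]
    rw [← h1]
    simp only [fullTensor, halfTensor, D.lieMod_congr h2,
      fiberMap_congr he.self_of_nhds (hp y) (hJ'.compatible.preserves y hy),
      quotMap_congr he.self_of_nhds (hp y) (hJ'.compatible.preserves y hy)]

/-- The local adapted structures glue, as they agree on overlaps. -/
theorem exists_isAdaptedOn_univ (o : ManifoldOrientation M) (hD : IsElliptic D) :
    ∃ J : Π y : M, TangentSpace (𝓡 6) y →L[ℝ] TangentSpace (𝓡 6) y,
      IsAdaptedOn D J Set.univ o := by
  choose U K hU hxU hK using exists_isAdaptedOn (D := D) o hD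
  refine ⟨fun x => K x x, isAdaptedOn_of_eventuallyEq fun x => ⟨U x, K x, hxU x, hK x, ?_⟩⟩
  filter_upwards [(hU x).mem_nhds (hxU x)] with y hy
  exact IsAdaptedOn.unique (U := U x ∩ U y) hD ((hK x).mono Set.inter_subset_left)
    ((hK y).mono Set.inter_subset_right) ((hU x).inter (hU y)) ⟨hy, hxU y⟩

end Local

/-! ### Adapted almost complex structures -/

namespace AlmostComplexStructure

variable {J : AlmostComplexStructure M}

theorem smoothAt_app {X : Π y : M, TangentSpace (𝓡 6) y} {x : M} (hX : SmoothAt X x) :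
    SmoothAt (J.app X) x := EndSmoothAt.apply (J.smooth x) hX

theorem isSection_app {r : ℕ} {D : Distribution M r} (hp : J.Preserves D)
    {X : Π y : M, TangentSpace (𝓡 6) y} (hX : D.IsSection X) : D.IsSection (J.app X) :=
  ⟨fun x => J.smoothAt_app (hX.1 x), fun x => hp x _ (hX.2 x)⟩

theorem isCompatibleOn {r : ℕ} {D : Distribution M r} {hp : J.Preserves D}
    (hb : LeviComplexBilinear hp) : IsCompatibleOn D J.toFun Set.univ :=
  ⟨fun y _ => J.smooth y, fun y _ => J.sq_eq_neg y, fun y _ => hp y, fun y _ u v => (hb y u v).1⟩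

theorem mkQ_halfBracket {r : ℕ} {D : Distribution M r} (hp : J.Preserves D)
    (ξ : Π y : M, TangentSpace (𝓡 6) y) {η : Π y : M, TangentSpace (𝓡 6) y} (hη : D.IsSection η)
    (x : M) : (D.fiber x).mkQ (J.halfBracket ξ η x) = halfTensor (hp x) ξ ⟨η x, hη.2 x⟩ := by
  rw [halfTensor, LinearMap.add_apply, LinearMap.comp_apply,
    D.lieMod_apply _ (hη.isSectionAt x) rfl, D.lieMod_apply _ (hη.isSectionAt x) rfl, quotMap_mkQ]
  exact map_add _ _ _

theorem mkQ_fullBracket {r : ℕ} {D : Distribution M r} (hp : J.Preserves D)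
    (ξ : Π y : M, TangentSpace (𝓡 6) y) {η : Π y : M, TangentSpace (𝓡 6) y} (hη : D.IsSection η)
    (x : M) : (D.fiber x).mkQ (J.fullBracket ξ η x) = fullTensor (hp x) ξ ⟨η x, hη.2 x⟩ := by
  have h1 := (isSection_app hp hη).isSectionAt x
  rw [fullTensor_apply _ (J.sq_eq_neg x), D.lieMod_apply _ (hη.isSectionAt x) rfl,
    D.lieMod_apply _ (hη.isSectionAt x) rfl, D.lieMod_apply _ h1 rfl, D.lieMod_apply _ h1 rfl,
    quotMap_mkQ, quotMap_mkQ, ← map_add, ← map_sub, ← map_add]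
  rfl

/-- Complex bilinearity of the Levi form in terms of brackets of sections. -/
theorem leviComplexBilinear_iff [T2Space M] {r : ℕ} {D : Distribution M r} (hp : J.Preserves D) :
    LeviComplexBilinear hp ↔ ∀ ξ η : Π x : M, TangentSpace (𝓡 6) x,
      D.IsSection ξ → D.IsSection η → D.Contains (J.halfBracket ξ η) := by
  have key : ∀ ξ η : Π x : M, TangentSpace (𝓡 6) x, ∀ (hξ : D.IsSection ξ) (hη : D.IsSection η)
      (x : M), (D.fiber x).mkQ (J.halfBracket ξ η x) =
        D.leviForm x ![⟨ξ x, hξ.2 x⟩, ⟨η x, hη.2 x⟩] +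
          quotMap (hp x) (D.leviForm x ![fiberMap (hp x) ⟨ξ x, hξ.2 x⟩, ⟨η x, hη.2 x⟩]) := by
    intro ξ η hξ hη x
    rw [mkQ_halfBracket hp ξ hη, halfTensor, LinearMap.add_apply, LinearMap.comp_apply,
      D.lieMod_of_isSectionAt (hξ.isSectionAt x) (u := ⟨ξ x, hξ.2 x⟩) rfl,
      ← D.lieMod_of_isSectionAt ((isSection_app hp hξ).isSectionAt x)
        (u := fiberMap (hp x) ⟨ξ x, hξ.2 x⟩) rfl]
    rfl
  constructor
  · intro h ξ η hξ hη x
    refine (Submodule.Quotient.mk_eq_zero _).1 ((key ξ η hξ hη x).trans ?_)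
    have h1 := (h x ⟨ξ x, hξ.2 x⟩ ⟨η x, hη.2 x⟩).1
    change D.leviForm x ![fiberMap (hp x) _, _] = quotMap (hp x) _ at h1
    rw [h1, quotMap_sq _ (J.sq_eq_neg x), add_neg_cancel]
  · intro h
    have hl : ∀ (x : M) (u v : D.fiber x),
        D.leviForm x ![fiberMap (hp x) u, v] = quotMap (hp x) (D.leviForm x ![u, v]) := by
      rintro x ⟨u, hu⟩ ⟨v, hv⟩
      obtain ⟨ξ, hξ, rfl⟩ := D.exists_isSection hu
      obtain ⟨η, hη, rfl⟩ := D.exists_isSection hv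
      have h1 := key ξ η hξ hη x
      rw [show (D.fiber x).mkQ (J.halfBracket ξ η x) = 0 from
        (Submodule.Quotient.mk_eq_zero _).2 (h ξ η hξ hη x)] at h1
      rw [eq_neg_of_add_eq_zero_left h1.symm, map_neg, quotMap_sq _ (J.sq_eq_neg x), neg_neg]
    refine fun x u v => ⟨hl x u v, ?_⟩
    change D.leviForm x ![u, fiberMap (hp x) v] = quotMap (hp x) _
    rw [map_swap_two, hl, map_swap_two (D.leviForm x) v, map_neg, neg_neg]

end AlmostComplexStructure

variable {o : ManifoldOrientation M} {D : Distribution M 4}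
  {J : AlmostComplexStructure M}

theorem IsAdapted.isAdaptedOn [T2Space M] (h : IsAdapted o D J) :
    IsAdaptedOn D J.toFun Set.univ o := by
  have hc := J.isCompatibleOn h.bilinear
  refine ⟨hc, fun y _ b hb => h.orientation y b hb.1 hb.2.1 hb.2.2, fun y hy ξ hξ => ?_⟩
  obtain ⟨ξ', hξ', he⟩ := exists_isSmoothField y (ξ y)
  rw [(hc.fullTensor_tensorial hy).pointwise (SmoothAt.diffAt hξ) (SmoothAt.diffAt (hξ' y)) he.symm]
  ext1 ⟨v, hv⟩
  obtain ⟨η, hη, rfl⟩ := D.exists_isSection hv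
  rw [← J.mkQ_fullBracket h.preserves ξ' hη]
  exact (Submodule.Quotient.mk_eq_zero _).2 (h.bracket ξ' η hξ' hη y)

theorem IsAdaptedOn.exists_isAdapted
    {K : Π y : M, TangentSpace (𝓡 6) y →L[ℝ] TangentSpace (𝓡 6) y}
    (h : IsAdaptedOn D K Set.univ o) :
    ∃ J : AlmostComplexStructure M, IsAdapted o D J := by
  have hy : ∀ y : M, y ∈ Set.univ := Set.mem_univ
  let J : AlmostComplexStructure M :=
    ⟨K, fun y => h.compatible.smooth y (hy y), fun y => h.compatible.sq y (hy y)⟩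
  have hp : J.Preserves D := fun y => h.compatible.preserves y (hy y)
  refine ⟨J, hp, fun y b h1 h3 h5 => h.orientation y (hy y) b ⟨h1, h3, h5⟩, ?_, ?_⟩
  · refine fun x u v => ⟨h.compatible.bilinear x (hy x) u v, ?_⟩
    rw [map_swap_two]
    refine (congrArg Neg.neg (h.compatible.bilinear x (hy x) v u)).trans ?_
    rw [map_swap_two (D.leviForm x) v, map_neg, neg_neg]
    rfl
  · intro ξ η hξ hη x
    refine (Submodule.Quotient.mk_eq_zero _).1 ((J.mkQ_fullBracket hp ξ hη x).trans ?_)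
    exact LinearMap.congr_fun (h.bracket x (hy x) ξ (hξ x)) _

theorem existsUnique_isAdapted [T2Space M] (o : ManifoldOrientation M) (hD : IsElliptic D) :
    ∃! J : AlmostComplexStructure M, IsAdapted o D J := by
  obtain ⟨K, hK⟩ := exists_isAdaptedOn_univ o hD
  obtain ⟨J, hJ⟩ := hK.exists_isAdapted
  refine ⟨J, hJ, fun J' hJ' => ?_⟩
  have h : J'.toFun = J.toFun := funext fun x =>
    hJ.isAdaptedOn.unique hD hJ'.isAdaptedOn isOpen_univ (Set.mem_univ x)
  cases J
  cases J'
  cases h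
  rfl

/-! ### The tensor `S` -/

theorem IsAdapted.existsUnique_isInducedTensor [T2Space M] (h : IsAdapted o D J) :
    ∃! S : Π x : M, D.Quot x ⊗[ℝ] D.fiber x →ₗ[ℝ] D.Quot x, IsInducedTensor D J S := by
  have hc := h.isAdaptedOn.compatible
  choose φ hφ using fun x : M =>
    TensorialAt.exists_linearMap (hc.halfTensor_tensorial (Set.mem_univ x))
  have hφD : ∀ x, D.fiber x ≤ LinearMap.ker (φ x) := fun x v hv => by
    obtain ⟨ζ, hζ, rfl⟩ := D.exists_isSection hv
    have hζx := SmoothAt.diffAt (hζ.1 x)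
    rw [LinearMap.mem_ker, hφ x ζ hζx,
      hc.halfTensor_eq_zero isOpen_univ (Set.mem_univ x) hζx hv]
  refine ⟨fun x => TensorProduct.lift ((D.fiber x).liftQ (φ x) (hφD x)), ?_, ?_⟩
  · intro ξ η hξ hη x
    rw [TensorProduct.lift.tmul, J.mkQ_halfBracket h.preserves ξ hη]
    exact LinearMap.congr_fun (hφ x ξ (SmoothAt.diffAt (hξ x))) _
  · intro S hS
    ext1 x
    refine TensorProduct.ext' fun w u => ?_
    obtain ⟨v, rfl⟩ := (D.fiber x).mkQ_surjective w
    obtain ⟨u, hu⟩ := u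
    obtain ⟨ξ, hξ, rfl⟩ := exists_isSmoothField x v
    obtain ⟨η, hη, rfl⟩ := D.exists_isSection hu
    rw [hS ξ η hξ hη x, TensorProduct.lift.tmul, J.mkQ_halfBracket h.preserves ξ hη]
    exact (LinearMap.congr_fun (hφ x ξ (SmoothAt.diffAt (hξ x))) _).symm

theorem IsInducedTensor.eq_zero_iff [T2Space M]
    {S : Π x : M, D.Quot x ⊗[ℝ] D.fiber x →ₗ[ℝ] D.Quot x}
    (hS : IsInducedTensor D J S) : (∀ x, S x = 0) ↔ ∀ ξ η : Π x : M, TangentSpace (𝓡 6) x,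
      IsSmoothField ξ → D.IsSection η → D.Contains (J.halfBracket ξ η) := by
  constructor
  · intro h ξ η hξ hη x
    have h1 := hS ξ η hξ hη x
    rw [h x, LinearMap.zero_apply] at h1
    exact (Submodule.Quotient.mk_eq_zero _).1 h1.symm
  · intro h x
    refine TensorProduct.ext' fun w u => ?_
    obtain ⟨v, rfl⟩ := (D.fiber x).mkQ_surjective w
    obtain ⟨u, hu⟩ := u
    obtain ⟨ξ, hξ, rfl⟩ := exists_isSmoothField x v
    obtain ⟨η, hη, rfl⟩ := D.exists_isSection hu
    rw [hS ξ η hξ hη x, LinearMap.zero_apply]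
    exact (Submodule.Quotient.mk_eq_zero _).2 (h ξ η hξ hη x)

/-! ### The Nijenhuis tensor -/

variable (M) in
/-- The smooth vector fields on `M`. -/
def smoothFields : AddSubgroup (Π x : M, TangentSpace (𝓡 6) x) where
  carrier := {X | IsSmoothField X}
  add_mem' hX hY := fun x => ContMDiffAt.add_section (hX x) (hY x)
  zero_mem' := fun _ => Bundle.contMDiff_zeroSection ..
  neg_mem' hX := fun x => ContMDiffAt.neg_section (hX x)

/-- The Lie ring of smooth vector fields. -/
instance : LieRing (smoothFields M) where
  bracket X Y := ⟨VectorField.mlieBracket (𝓡 6) X.1 Y.1, fun x =>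
    SmoothAt.mlieBracket (X.2 x) (Y.2 x)⟩
  add_lie X Y Z := by
    ext1; ext1 x
    exact VectorField.mlieBracket_add_left (SmoothAt.diffAt (X.2 x)) (SmoothAt.diffAt (Y.2 x))
  lie_add X Y Z := by
    ext1; ext1 x
    exact VectorField.mlieBracket_add_right (SmoothAt.diffAt (Y.2 x)) (SmoothAt.diffAt (Z.2 x))
  lie_self X := by
    ext1
    exact VectorField.mlieBracket_self
  leibniz_lie X Y Z := by
    have h2 : minSmoothness ℝ 2 ≤ ∞ := by simpa using ENat.LEInfty.out
    ext1; ext1 x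
    exact VectorField.leibniz_identity_mlieBracket_apply ((X.2 x).of_le h2) ((Y.2 x).of_le h2)
      ((Z.2 x).of_le h2)

variable (J) in
/-- The almost complex structure as an endomorphism of the Lie ring of smooth vector fields. -/
def appHom : smoothFields M →+ smoothFields M where
  toFun X := ⟨J.app X.1, fun x => J.smoothAt_app (X.2 x)⟩
  map_zero' := by ext1; ext1 x; exact map_zero (J.toFun x)
  map_add' X Y := by ext1; ext1 x; exact map_add (J.toFun x) _ _

theorem appHom_sq (X : smoothFields M) : appHom J (appHom J X) = -X := by
  ext1; ext1 x
  exact J.sq_eq_neg x _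

theorem nijenhuis_apply (ξ η : Π y : M, TangentSpace (𝓡 6) y) (x : M) :
    J.nijenhuis ξ η x = VectorField.mlieBracket (𝓡 6) ξ η x
      + J.toFun x (VectorField.mlieBracket (𝓡 6) (J.app ξ) η x)
      + J.toFun x (VectorField.mlieBracket (𝓡 6) ξ (J.app η) x)
      - VectorField.mlieBracket (𝓡 6) (J.app ξ) (J.app η) x := rfl

theorem app_apply (ξ : Π y : M, TangentSpace (𝓡 6) y) (x : M) : J.app ξ x = J.toFun x (ξ x) := rfl

theorem nijenhuis_tensorial (ξ : Π y : M, TangentSpace (𝓡 6) y) (x : M) :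
    TensorialAt (𝓡 6) E6 (fun η => J.nijenhuis ξ η x) x where
  smul {f η} hf hη := by
    have hJη : DiffAt (J.app η) x := EndSmoothAt.apply_diffAt (J.smooth x) hη
    have h1 : J.app (f • η) = f • J.app η := by
      ext1 y; exact (J.toFun y).map_smul _ _
    have h2 := J.sq_eq_neg x
    simp only [nijenhuis_apply, h1]
    rw [VectorField.mlieBracket_smul_right hf hη, VectorField.mlieBracket_smul_right hf hη,
      VectorField.mlieBracket_smul_right hf hJη, VectorField.mlieBracket_smul_right hf hJη]
    simp only [map_add, map_smul, app_apply, h2]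
    module
  add {η η'} hη hη' := by
    have hJη : DiffAt (J.app η) x := EndSmoothAt.apply_diffAt (J.smooth x) hη
    have hJη' : DiffAt (J.app η') x := EndSmoothAt.apply_diffAt (J.smooth x) hη'
    have h1 : J.app (η + η') = J.app η + J.app η' := by
      ext1 y; exact (J.toFun y).map_add _ _
    simp only [nijenhuis_apply, h1]
    rw [VectorField.mlieBracket_add_right hη hη', VectorField.mlieBracket_add_right hη hη',
      VectorField.mlieBracket_add_right hJη hJη', VectorField.mlieBracket_add_right hJη hJη']
    simp only [map_add]
    abel

/-- If the tensor `S` vanishes, so does the Nijenhuis tensor on `TM ⊗ D`: by the Jacobi identity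
its values are in the kernel of the Levi form. -/
theorem nijenhuis_eq_zero_of_isSection [T2Space M] (hD : IsElliptic D) (hp : J.Preserves D)
    (hS : ∀ ξ η : Π x : M, TangentSpace (𝓡 6) x, IsSmoothField ξ → D.IsSection η →
      D.Contains (J.halfBracket ξ η)) {ξ η : Π x : M, TangentSpace (𝓡 6) x}
    (hξ : IsSmoothField ξ) (hη : D.IsSection η) : J.nijenhuis ξ η = 0 := by
  let 𝔥 : AddSubgroup (smoothFields M) :=
    { carrier := {X | D.Contains X.1}
      add_mem' := fun hX hY x => (D.fiber x).add_mem (hX x) (hY x)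
      zero_mem' := fun x => (D.fiber x).zero_mem
      neg_mem' := fun hX x => (D.fiber x).neg_mem (hX x) }
  have hlin : ∀ X, ∀ Y ∈ 𝔥, ⁅appHom J X, Y⁆ - appHom J ⁅X, Y⁆ ∈ 𝔥 := fun X Y hY x => by
    have h1 := (D.fiber x).neg_mem (hp x _ (hS X.1 Y.1 X.2 ⟨Y.2, hY⟩ x))
    have h2 : J.halfBracket X.1 Y.1 x = VectorField.mlieBracket (𝓡 6) X.1 Y.1 x +
      J.toFun x (VectorField.mlieBracket (𝓡 6) (J.app X.1) Y.1 x) := rfl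
    rw [h2, map_add, J.sq_eq_neg, neg_add, neg_neg, add_comm, ← sub_eq_add_neg] at h1
    exact h1
  have key : ∀ ζ : Π x : M, TangentSpace (𝓡 6) x, D.IsSection ζ →
      D.Contains (J.nijenhuis ξ η) ∧
      D.Contains (2 • VectorField.mlieBracket (𝓡 6) (J.nijenhuis ξ η) ζ) := fun ζ hζ =>
    two_lie_lieNijenhuis_mem (J := appHom J) appHom_sq (𝔥 := 𝔥) (fun X hX x => hp x _ (hX x)) hlin
      ⟨ξ, hξ⟩ (y := ⟨η, hη.1⟩) (z := ⟨ζ, hζ.1⟩) hη.2 hζ.2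
  have hN : D.IsSection (J.nijenhuis ξ η) :=
    ⟨(lieNijenhuis (appHom J) ⟨ξ, hξ⟩ ⟨η, hη.1⟩).2, (key η hη).1⟩
  ext1 x
  refine congrArg Subtype.val ((hD.nondegenerate x).eq_zero (v := ⟨_, hN.2 x⟩) ?_)
  rintro ⟨v, hv⟩
  obtain ⟨ζ, hζ, rfl⟩ := D.exists_isSection hv
  rw [D.leviForm_apply x _ ζ _ _ (hN.isSectionAt x) (hζ.isSectionAt x) rfl rfl]
  have h1 : (2 : ℕ) • VectorField.mlieBracket (𝓡 6) (J.nijenhuis ξ η) ζ x ∈ D.fiber x :=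
    (key ζ hζ).2 x
  rw [← Nat.cast_smul_eq_nsmul ℝ] at h1
  exact (Submodule.Quotient.mk_eq_zero _).2
    (((D.fiber x).smul_mem_iff (by norm_num)).1 h1)

theorem nijenhuis_skew {ξ η : Π x : M, TangentSpace (𝓡 6) x} (hξ : IsSmoothField ξ)
    (hη : IsSmoothField η) : J.nijenhuis ξ η = -J.nijenhuis η ξ :=
  congrArg Subtype.val (lieNijenhuis_skew (appHom J) ⟨ξ, hξ⟩ ⟨η, hη⟩)

/-- The Nijenhuis tensor vanishes if it does so on `TM ⊗ D`, because `TM/D` is a complex line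
bundle, and `N(ξ, ξ) = N(ξ, Jξ) = 0`. -/
theorem nijenhuisVanishes_of_isSection [T2Space M] (hp : J.Preserves D)
    (h : ∀ ξ η : Π x : M, TangentSpace (𝓡 6) x, IsSmoothField ξ → D.IsSection η →
      J.nijenhuis ξ η = 0) : J.NijenhuisVanishes := by
  intro ξ η hξ hη
  ext1 x
  have hφ : ∀ ξ : Π x : M, TangentSpace (𝓡 6) x, IsSmoothField ξ →
      ∃ φ : TangentSpace (𝓡 6) x →ₗ[ℝ] TangentSpace (𝓡 6) x, D.fiber x ≤ LinearMap.ker φ ∧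
        ∀ η : Π x : M, TangentSpace (𝓡 6) x, IsSmoothField η →
          φ (η x) = J.nijenhuis ξ η x := fun ξ hξ => by
    obtain ⟨φ, hφ⟩ := TensorialAt.exists_linearMap (nijenhuis_tensorial (J := J) ξ x)
    refine ⟨φ, fun v hv => ?_, fun η hη => hφ η (SmoothAt.diffAt (hη x))⟩
    obtain ⟨ζ, hζ, rfl⟩ := D.exists_isSection hv
    rw [LinearMap.mem_ker, hφ ζ (SmoothAt.diffAt (hζ.1 x)), h ξ ζ hξ hζ]
    rfl
  change J.nijenhuis ξ η x = 0
  by_cases hx : ξ x ∈ D.fiber x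
  · obtain ⟨φ, hφD, hφ⟩ := hφ η hη
    have h1 := hφ ξ hξ
    rw [LinearMap.mem_ker.1 (hφD hx)] at h1
    rw [nijenhuis_skew hξ hη, Pi.neg_apply, ← h1, neg_zero]
  · obtain ⟨φ, hφD, hφ⟩ := hφ ξ hξ
    have h1 : φ (ξ x) = 0 := by
      rw [hφ ξ hξ]
      exact congrFun (congrArg Subtype.val (lieNijenhuis_self (appHom J) ⟨ξ, hξ⟩)) x
    have h2 : φ (J.toFun x (ξ x)) = 0 := by
      have h3 := congrFun (congrArg Subtype.val
        (lieNijenhuis_apply_right (J := appHom J) appHom_sq ⟨ξ, hξ⟩ ⟨ξ, hξ⟩)) x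
      rw [lieNijenhuis_self, map_zero, neg_zero] at h3
      exact (hφ (J.app ξ) fun y => J.smoothAt_app (hξ y)).trans h3
    have hψ : (D.fiber x).liftQ φ hφD = 0 := by
      have hli := linearIndependent_mkQ_pair (J.sq_eq_neg x) (hp x) hx
      refine LinearMap.ext_on_range
        (hli.span_eq_top_of_card_eq_finrank (by simp [D.finrank_quot])) fun i => ?_
      fin_cases i
      · exact h1
      · exact h2
    rw [← hφ η hη]
    exact LinearMap.congr_fun hψ ((D.fiber x).mkQ (η x))

theorem IsAdapted.halfBracket_iff_nijenhuisVanishes [T2Space M] (hD : IsElliptic D)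
    (h : IsAdapted o D J) :
    (∀ ξ η : Π x : M, TangentSpace (𝓡 6) x, IsSmoothField ξ → D.IsSection η →
      D.Contains (J.halfBracket ξ η)) ↔ J.NijenhuisVanishes := by
  refine ⟨fun hS => nijenhuisVanishes_of_isSection h.preserves fun ξ η hξ hη =>
    nijenhuis_eq_zero_of_isSection hD h.preserves hS hξ hη, fun hN ξ η hξ hη x => ?_⟩
  -- the Nijenhuis tensor and the full bracket add up to twice the half bracket
  have h1 : (2 : ℝ) • J.halfBracket ξ η x = J.nijenhuis ξ η x + J.fullBracket ξ η x := by
    simp only [AlmostComplexStructure.halfBracket, AlmostComplexStructure.nijenhuis,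
      AlmostComplexStructure.fullBracket, Pi.add_apply, Pi.sub_apply]
    module
  rw [hN ξ η hξ hη.1, Pi.zero_apply, zero_add] at h1
  have h2 : (2 : ℝ) • J.halfBracket ξ η x ∈ D.fiber x := by
    rw [h1]
    exact h.bracket ξ η hξ hη x
  exact ((D.fiber x).smul_mem_iff two_ne_zero).1 h2

end SixDim

end

theorem mainTheorem1 {M : Type*} [TopologicalSpace M] [T2Space M]
    [ChartedSpace SixDim.E6 M] [IsManifold (𝓡 6) ∞ M]
    (o : SixDim.ManifoldOrientation M) (D : SixDim.Distribution M 4)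
    (hD : SixDim.IsElliptic D) :
    (∃! J : SixDim.AlmostComplexStructure M, SixDim.IsAdapted o D J) ∧
    (∀ (J : SixDim.AlmostComplexStructure M) (hJ : J.Preserves D),
      SixDim.AlmostComplexStructure.LeviComplexBilinear hJ ↔
        ∀ ξ η : Π x : M, TangentSpace (𝓡 6) x,
          D.IsSection ξ → D.IsSection η → D.Contains (J.halfBracket ξ η)) ∧
    (∀ J : SixDim.AlmostComplexStructure M, SixDim.IsAdapted o D J →
      (∃! S : Π x : M, D.Quot x ⊗[ℝ] D.fiber x →ₗ[ℝ] D.Quot x, SixDim.IsInducedTensor D J S) ∧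
      ∀ S : Π x : M, D.Quot x ⊗[ℝ] D.fiber x →ₗ[ℝ] D.Quot x, SixDim.IsInducedTensor D J S →
        ((∀ x, S x = 0) ↔ J.NijenhuisVanishes)) := by
  refine ⟨SixDim.existsUnique_isAdapted o hD,
    fun J hJ => J.leviComplexBilinear_iff hJ, fun J hJ => ⟨hJ.existsUnique_isInducedTensor, ?_⟩⟩
  intro S hS
  exact hS.eq_zero_iff.trans (hJ.halfBracket_iff_nijenhuisVanishes hD)
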